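/- **Models.** A machine word on inputs with $n$ nodes has $\kappa(\lfloor\log_2 n\rfloor+1)=\Theta(\log n)$ bits, where $\kappa\ge 2$ is a fixed constant. A *graph problem* is a set of inputs $I$ (an $n$-node graph whose nodes have distinct one-word identifiers, with a constant number of words as label on every node and edge), together with a set of legal outputs for each input. An output is a finite set of items (strings of words) of total size polynomial in $n$. A distributed algorithm *solves* the problem if on every input, and for every admissible distribution of the input, the items reported by all machines together form a legal output $s$, each item of $s$ being reported by at least one machine, with total reported length $O(|s|)$. In $\mathrm{MPC}(M,S)$ there are $M$ machines with identifiers $0,\dots,M-1$ that run the same constant-size program. Each has a memory of $O(S)$ words, and sends and receives at most $S$ words per round. The edges of the input (with labels) are distributed adversarially, at most $S$ per machine, and $MS\ge |E|$ is required. In $\mathrm{NCC}(C)$ the machines are the $n$ nodes of the input graph; each node initially knows the set of all identifiers, its neighbors, its own label and the labels of its incident edges, and sends and receives at most $C$ words per round; local computation is unrestricted. In both models capacities must never be violated, and all algorithms are deterministic. For functions $M,S,C$ of $n$ and a family $\mathcal P$ of graph problems, $\mathrm{MPC}(M,S)\le_{\mathcal P}\mathrm{NCC}(C)$ means: for every $\Pi\in\mathcal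 P$ and every $\mathrm{MPC}(M,S)$ algorithm that solves $\Pi$ in $T(n)$ rounds, some $\mathrm{NCC}(C)$ algorithm solves $\Pi$ on all sufficiently large inputs in $O(T(n))$ rounds. For $a:\mathbb N\to\mathbb N$ let $\mathcal P_a$ be the family of graph problems whose $n$-node input graphs have arboricity at most $a(n)$. For $a\in\mathbb N$ let $\mathcal G_a$ be the set of lollipop graphs obtained from the path $1,2,\dots,a^3$ by adding an arbitrary set of further edges among the last $a$ vertices. The random lollipop graph adds each such missing edge independently with probability $1/2$. **Theorem.** Let $\kappa\ge 2$. 1. There is a constant $c>0$ such that for every $a=a(n)\in\Omega(n^{1/3})$ with $a(n)\le (n+1)/2$ for all large $n$, and all $M=M(n)$, $S=S(n)$ with $$ n\le MS\le \frac{a\,n}{c\log n}\quad\text{for all large } n,$$ we have $\mathrm{MPC}(M,S)\not\le_{\mathcal P_a}\mathrm{NCC}(\lfloor MS/n\rfloor)$: there is no simulation with constant slowdown. Moreover, triangle listing on lollipop graphs (every triangle must be reported by at least one machine; the input is promised to be in $\mathcal G_a$; $n=a^3$) has the following properties. 2. Every graph in $\mathcal G_a$ has arboricity at most $a$. 3.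 There is a constant $K$ such that for every $\delta\in(0,1)$ there is one MPC algorithm that, for all sufficiently large $a$ and all $M,S\le n^{\kappa}$ with $S\ge n^{\delta}$ and $MS\ge Kn$, lists all triangles of every graph in $\mathcal G_a$ in $\mathrm{MPC}(M,S)$ in at most $K/\delta$ rounds. 4. There is a constant $c'>0$ such that for all sufficiently large $a$ and every $C\ge 1$, every $\mathrm{NCC}(C)$ algorithm that lists all triangles of every graph in $\mathcal G_a$ takes at least $c'\,\dfrac{a}{C\log n}$ rounds in expectation on the random lollipop graph. 5. Hence for every $t\in\mathbb N$ there is $c>0$ such that for all sufficiently large $a$ and all $M,S$ with $n\le MS\le \frac{a n}{c\log n}$, every $\mathrm{NCC}(\lfloor MS/n\rfloor)$ algorithm that lists all triangles of every graph in $\mathcal G_a$ takes more than $t$ rounds on some graph in $\mathcal G_a$. -/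

import Mathlib

namespace DistSim

/-! ### Machine words, graph problems -/

/-- Machine words on inputs with `n` nodes are the naturals below this bound, i.e. bit strings of
`κ · (⌊log₂ n⌋ + 1) = Θ(log n)` bits. The constant `κ` is shared by both models. -/
def wordBound (κ n : ℕ) : ℕ := 2 ^ (κ * Nat.size n)

/-- An input: a finite graph, whose vertices are natural numbers and serve as their own identifiers,
with labels (lists of words) on the nodes and the edges. -/
structure Instance where
  V : Finset ℕ
  G : SimpleGraph ℕ
  mem_of_adj : ∀ u v, G.Adj u v → u ∈ V
  nodeLabel : ℕ → List ℕ
  edgeLabel : Sym2 ℕ → List ℕ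

/-- The number of nodes. -/
def Instance.n (I : Instance) : ℕ := I.V.card

open Classical in
/-- The identifiers of the neighbours of `v`. -/
noncomputable def Instance.nbrs (I : Instance) (v : ℕ) : Finset ℕ :=
  I.V.filter fun u => I.G.Adj v u

open Classical in
/-- The labels of the edges at `v`, indexed by the other endpoint. -/
noncomputable def Instance.incidentLabel (I : Instance) (v u : ℕ) : List ℕ :=
  if I.G.Adj v u then I.edgeLabel s(v, u) else []

/-- Number of words of an output. An output is a finite set of items, an item is a list of words. -/
def outSize (s : Finset (List ℕ)) : ℕ := ∑ x ∈ s, x.length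

/-- A graph problem: a set of inputs, and for every input the set of legal outputs.
Identifiers are words, nodes and edges carry a constant number `labelWords` of words as labels, and
legal outputs have polynomial size. -/
structure GraphProblem (κ : ℕ) where
  instances : Set Instance
  legal : Instance → Set (Finset (List ℕ))
  labelWords : ℕ
  outExp : ℕ
  id_lt : ∀ I ∈ instances, ∀ v ∈ I.V, v < wordBound κ I.n
  nodeLabel_words : ∀ I ∈ instances, ∀ v ∈ I.V,
    (I.nodeLabel v).length = labelWords ∧ ∀ x ∈ I.nodeLabel v, x < wordBound κ I.n
  edgeLabel_words : ∀ I ∈ instances, ∀ e ∈ I.G.edgeSet,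
    (I.edgeLabel e).length = labelWords ∧ ∀ x ∈ I.edgeLabel e, x < wordBound κ I.n
  legal_size : ∀ I ∈ instances, ∀ s ∈ legal I, outSize s ≤ (I.n + 1) ^ outExp

/-- The items `out` output by all machines together represent the solution `s`: every item of `s` is
reported by at least one machine, nothing else is reported, and the total length is at most
`d` times the size of `s`. -/
def Represents (out : List (List ℕ)) (s : Finset (List ℕ)) (d : ℕ) : Prop :=
  out.toFinset = s ∧ (out.map List.length).sum ≤ d * outSize s

/-- The inbox of machine `i`, where `outbox j` lists the messages (destination, word) sent by `j`:
the pairs (sender, word) addressed to `i`, ordered by sender and then by order of sending.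
Every message carries one word. -/
def deliver (ids : List ℕ) (outbox : ℕ → List (ℕ × ℕ)) (i : ℕ) : List (ℕ × ℕ) :=
  ids.flatMap fun j => ((outbox j).filter fun m => m.1 = i).map fun m => (j, m.2)

/-! ### The MPC model

All machines run the same constant-size program, a while-program over a random access memory
of `O(S)` words. -/

/-- Expressions over words: constants, the parameters `n`, `M`, `S`, the own identifier, the
(read-only) input and inbox, indirect memory access and arithmetic. -/
inductive WExpr
  | const (k : ℕ)
  | numNodes
  | numMachines
  | memSize
  | ownId
  | inputLen
  | input (i : WExpr)
  | inboxLen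
  | inboxSender (i : WExpr)
  | inboxWord (i : WExpr)
  | load (addr : WExpr)
  | add (x y : WExpr)
  | sub (x y : WExpr)
  | mul (x y : WExpr)
  | div (x y : WExpr)
  | mod (x y : WExpr)
  | lt (x y : WExpr)

/-- Programs. -/
inductive Prog
  | skip
  | store (addr val : WExpr)
  | send (dest word : WExpr)
  | emit (item : List WExpr)
  | halt
  | seq (p q : Prog)
  | ite (cond : WExpr) (p q : Prog)
  | while (cond : WExpr) (p : Prog)

/-- What a machine reads but cannot change during the local computation of a round. -/
structure Env where
  n : ℕ
  M : ℕ
  S : ℕ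
  id : ℕ
  input : List ℕ
  inbox : List (ℕ × ℕ)

/-- The state of a machine: its memory, the messages sent in the current round, the items it has
output so far, and whether it has halted. -/
structure Machine where
  mem : ℕ → ℕ
  outbox : List (ℕ × ℕ)
  out : List (List ℕ)
  halted : Bool

/-- Value of an expression (truncated subtraction, `x / 0 = 0`, comparisons give `0` or `1`). -/
def WExpr.eval (E : Env) (mem : ℕ → ℕ) : WExpr → ℕ
  | const k => k
  | numNodes => E.n
  | numMachines => E.M
  | memSize => E.S
  | ownId => E.id
  | inputLen => E.input.length
  | input i => E.input.getD (i.eval E mem) 0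
  | inboxLen => E.inbox.length
  | inboxSender i => (E.inbox.getD (i.eval E mem) (0, 0)).1
  | inboxWord i => (E.inbox.getD (i.eval E mem) (0, 0)).2
  | load a => mem (a.eval E mem)
  | add x y => x.eval E mem + y.eval E mem
  | sub x y => x.eval E mem - y.eval E mem
  | mul x y => x.eval E mem * y.eval E mem
  | div x y => x.eval E mem / y.eval E mem
  | mod x y => x.eval E mem % y.eval E mem
  | lt x y => if x.eval E mem < y.eval E mem then 1 else 0

/-- `Exec E W B p m m'`: program `p`, started in state `m`, terminates in state `m'` using only words
below `W`, memory cells below `B`, and destinations below the number of machines. -/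
inductive Exec (E : Env) (W B : ℕ) : Prog → Machine → Machine → Prop
  | skip (m : Machine) : Exec E W B .skip m m
  | store (addr val : WExpr) (m : Machine)
      (ha : addr.eval E m.mem < B) (hv : val.eval E m.mem < W) :
      Exec E W B (.store addr val) m
        { m with mem := Function.update m.mem (addr.eval E m.mem) (val.eval E m.mem) }
  | send (dest word : WExpr) (m : Machine)
      (hd : dest.eval E m.mem < E.M) (hw : word.eval E m.mem < W) :
      Exec E W B (.send dest word) m
        { m with outbox := m.outbox ++ [(dest.eval E m.mem, word.eval E m.mem)] }
  | emit (item : List WExpr) (m : Machine) (h : ∀ x ∈ item, x.eval E m.mem < W) :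
      Exec E W B (.emit item) m
        { m with out := m.out ++ [item.map fun x => x.eval E m.mem] }
  | halt (m : Machine) : Exec E W B .halt m { m with halted := true }
  | seq (p q : Prog) (m₁ m₂ m₃ : Machine) (hp : Exec E W B p m₁ m₂) (hq : Exec E W B q m₂ m₃) :
      Exec E W B (.seq p q) m₁ m₃
  | iteTrue (cond : WExpr) (p q : Prog) (m m' : Machine)
      (hc : cond.eval E m.mem ≠ 0) (hp : Exec E W B p m m') :
      Exec E W B (.ite cond p q) m m'
  | iteFalse (cond : WExpr) (p q : Prog) (m m' : Machine)
      (hc : cond.eval E m.mem = 0) (hq : Exec E W B q m m') :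
      Exec E W B (.ite cond p q) m m'
  | whileTrue (cond : WExpr) (p : Prog) (m₁ m₂ m₃ : Machine)
      (hc : cond.eval E m₁.mem ≠ 0) (hp : Exec E W B p m₁ m₂)
      (hr : Exec E W B (.while cond p) m₂ m₃) :
      Exec E W B (.while cond p) m₁ m₃
  | whileFalse (cond : WExpr) (p : Prog) (m : Machine) (hc : cond.eval E m.mem = 0) :
      Exec E W B (.while cond p) m m

/-- An MPC algorithm: the program that every machine runs in every round, the constant in the
memory bound `O(S)`, and the constant in the bound on the length of the output representation. -/
structure MPCAlgorithm where
  prog : Prog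
  memFactor : ℕ
  outFactor : ℕ

/-- `inp i` lists the edges given to machine `i`: at most `S` per machine, every edge on exactly one
machine (written in either orientation), and otherwise arbitrarily distributed. -/
def IsMPCInput (I : Instance) (M S : ℕ) (inp : ℕ → List (ℕ × ℕ)) : Prop :=
  (∀ i < M, (inp i).length ≤ S) ∧
  (((List.range M).flatMap inp).map fun p => s(p.1, p.2)).Nodup ∧
  ∀ e : Sym2 ℕ, e ∈ (((List.range M).flatMap inp).map fun p => s(p.1, p.2)) ↔ e ∈ I.G.edgeSet

/-- The words describing a list of edges: endpoints, labels of the endpoints, label of the edge. -/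
def inputWords (I : Instance) (L : List (ℕ × ℕ)) : List ℕ :=
  L.flatMap fun p =>
    [p.1, p.2] ++ I.nodeLabel p.1 ++ I.nodeLabel p.2 ++ I.edgeLabel s(p.1, p.2)

/-- The environment of machine `i` when the outboxes of the previous round are those of `c`. -/
def mpcEnv (I : Instance) (M S : ℕ) (inp : ℕ → List (ℕ × ℕ)) (c : ℕ → Machine) (i : ℕ) : Env where
  n := I.n
  M := M
  S := S
  id := i
  input := inputWords I (inp i)
  inbox := deliver (List.range M) (fun j => (c j).outbox) i

/-- One round of machine `i`: it receives the messages of the previous round and runs the program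
(which may send messages); a halted machine does nothing. -/
def mpcStep (κ : ℕ) (A : MPCAlgorithm) (I : Instance) (M S : ℕ) (inp : ℕ → List (ℕ × ℕ))
    (c : ℕ → Machine) (i : ℕ) (m' : Machine) : Prop :=
  if (c i).halted then m' = { c i with outbox := [] }
  else Exec (mpcEnv I M S inp c i) (wordBound κ I.n) (A.memFactor * S) A.prog
    { c i with outbox := [] } m'

/-- `conf 0, …, conf T` is the execution of `A` during `T` rounds, and respects all capacities: a
machine sends at most `S` words and receives at most `S` words per round, and its output has at most
`O(S)` words. (The memory bound is part of the execution of the program.) -/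
def IsMPCRun (κ : ℕ) (A : MPCAlgorithm) (I : Instance) (M S : ℕ) (inp : ℕ → List (ℕ × ℕ)) (T : ℕ)
    (conf : ℕ → ℕ → Machine) : Prop :=
  (∀ i, conf 0 i = ⟨fun _ => 0, [], [], false⟩) ∧
  (∀ r < T, ∀ i < M, mpcStep κ A I M S inp (conf r) i (conf (r + 1) i)) ∧
  (∀ r ≤ T, ∀ i < M, (conf r i).outbox.length ≤ S ∧
    (deliver (List.range M) (fun j => (conf r j).outbox) i).length ≤ S ∧
    ((conf r i).out.map List.length).sum ≤ A.memFactor * S)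

/-- `A` solves `Π` in `MPC(M, S)` within `T` rounds (`M`, `S`, `T` depend on the number of nodes):
the parameters and machine identifiers are words, the total memory can hold the input, and for every
instance and every distribution of its edges the run of `A` respects the capacities, all
machines halt within `T` rounds, and the outputs represent a legal solution. -/
def MPCSolves {κ : ℕ} (A : MPCAlgorithm) (P : GraphProblem κ) (M S : ℕ → ℕ) (T : ℕ → ℕ) : Prop :=
  ∀ I ∈ P.instances,
    M I.n < wordBound κ I.n ∧ S I.n < wordBound κ I.n ∧
    I.G.edgeSet.ncard ≤ M I.n * S I.n ∧
    ∀ inp, IsMPCInput I (M I.n) (S I.n) inp →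
      ∃ conf, IsMPCRun κ A I (M I.n) (S I.n) inp (T I.n) conf ∧
        (∀ i < M I.n, (conf (T I.n) i).halted = true) ∧
        ∃ s ∈ P.legal I,
          Represents ((List.range (M I.n)).flatMap fun i => (conf (T I.n) i).out) s A.outFactor

/-! ### The node-capacitated clique -/

/-- An NCC algorithm. Local computations are arbitrary functions. A node initially knows
the set of all identifiers, its own identifier, the identifiers of its neighbours, its own label and
the labels of its incident edges. In every round each node sends the messages
(destination, word) given by `send`, and updates its state with the received pairs (sender, word).
A node has terminated once `output` is defined. -/
structure NCCAlgorithm where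
  State : Type
  init : (ids : Finset ℕ) → (self : ℕ) → (nbrs : Finset ℕ) → (label : List ℕ) →
    (edgeLabels : ℕ → List ℕ) → State
  send : State → List (ℕ × ℕ)
  update : State → List (ℕ × ℕ) → State
  output : State → Option (List (List ℕ))
  outFactor : ℕ

/-- The inbox of node `v`, when the nodes are in the states `c`. -/
def NCCAlgorithm.inbox (A : NCCAlgorithm) (I : Instance) (c : ℕ → A.State) (v : ℕ) :
    List (ℕ × ℕ) :=
  deliver I.V.sort (fun u => A.send (c u)) v

/-- The states of the nodes after `r` rounds. -/
noncomputable def NCCAlgorithm.conf (A : NCCAlgorithm) (I : Instance) : ℕ → ℕ → A.State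
  | 0, v => A.init I.V v (I.nbrs v) (I.nodeLabel v) (I.incidentLabel v)
  | r + 1, v => A.update (A.conf I r v) (A.inbox I (A.conf I r) v)

/-- `A` solves `Π` in `NCC(C)`, and on instance `I` it takes exactly `τ I` rounds until all nodes have
terminated: no node ever sends or receives more than `C` words per round, outputs are irrevocable, and
the outputs represent a legal solution. -/
def NCCSolves {κ : ℕ} (A : NCCAlgorithm) (P : GraphProblem κ) (C : ℕ → ℕ) (τ : Instance → ℕ) :
    Prop :=
  ∀ I ∈ P.instances,
    (∀ r < τ I, ∀ v ∈ I.V,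
      (A.send (A.conf I r v)).length ≤ C I.n ∧
      (∀ m ∈ A.send (A.conf I r v), m.1 ∈ I.V ∧ m.2 < wordBound κ I.n) ∧
      (A.inbox I (A.conf I r) v).length ≤ C I.n) ∧
    (∀ v ∈ I.V, (A.output (A.conf I (τ I) v)).isSome) ∧
    (∀ r < τ I, ∃ v ∈ I.V, A.output (A.conf I r v) = none) ∧
    (∀ v ∈ I.V, ∀ r ≤ τ I, ∀ o, A.output (A.conf I r v) = some o →
      A.output (A.conf I (τ I) v) = some o) ∧
    ∃ s ∈ P.legal I,
      Represents (I.V.sort.flatMap fun v => (A.output (A.conf I (τ I) v)).getD []) s A.outFactor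

/-! ### Simulation -/

/-- The problem `Π` restricted to instances with at least `N` nodes. -/
def GraphProblem.restrict {κ : ℕ} (P : GraphProblem κ) (N : ℕ) : GraphProblem κ where
  instances := {I | I ∈ P.instances ∧ N ≤ I.n}
  legal := P.legal
  labelWords := P.labelWords
  outExp := P.outExp
  id_lt := fun I hI => P.id_lt I hI.1
  nodeLabel_words := fun I hI => P.nodeLabel_words I hI.1
  edgeLabel_words := fun I hI => P.edgeLabel_words I hI.1
  legal_size := fun I hI => P.legal_size I hI.1

/-- An algorithm that solves `P` within `T` rounds can be simulated in `NCC(C)` with slowdown `t`: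
some NCC algorithm solves `P` in `O(t · T)` rounds (for all sufficiently large inputs). -/
def SimulableInNCC {κ : ℕ} (P : GraphProblem κ) (T : ℕ → ℕ) (t C : ℕ → ℕ) : Prop :=
  ∃ (K N : ℕ) (A : NCCAlgorithm) (τ : Instance → ℕ),
    NCCSolves A (P.restrict N) C τ ∧
    ∀ I ∈ (P.restrict N).instances, τ I ≤ K * (t I.n * T I.n)

/-- `MPC(M, S) ≤_{𝓟, t} NCC(C)`: every algorithm that solves some problem of the family `𝓟` in
`MPC(M, S)` can be simulated in `NCC(C)` with slowdown `t`. -/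
def MPCLeNCC {κ : ℕ} (𝓟 : Set (GraphProblem κ)) (t M S C : ℕ → ℕ) : Prop :=
  ∀ P ∈ 𝓟, ∀ (A : MPCAlgorithm) (T : ℕ → ℕ), MPCSolves A P M S T → SimulableInNCC P T t C

/-! ### Arboricity -/

/-- The edge set of `G` is the union of `k` edge-disjoint forests. -/
def IsUnionOfForests (G : SimpleGraph ℕ) (k : ℕ) : Prop :=
  ∃ F : Fin k → SimpleGraph ℕ, (∀ i, (F i).IsAcyclic) ∧
    (∀ i j, i ≠ j → Disjoint (F i) (F j)) ∧ (⨆ i, F i) = G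

/-- The arboricity of `G`. -/
noncomputable def arboricity (G : SimpleGraph ℕ) : ℕ∞ :=
  ⨅ (k : ℕ) (_ : IsUnionOfForests G k), (k : ℕ∞)

/-- The family of graph problems whose `n`-node input graphs have arboricity at most `a n`. -/
def boundedArboricity (κ : ℕ) (a : ℕ → ℕ) : Set (GraphProblem κ) :=
  {P | ∀ I ∈ P.instances, arboricity I.G ≤ a I.n}

/-! ### Triangle listing on lollipop graphs -/

/-- The pairs among the last `a` vertices of the path `1, …, a ^ 3` that are not path edges. -/
def freePairs (a : ℕ) : Finset (ℕ × ℕ) :=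
  (Finset.Ioc (a ^ 3 - a) (a ^ 3) ×ˢ Finset.Ioc (a ^ 3 - a) (a ^ 3)).filter
    fun p => p.1 + 1 < p.2

/-- The path on the vertices `1, …, a ^ 3` together with the edges `B` among its last `a` vertices. -/
def lollipopGraph (a : ℕ) (B : Finset (ℕ × ℕ)) : SimpleGraph ℕ :=
  SimpleGraph.fromRel fun u v =>
    (1 ≤ u ∧ v = u + 1 ∧ v ≤ a ^ 3) ∨ ((u, v) ∈ B ∧ (u, v) ∈ freePairs a)

theorem lollipopGraph_mem (a : ℕ) (B : Finset (ℕ × ℕ)) (u v : ℕ)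
    (h : (lollipopGraph a B).Adj u v) : u ∈ Finset.Icc 1 (a ^ 3) := by
  simp only [lollipopGraph, SimpleGraph.fromRel_adj, freePairs, Finset.mem_filter,
    Finset.mem_product, Finset.mem_Ioc] at h
  rw [Finset.mem_Icc]
  omega

/-- The (unlabelled) instance given by a lollipop graph. -/
def lollipop (a : ℕ) (B : Finset (ℕ × ℕ)) : Instance where
  V := Finset.Icc 1 (a ^ 3)
  G := lollipopGraph a B
  mem_of_adj := lollipopGraph_mem a B
  nodeLabel := fun _ => []
  edgeLabel := fun _ => []

open Classical in
/-- The set of all triangles `u < v < w` of the input graph. -/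
noncomputable def triangles (I : Instance) : Finset (List ℕ) :=
  ((I.V ×ˢ I.V ×ˢ I.V).filter fun p =>
    p.1 < p.2.1 ∧ p.2.1 < p.2.2 ∧ I.G.Adj p.1 p.2.1 ∧ I.G.Adj p.2.1 p.2.2 ∧ I.G.Adj p.1 p.2.2).image
      fun p => [p.1, p.2.1, p.2.2]

theorem outSize_triangles (I : Instance) : outSize (triangles I) ≤ (I.n + 1) ^ 5 := by
  classical
  have h1 : outSize (triangles I) ≤ (triangles I).card * 3 := by
    unfold outSize
    apply Finset.sum_le_card_nsmul
    intro x hx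
    simp only [triangles, Finset.mem_image] at hx
    obtain ⟨p, -, rfl⟩ := hx
    simp
  have h2 : (triangles I).card ≤ I.n ^ 3 := by
    refine Finset.card_image_le.trans ((Finset.card_filter_le _ _).trans ?_)
    simp only [Finset.card_product, Instance.n]
    exact le_of_eq (by ring)
  calc outSize (triangles I) ≤ I.n ^ 3 * 3 := h1.trans (Nat.mul_le_mul_right 3 h2)
    _ ≤ (I.n + 1) ^ 5 := by
      rcases Nat.eq_zero_or_pos I.n with h | h
      · simp [h]
      · have h3 : I.n ^ 3 ≤ (I.n + 1) ^ 3 := Nat.pow_le_pow_left (Nat.le_succ _) 3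
        have h4 : 3 ≤ (I.n + 1) ^ 2 := by nlinarith
        calc I.n ^ 3 * 3 ≤ (I.n + 1) ^ 3 * (I.n + 1) ^ 2 := Nat.mul_le_mul h3 h4
          _ = (I.n + 1) ^ 5 := by ring

/-- Triangle listing, when the input is promised to be a lollipop graph with parameter `a ∈ 𝒜`:
every triangle has to be reported. -/
noncomputable def lollipopTriangles (κ : ℕ) (hκ : 1 ≤ κ) (𝒜 : Set ℕ) : GraphProblem κ where
  instances := {I | ∃ a ∈ 𝒜, ∃ B ∈ (freePairs a).powerset, I = lollipop a B}
  legal := fun I => {triangles I}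
  labelWords := 0
  outExp := 5
  id_lt := by
    rintro I ⟨a, -, B, -, rfl⟩ v hv
    have h1 : v ≤ a ^ 3 := (Finset.mem_Icc.mp hv).2
    have h2 : (lollipop a B).n = a ^ 3 := by simp [lollipop, Instance.n]
    rw [h2]
    calc v ≤ a ^ 3 := h1
      _ < 2 ^ Nat.size (a ^ 3) := Nat.lt_size_self _
      _ ≤ wordBound κ (a ^ 3) :=
        Nat.pow_le_pow_right (by norm_num) (Nat.le_mul_of_pos_left _ hκ)
  nodeLabel_words := by
    rintro I ⟨a, -, B, -, rfl⟩ v -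
    simp [lollipop]
  edgeLabel_words := by
    rintro I ⟨a, -, B, -, rfl⟩ e -
    simp [lollipop]
  legal_size := by
    rintro I - s rfl
    exact outSize_triangles I

/-- The expectation of `τ` over the random lollipop graph with parameter `a`, in which every free
pair is an edge independently with probability `1 / 2` (so every `B ⊆ freePairs a` is equally
likely). -/
noncomputable def lollipopExpectation (a : ℕ) (τ : Instance → ℕ) : ℝ :=
  (∑ B ∈ (freePairs a).powerset, (τ (lollipop a B) : ℝ)) / 2 ^ (freePairs a).card

end DistSim

open DistSim

namespace DistSim

/-! The engine of both lower bounds is an incompressibility count. Let the input be a uniformly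
random ω : ι → α with q = |α|. If a transcript with at most q ^ L possible values, together with
coordinates already known, determines a set Q of further coordinates and their values, then |Q| is
at most L + 1 on average (`sum_card_certificate_le`). In an NCC run, all information about ω sits
initially in a small set of core nodes. A core node learns something new only through its own inbox.
All other nodes together learn only what the core sends, whatever they tell each other. So in t
rounds the whole network can reveal only O(|core| · C · ℓ · t) coordinates that the revealing node
did not know at the start, where one message is worth ℓ coordinates (`ncc_sum_revealed_le`).

For the random lollipop graph the coordinates are the bits of the free pairs. Whoever reports a
triangle reveals at least one pair not incident to itself, because a node lies on only two sides of
a triangle. A pair lies in O(a) triangles, whereas Θ(a ^ 3) triangles are expected, so Ω(a ^ 2) bits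
must be revealed. With a core nodes and ℓ = Θ(log n) bits per message this forces Ω(a / (C log n))
rounds in expectation.

The failure of constant-slowdown simulation is derived from a simpler problem: report every edge of
a k-clique along with the labels of both endpoints and of the edge. In MPC the machine holding an
edge also holds these labels, so one round without communication suffices (`reportEdges_solves`). In
NCC an endpoint lacks the label of the other endpoint, and any other node lacks the edge label.
Hence Ω(k ^ 2) labels must travel. A label is one full word, so a message is worth only ℓ = 2
coordinates and no logarithm is lost: k = O(C t) is forced (`clique_ncc_bound`). With k = min(a,
√(MS)) and C = MS / n the assumed bound on MS makes k / C unbounded, which excludes every constant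
t.

For the MPC upper bound, each edge among the last a vertices must meet each of the a candidate third
vertices. An edge code is replicated along a b-ary tree of depth T = ⌈1/δ⌉, where b ^ T is between a
and 2a. Every copy then acts as a pair of an edge and a vertex and is sent to the machine in charge
of the resulting triple. A triple is a triangle exactly when three messages arrive. Blocks of
consecutive codes are assigned to machines, S / b codes each during replication and S / 3 codes each
at the end, so no capacity is exceeded and linear total memory is enough. -/

/-! ### Arboricity bounds from colourings of upper neighbours -/

/-- The smallest vertex of a cycle would have two distinct larger neighbours, its successor and its
predecessor on the cycle. -/
theorem isAcyclic_of_upper_unique (G : SimpleGraph ℕ)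
    (h : ∀ u v w, u < v → u < w → G.Adj u v → G.Adj u w → v = w) : G.IsAcyclic := by
  intro v c hc
  obtain ⟨m, hm, hmin⟩ := c.support.toFinset.exists_min_image id
    ⟨v, List.mem_toFinset.mpr c.start_mem_support⟩
  rw [List.mem_toFinset] at hm
  have hc' := (SimpleGraph.Walk.isCycle_rotate hm).mpr hc
  have hle : ∀ x ∈ (c.rotate m hm).support, m ≤ x := fun x hx =>
    hmin x (List.mem_toFinset.mpr ((c.mem_support_rotate_iff m hm).mp hx))
  have hnil := hc'.not_nil
  have h1 := (c.rotate m hm).adj_snd hnil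
  have h2 := (c.rotate m hm).adj_penultimate hnil
  refine hc'.snd_ne_penultimate (h m _ _ ?_ ?_ h1 h2.symm)
  · exact lt_of_le_of_ne (hle _ (SimpleGraph.Walk.getVert_mem_support _ _)) h1.ne
  · exact lt_of_le_of_ne (hle _ (SimpleGraph.Walk.getVert_mem_support _ _)) h2.ne'

/-- If the edges `u < v` can be coloured with `k` colours so that every vertex has at most one upper
neighbour of each colour, then the graph has arboricity at most `k`. -/
theorem arboricity_le_of_coloring (G : SimpleGraph ℕ) (k : ℕ) (col : ℕ → ℕ → ℕ)
    (hk : ∀ u v, u < v → G.Adj u v → col u v < k)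
    (h : ∀ u v w, u < v → u < w → G.Adj u v → G.Adj u w → col u v = col u w → v = w) :
    arboricity G ≤ k := by
  refine iInf₂_le_of_le k ⟨fun i =>
    { Adj := fun u v => G.Adj u v ∧ col (min u v) (max u v) = i
      symm := ⟨fun u v h => by rwa [min_comm, max_comm, G.adj_comm]⟩
      loopless := ⟨fun u h => G.loopless.irrefl u h.1⟩ }, ?_, ?_, ?_⟩ le_rfl
  · intro i
    refine isAcyclic_of_upper_unique _ fun u v w huv huw h1 h2 => ?_
    dsimp only at h1 h2
    rw [min_eq_left huv.le, max_eq_right huv.le] at h1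
    rw [min_eq_left huw.le, max_eq_right huw.le] at h2
    exact h u v w huv huw h1.1 h2.1 (h1.2.trans h2.2.symm)
  · intro i j hij
    rw [disjoint_iff_inf_le]
    intro u v huv
    exact absurd (Fin.ext (huv.1.2.symm.trans huv.2.2)) hij
  · ext u v
    rw [SimpleGraph.iSup_adj]
    constructor
    · rintro ⟨i, hi, -⟩
      exact hi
    · intro huv
      have : min u v < max u v := by
        rcases lt_or_gt_of_ne huv.ne with h' | h'
        · simpa [min_eq_left h'.le, max_eq_right h'.le] using h'
        · simpa [min_eq_right h'.le, max_eq_left h'.le] using h'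
      refine ⟨⟨col (min u v) (max u v), hk _ _ this ?_⟩, huv, rfl⟩
      rcases le_total u v with h' | h'
      · rwa [min_eq_left h', max_eq_right h']
      · rw [min_eq_right h', max_eq_left h']
        exact huv.symm

theorem lollipopGraph_adj_iff {a : ℕ} {B : Finset (ℕ × ℕ)} {u v : ℕ} (huv : u < v) :
    (lollipopGraph a B).Adj u v ↔
      (1 ≤ u ∧ v = u + 1 ∧ v ≤ a ^ 3) ∨ ((u, v) ∈ B ∧ (u, v) ∈ freePairs a) := by
  simp only [lollipopGraph, SimpleGraph.fromRel_adj, freePairs, Finset.mem_filter,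
    Finset.mem_product, Finset.mem_Ioc]
  grind

theorem mem_freePairs {a u v : ℕ} :
    (u, v) ∈ freePairs a ↔ a ^ 3 - a < u ∧ u + 1 < v ∧ v ≤ a ^ 3 := by
  simp only [freePairs, Finset.mem_filter, Finset.mem_product, Finset.mem_Ioc]
  omega

/-- An edge is coloured by the position of its larger end among the last a vertices. The subtraction
is truncated, so path edges ending before these vertices get colour 0. This is harmless, since a
vertex outside the core has a single upper neighbour. -/
theorem arboricity_lollipop_le (a : ℕ) (B : Finset (ℕ × ℕ)) :
    arboricity (lollipop a B).G ≤ a := by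
  refine arboricity_le_of_coloring _ a (fun _ v => v - (a ^ 3 - a + 1)) ?_ ?_
  · intro u v huv hadj
    have hle : a ≤ a ^ 3 := Nat.le_self_pow (by norm_num) a
    have := (lollipopGraph_adj_iff huv).mp hadj
    rw [mem_freePairs] at this
    have : a ≠ 0 := by rintro rfl; simp at this; omega
    omega
  · intro u v w huv huw h1 h2 h
    have h1' := (lollipopGraph_adj_iff huv).mp h1
    have h2' := (lollipopGraph_adj_iff huw).mp h2
    rw [mem_freePairs] at h1' h2'
    omega

/-! ### Counting configurations by certificates -/

theorem card_agree_mul {ι α : Type*} [Fintype ι] [DecidableEq ι] [Fintype α] [DecidableEq α]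
    (D : Finset ι) (ω₀ : ι → α) :
    (Finset.univ.filter fun ω : ι → α => ∀ i ∈ D, ω₀ i = ω i).card * Fintype.card α ^ D.card =
      Fintype.card α ^ Fintype.card ι := by
  have h : (Finset.univ.filter fun ω : ι → α => ∀ i ∈ D, ω₀ i = ω i) =
      Fintype.piFinset fun i => if i ∈ D then {ω₀ i} else Finset.univ := by
    ext ω
    simp only [Finset.mem_filter, Finset.mem_univ, true_and, Fintype.mem_piFinset]
    refine forall_congr' fun i => ?_
    by_cases hi : i ∈ D <;> simp [hi, eq_comm]
  have h2 : ∀ i, (if i ∈ D then ({ω₀ i} : Finset α) else Finset.univ).card =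
      if i ∈ D then 1 else Fintype.card α := fun i => by
    by_cases hi : i ∈ D <;> simp [hi]
  rw [h, Fintype.card_piFinset, Finset.prod_congr rfl fun i _ => h2 i, Finset.prod_ite,
    Finset.prod_const_one, one_mul, Finset.prod_const, ← pow_add]
  congr 1
  rw [← Finset.compl_filter, Finset.filter_univ_mem, Finset.card_compl]
  exact Nat.sub_add_cancel (Finset.card_le_univ D)

/-- If `key` and the coordinates in `R` determine a set `Q` of further coordinates together with
the values there, and `key` takes at most `X` values, then `Q` is small on average. -/
theorem sum_pow_card_certificate_le {ι α ζ : Type*} [Fintype ι] [DecidableEq ι] [Fintype α]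
    [DecidableEq α] [Nonempty α] [DecidableEq ζ] (R : Finset ι) (𝒢 : Finset (ι → α))
    (key : (ι → α) → ζ) (X : ℕ) (hX : (𝒢.image key).card ≤ X) (Q : (ι → α) → Finset ι)
    (hdisj : ∀ ω ∈ 𝒢, Disjoint R (Q ω))
    (hagree : ∀ ω ∈ 𝒢, ∀ ω' ∈ 𝒢, (∀ i ∈ R, ω i = ω' i) → key ω = key ω' →
      Q ω = Q ω' ∧ ∀ i ∈ Q ω, ω i = ω' i) :
    ∑ ω ∈ 𝒢, Fintype.card α ^ (Q ω).card ≤ X * Fintype.card α ^ Fintype.card ι := by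
  set q := Fintype.card α with hq
  have hq0 : 0 < q := Fintype.card_pos
  let g : (ι → α) → (R → α) × ζ := fun ω => (fun i => ω i, key ω)
  have himg : (𝒢.image g).card ≤ q ^ R.card * X := by
    have hsub : 𝒢.image g ⊆ (Finset.univ : Finset (R → α)) ×ˢ 𝒢.image key := by
      intro b hb
      obtain ⟨ω, hω, rfl⟩ := Finset.mem_image.mp hb
      exact Finset.mem_product.mpr ⟨Finset.mem_univ _, Finset.mem_image_of_mem _ hω⟩
    refine (Finset.card_le_card hsub).trans ?_
    rw [Finset.card_product, Finset.card_univ, Fintype.card_fun, Fintype.card_coe]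
    exact Nat.mul_le_mul_left _ hX
  -- On a fibre of `g` the set `Q` is constant and ω is fixed on the disjoint union of `R` and `Q`.
  -- The fibre thus has at most q ^ (|ι| - |R| - |Q|) elements, which exactly compensates the weight
  -- q ^ |Q|.
  have hfib : ∀ b ∈ 𝒢.image g,
      (∑ ω ∈ 𝒢 with g ω = b, q ^ (Q ω).card) * q ^ R.card ≤ q ^ Fintype.card ι := by
    intro b hb
    obtain ⟨ω₀, hω₀, rfl⟩ := Finset.mem_image.mp hb
    have hmem : ∀ ω ∈ 𝒢.filter (fun ω => g ω = g ω₀),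
        Q ω₀ = Q ω ∧ (∀ i ∈ R ∪ Q ω₀, ω₀ i = ω i) := by
      intro ω hω
      obtain ⟨h1, h2⟩ := Finset.mem_filter.mp hω
      have hR : ∀ i ∈ R, ω₀ i = ω i := fun i hi =>
        (congrFun (congrArg Prod.fst h2) ⟨i, hi⟩).symm
      obtain ⟨h3, h4⟩ := hagree ω₀ hω₀ ω h1 hR (congrArg Prod.snd h2).symm
      refine ⟨h3, fun i hi => ?_⟩
      rcases Finset.mem_union.mp hi with h | h
      · exact hR i h
      · exact h4 i h
    have hsum : (∑ ω ∈ 𝒢 with g ω = g ω₀, q ^ (Q ω).card) =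
        (𝒢.filter fun ω => g ω = g ω₀).card * q ^ (Q ω₀).card := by
      rw [← smul_eq_mul, ← Finset.sum_const]
      exact Finset.sum_congr rfl fun ω hω => by rw [(hmem ω hω).1]
    rw [hsum, mul_assoc, ← pow_add, add_comm, ← Finset.card_union_of_disjoint (hdisj ω₀ hω₀),
      ← card_agree_mul (R ∪ Q ω₀) ω₀]
    refine Nat.mul_le_mul_right _ (Finset.card_le_card fun ω hω => ?_)
    exact Finset.mem_filter.mpr ⟨Finset.mem_univ _, (hmem ω hω).2⟩
  refine Nat.le_of_mul_le_mul_right ?_ (pow_pos hq0 R.card)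
  calc (∑ ω ∈ 𝒢, q ^ (Q ω).card) * q ^ R.card
      = ∑ b ∈ 𝒢.image g, (∑ ω ∈ 𝒢 with g ω = b, q ^ (Q ω).card) * q ^ R.card := by
        rw [← Finset.sum_mul, Finset.sum_fiberwise_of_maps_to]
        exact fun ω hω => Finset.mem_image_of_mem _ hω
    _ ≤ (𝒢.image g).card * q ^ Fintype.card ι := by
        rw [← smul_eq_mul]
        exact Finset.sum_le_card_nsmul _ _ _ hfib
    _ ≤ q ^ R.card * X * q ^ Fintype.card ι := Nat.mul_le_mul_right _ himg
    _ = X * q ^ Fintype.card ι * q ^ R.card := by ring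

/-- Passing from the exponential moment of |Q| to its mean. Instead of convexity, a pointwise linear
bound is used: either |Q| ≤ L, or the excess d = |Q| - L is below q ^ d. -/
theorem sum_card_certificate_le {ι α ζ : Type*} [Fintype ι] [DecidableEq ι] [Fintype α]
    [DecidableEq α] [DecidableEq ζ] (hα : 2 ≤ Fintype.card α) (R : Finset ι)
    (𝒢 : Finset (ι → α)) (key : (ι → α) → ζ) (L : ℕ)
    (hX : (𝒢.image key).card ≤ Fintype.card α ^ L) (Q : (ι → α) → Finset ι)
    (hdisj : ∀ ω ∈ 𝒢, Disjoint R (Q ω))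
    (hagree : ∀ ω ∈ 𝒢, ∀ ω' ∈ 𝒢, (∀ i ∈ R, ω i = ω' i) → key ω = key ω' →
      Q ω = Q ω' ∧ ∀ i ∈ Q ω, ω i = ω' i) :
    ∑ ω ∈ 𝒢, (Q ω).card ≤ Fintype.card α ^ Fintype.card ι * (L + 1) := by
  have : Nonempty α := Fintype.card_pos_iff.mp (by omega)
  have h := sum_pow_card_certificate_le R 𝒢 key _ hX Q hdisj hagree
  set q := Fintype.card α with hq
  have hpt : ∀ ω, q ^ L * (Q ω).card ≤ q ^ L * L + q ^ (Q ω).card := by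
    intro ω
    rcases le_total (Q ω).card L with hle | hle
    · exact (Nat.mul_le_mul_left _ hle).trans (Nat.le_add_right _ _)
    · obtain ⟨d, hd⟩ := Nat.exists_eq_add_of_le hle
      rw [hd, mul_add, pow_add]
      exact Nat.add_le_add_left (Nat.mul_le_mul_left _ (Nat.lt_pow_self (by omega)).le) _
  have hcard : 𝒢.card ≤ q ^ Fintype.card ι := by
    rw [hq, ← Fintype.card_fun]
    exact Finset.card_le_univ _
  refine Nat.le_of_mul_le_mul_left ?_ (pow_pos (by omega : 0 < q) L)
  calc q ^ L * ∑ ω ∈ 𝒢, (Q ω).card = ∑ ω ∈ 𝒢, q ^ L * (Q ω).card := Finset.mul_sum _ _ _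
    _ ≤ ∑ ω ∈ 𝒢, (q ^ L * L + q ^ (Q ω).card) := Finset.sum_le_sum fun ω _ => hpt ω
    _ = 𝒢.card * (q ^ L * L) + ∑ ω ∈ 𝒢, q ^ (Q ω).card := by
        rw [Finset.sum_add_distrib, Finset.sum_const, smul_eq_mul]
    _ ≤ q ^ Fintype.card ι * (q ^ L * L) + q ^ L * q ^ Fintype.card ι :=
        Nat.add_le_add (Nat.mul_le_mul_right _ hcard) h
    _ = q ^ L * (q ^ Fintype.card ι * (L + 1)) := by ring

/-- Lists shorter than k are padded with an extra symbol `none`, which accounts for the base m + 1.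
-/
theorem card_lists_le {β : Type*} [DecidableEq β] (𝓛 : Finset (List β)) (k m : ℕ)
    (hlen : ∀ l ∈ 𝓛, l.length ≤ k) (hm : (𝓛.biUnion List.toFinset).card ≤ m) :
    𝓛.card ≤ (m + 1) ^ k := by
  set F := 𝓛.biUnion List.toFinset
  have : 𝓛.card ≤ (Fintype.piFinset fun _ : Fin k => Finset.insertNone F).card := by
    refine Finset.card_le_card_of_injOn (fun l i => l[(i : ℕ)]?) ?_ ?_
    · intro l hl
      simp only [Finset.mem_coe, Fintype.mem_piFinset, Finset.mem_insertNone]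
      intro i x hx
      exact Finset.mem_biUnion.mpr ⟨l, hl, List.mem_toFinset.mpr (List.mem_of_getElem? hx)⟩
    · intro l hl l' hl' h
      refine List.ext_getElem? fun i => ?_
      rcases lt_or_ge i k with hi | hi
      · exact congrFun h ⟨i, hi⟩
      · rw [List.getElem?_eq_none ((hlen l hl).trans hi),
          List.getElem?_eq_none ((hlen l' hl').trans hi)]
  refine this.trans ?_
  rw [Fintype.card_piFinset_const, Finset.card_insertNone]
  exact Nat.pow_le_pow_left (by omega) k

/-! ### Determinacy of NCC executions -/

/-- What `v` has reported after `r` rounds. -/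
noncomputable def NCCAlgorithm.reported (A : NCCAlgorithm) (I : Instance) (r v : ℕ) :
    List (List ℕ) :=
  (A.output (A.conf I r v)).getD []

/-- The certificate of a core node: its initial knowledge and its own inboxes determine its state.
-/
theorem NCCAlgorithm.conf_eq_of_inbox_eq (A : NCCAlgorithm) {I I' : Instance} {v : ℕ}
    (h0 : A.conf I 0 v = A.conf I' 0 v) (s : ℕ)
    (h : ∀ r < s, A.inbox I (A.conf I r) v = A.inbox I' (A.conf I' r) v) :
    A.conf I s v = A.conf I' s v := by
  induction s with
  | zero => exact h0
  | succ s ih =>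
    change A.update _ _ = A.update _ _
    rw [ih fun r hr => h r (hr.trans s.lt_succ_self), h s s.lt_succ_self]

theorem deliver_congr {ids : List ℕ} {o o' : ℕ → List (ℕ × ℕ)} (h : ∀ j ∈ ids, o j = o' j)
    (i : ℕ) : deliver ids o i = deliver ids o' i := by
  unfold deliver
  rw [List.flatMap_def, List.flatMap_def]
  congr 1
  exact List.map_congr_left fun j hj => by rw [h j hj]

/-- The nodes outside the core behave like one machine whose only external input is what the core
sends. Traffic among them needs no accounting, so the cost scales with the core and not with the
number of nodes. -/
theorem NCCAlgorithm.conf_eq_of_send_eq (A : NCCAlgorithm) {I I' : Instance} {core : Finset ℕ}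
    (hV : I.V = I'.V) (h0 : ∀ v ∈ I.V, v ∉ core → A.conf I 0 v = A.conf I' 0 v) (s : ℕ)
    (h : ∀ r < s, ∀ u ∈ core, A.send (A.conf I r u) = A.send (A.conf I' r u)) :
    ∀ v ∈ I.V, v ∉ core → A.conf I s v = A.conf I' s v := by
  induction s with
  | zero => exact h0
  | succ s ih =>
    have ih' := ih fun r hr => h r (hr.trans s.lt_succ_self)
    intro v hv hvc
    change A.update _ (deliver _ _ _) = A.update _ (deliver _ _ _)
    rw [ih' v hv hvc, ← hV, deliver_congr (o' := fun u => A.send (A.conf I' s u))]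
    intro u hu
    by_cases huc : u ∈ core
    · exact h s s.lt_succ_self u huc
    · rw [ih' u ((Finset.mem_sort _).mp hu) huc]

theorem mem_deliver {ids : List ℕ} {o : ℕ → List (ℕ × ℕ)} {i : ℕ} {p : ℕ × ℕ} :
    p ∈ deliver ids o i ↔ p.1 ∈ ids ∧ (i, p.2) ∈ o p.1 := by
  obtain ⟨j, w⟩ := p
  simp only [deliver, List.mem_flatMap, List.mem_map, List.mem_filter, decide_eq_true_eq,
    Prod.mk.injEq]
  constructor
  · rintro ⟨j', hj', ⟨d, w'⟩, ⟨hm, rfl⟩, rfl, rfl⟩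
    exact ⟨hj', hm⟩
  · rintro ⟨hj, hm⟩
    exact ⟨j, hj, (i, w), ⟨hm, rfl⟩, rfl, rfl⟩

/-- Transcripts are nested lists (messages, then possibly nodes, then rounds), and each level adds a
padding symbol through `card_lists_le`. The slack of 3 in the hypothesis absorbs these additions. -/
theorem card_pow_arith {m C q ℓ : ℕ} (hC : 1 ≤ C) (hℓ : m + 3 ≤ q ^ ℓ) :
    (m + 1) ^ C + 1 ≤ q ^ (C * ℓ) ∧ ∀ k, 1 ≤ k → ((m + 1) ^ C + 1) ^ k + 1 ≤ q ^ (C * ℓ * k) := by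
  have succ_pow : ∀ x k : ℕ, 1 ≤ k → x ^ k + 1 ≤ (x + 1) ^ k := by
    exact fun x k hk => Nat.pow_lt_pow_left x.lt_succ_self (by omega)
  have h1 : (m + 1) ^ C + 1 ≤ (m + 2) ^ C := succ_pow (m + 1) C hC
  refine ⟨?_, fun k hk => ?_⟩
  · rw [mul_comm, pow_mul]
    exact h1.trans (Nat.pow_le_pow_left (by omega) C)
  · calc ((m + 1) ^ C + 1) ^ k + 1 ≤ ((m + 2) ^ C) ^ k + 1 :=
          Nat.add_le_add_right (Nat.pow_le_pow_left h1 k) 1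
      _ = (m + 2) ^ (C * k) + 1 := by rw [← pow_mul]
      _ ≤ (m + 3) ^ (C * k) := succ_pow (m + 2) (C * k) (Nat.mul_pos hC hk)
      _ ≤ (q ^ ℓ) ^ (C * k) := Nat.pow_le_pow_left hℓ _
      _ = q ^ (C * ℓ * k) := by rw [← pow_mul]; congr 1; ring

/-- Consider a family of inputs on the node set `V`, indexed by `ω : ι → α`, such that only the nodes
in `core` know anything about `ω`: `v ∈ core` knows the coordinates `known v`. If every reported item
`x` reveals the coordinates `coords x` of `ω`, then on average the core nodes reveal few
coordinates that they do not know initially, and the other nodes reveal few coordinates. -/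
theorem ncc_sum_revealed_le {ι α : Type*} [Fintype ι] [DecidableEq ι] [Fintype α] [DecidableEq α]
    (hα : 2 ≤ Fintype.card α) (A : NCCAlgorithm) (inst : (ι → α) → Instance) (V core : Finset ℕ)
    (known : ℕ → Finset ι) (W C t ℓ : ℕ) (hcV : core ⊆ V) (hne : core.Nonempty)
    (hV : ∀ ω, (inst ω).V = V)
    (hinit : ∀ ω ω', ∀ v ∈ core, (∀ i ∈ known v, ω i = ω' i) →
      A.conf (inst ω) 0 v = A.conf (inst ω') 0 v)
    (hinit' : ∀ ω ω', ∀ v ∈ V, v ∉ core → A.conf (inst ω) 0 v = A.conf (inst ω') 0 v)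
    (𝒢 : Finset (ι → α)) (τ : (ι → α) → ℕ) (hτ : ∀ ω ∈ 𝒢, τ ω ≤ t)
    (hcap : ∀ ω ∈ 𝒢, ∀ r < τ ω, ∀ v ∈ V,
      (A.send (A.conf (inst ω) r v)).length ≤ C ∧
      (∀ m ∈ A.send (A.conf (inst ω) r v), m.1 ∈ V ∧ m.2 < W) ∧
      (A.inbox (inst ω) (A.conf (inst ω) r) v).length ≤ C)
    (hC : 1 ≤ C) (hℓ : V.card * W + 3 ≤ Fintype.card α ^ ℓ)
    (coords : List ℕ → Finset ι)
    (hcoords : ∀ ω ∈ 𝒢, ∀ ω' ∈ 𝒢, ∀ v ∈ V, ∀ x ∈ A.reported (inst ω) (τ ω) v,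
      x ∈ A.reported (inst ω') (τ ω') v → ∀ i ∈ coords x, ω i = ω' i) :
    ∑ ω ∈ 𝒢, (((V \ core).biUnion fun v =>
          (A.reported (inst ω) (τ ω) v).toFinset.biUnion coords).card +
        ∑ v ∈ core, ((A.reported (inst ω) (τ ω) v).toFinset.biUnion coords \ known v).card) ≤
      Fintype.card α ^ Fintype.card ι * (core.card * (2 * C * ℓ * t + 1) + 1) := by
  classical
  set q := Fintype.card α with hq
  have hmsg : (V ×ˢ Finset.range W).card = V.card * W := by
    rw [Finset.card_product, Finset.card_range]
  obtain ⟨har1, har2⟩ := card_pow_arith hC hℓ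
  have hcore : ∀ v ∈ core, ∑ ω ∈ 𝒢,
      ((A.reported (inst ω) (τ ω) v).toFinset.biUnion coords \ known v).card ≤
        q ^ Fintype.card ι * (C * ℓ * t + 1) := by
    intro v hv
    -- The transcript of v: all its inboxes up to termination. Its length reveals the number of
    -- rounds, so equal keys imply equal running times.
    let key : (ι → α) → List (List (ℕ × ℕ)) := fun ω =>
      (List.range (τ ω)).map fun r => A.inbox (inst ω) (A.conf (inst ω) r) v
    refine sum_card_certificate_le hα (known v) 𝒢 key (C * ℓ * t) ?_ _ ?_ ?_
    · refine (card_lists_le _ t ((V.card * W + 1) ^ C) ?_ ?_).trans ?_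
      · intro l hl
        obtain ⟨ω, hω, rfl⟩ := Finset.mem_image.mp hl
        simpa [key] using hτ ω hω
      · refine card_lists_le _ C _ ?_ (hmsg ▸ Finset.card_le_card ?_)
        · intro l hl
          simp only [Finset.mem_biUnion, Finset.mem_image, List.mem_toFinset] at hl
          obtain ⟨_, ⟨ω, hω, rfl⟩, hl⟩ := hl
          obtain ⟨r, hr, rfl⟩ := List.mem_map.mp hl
          exact (hcap ω hω r (List.mem_range.mp hr) v (hcV hv)).2.2
        · intro p hp
          simp only [Finset.mem_biUnion, Finset.mem_image, List.mem_toFinset] at hp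
          obtain ⟨l, ⟨_, ⟨ω, hω, rfl⟩, hl⟩, hp⟩ := hp
          obtain ⟨r, hr, rfl⟩ := List.mem_map.mp hl
          obtain ⟨h1, h2⟩ := mem_deliver.mp hp
          rw [Finset.mem_sort, hV] at h1
          exact Finset.mem_product.mpr ⟨h1, Finset.mem_range.mpr
            ((hcap ω hω r (List.mem_range.mp hr) _ h1).2.1 _ h2).2⟩
      · rw [pow_mul]
        exact Nat.pow_le_pow_left har1 t
    · exact fun ω _ => Finset.disjoint_sdiff
    · intro ω hω ω' hω' hR hkey
      have hlen : τ ω = τ ω' := by simpa [key] using congrArg List.length hkey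
      have hin : ∀ r < τ ω, A.inbox (inst ω) (A.conf (inst ω) r) v =
          A.inbox (inst ω') (A.conf (inst ω') r) v := by
        intro r hr
        have h1 := congrArg (fun l => l[r]?) hkey
        simpa [key, hr, hlen ▸ hr] using h1
      have hout : A.reported (inst ω) (τ ω) v = A.reported (inst ω') (τ ω') v := by
        unfold NCCAlgorithm.reported
        rw [A.conf_eq_of_inbox_eq (hinit ω ω' v hv hR) (τ ω) hin, hlen]
      refine ⟨by rw [hout], fun i hi => ?_⟩
      obtain ⟨x, hx, hi⟩ := Finset.mem_biUnion.mp (Finset.mem_sdiff.mp hi).1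
      rw [List.mem_toFinset] at hx
      exact hcoords ω hω ω' hω' v (hcV hv) x hx (hout ▸ hx) i hi
  have hrest : ∑ ω ∈ 𝒢, ((V \ core).biUnion fun v =>
      (A.reported (inst ω) (τ ω) v).toFinset.biUnion coords).card ≤
        q ^ Fintype.card ι * (C * ℓ * core.card * t + 1) := by
    -- One transcript serves all nodes outside the core: everything the core nodes send. No
    -- coordinate is known to them in advance, so the certificate is used with the empty set of
    -- known coordinates.
    let key : (ι → α) → List (List (List (ℕ × ℕ))) := fun ω =>
      (List.range (τ ω)).map fun r => core.sort.map fun u => A.send (A.conf (inst ω) r u)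
    refine sum_card_certificate_le hα ∅ 𝒢 key (C * ℓ * core.card * t) ?_ _
      (fun ω _ => Finset.disjoint_empty_left _) ?_
    · refine (card_lists_le _ t (((V.card * W + 1) ^ C + 1) ^ core.card) ?_ ?_).trans ?_
      · intro l hl
        obtain ⟨ω, hω, rfl⟩ := Finset.mem_image.mp hl
        simpa [key] using hτ ω hω
      · refine card_lists_le _ core.card _ ?_ (card_lists_le _ C _ ?_
          (hmsg ▸ Finset.card_le_card ?_))
        · intro l hl
          simp only [Finset.mem_biUnion, Finset.mem_image, List.mem_toFinset] at hl
          obtain ⟨_, ⟨ω, hω, rfl⟩, hl⟩ := hl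
          obtain ⟨r, hr, rfl⟩ := List.mem_map.mp hl
          simp
        · intro l hl
          simp only [Finset.mem_biUnion, Finset.mem_image, List.mem_toFinset] at hl
          obtain ⟨_, ⟨_, ⟨ω, hω, rfl⟩, hl'⟩, hl⟩ := hl
          obtain ⟨r, hr, rfl⟩ := List.mem_map.mp hl'
          obtain ⟨u, hu, rfl⟩ := List.mem_map.mp hl
          exact (hcap ω hω r (List.mem_range.mp hr) u (hcV ((Finset.mem_sort _).mp hu))).1
        · intro p hp
          simp only [Finset.mem_biUnion, Finset.mem_image, List.mem_toFinset] at hp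
          obtain ⟨l, ⟨_, ⟨_, ⟨ω, hω, rfl⟩, hl'⟩, hl⟩, hp⟩ := hp
          obtain ⟨r, hr, rfl⟩ := List.mem_map.mp hl'
          obtain ⟨u, hu, rfl⟩ := List.mem_map.mp hl
          have := (hcap ω hω r (List.mem_range.mp hr) u
            (hcV ((Finset.mem_sort _).mp hu))).2.1 p hp
          exact Finset.mem_product.mpr ⟨this.1, Finset.mem_range.mpr this.2⟩
      · rw [pow_mul]
        exact Nat.pow_le_pow_left (har2 _ hne.card_pos) t
    · intro ω hω ω' hω' _ hkey
      have hlen : τ ω = τ ω' := by simpa [key] using congrArg List.length hkey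
      have hsend : ∀ r < τ ω, ∀ u ∈ core,
          A.send (A.conf (inst ω) r u) = A.send (A.conf (inst ω') r u) := by
        intro r hr
        have h1 := congrArg (fun l => l[r]?) hkey
        simpa [key, hr, hlen ▸ hr] using h1
      have hout : ∀ v ∈ V \ core,
          A.reported (inst ω) (τ ω) v = A.reported (inst ω') (τ ω') v := by
        intro v hv
        obtain ⟨hv, hvc⟩ := Finset.mem_sdiff.mp hv
        unfold NCCAlgorithm.reported
        rw [A.conf_eq_of_send_eq ((hV ω).trans (hV ω').symm) (fun v hv => hinit' ω ω' v (hV ω ▸ hv))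
          (τ ω) hsend v ((hV ω).symm ▸ hv) hvc, hlen]
      refine ⟨Finset.biUnion_congr rfl fun v hv => by rw [hout v hv], fun i hi => ?_⟩
      obtain ⟨v, hv, hi⟩ := Finset.mem_biUnion.mp hi
      obtain ⟨x, hx, hi⟩ := Finset.mem_biUnion.mp hi
      rw [List.mem_toFinset] at hx
      exact hcoords ω hω ω' hω' v (Finset.mem_sdiff.mp hv).1 x hx (hout v hv ▸ hx) i hi
  rw [Finset.sum_add_distrib, Finset.sum_comm]
  calc _ ≤ q ^ Fintype.card ι * (C * ℓ * core.card * t + 1) +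
        ∑ v ∈ core, q ^ Fintype.card ι * (C * ℓ * t + 1) :=
        Nat.add_le_add hrest (Finset.sum_le_sum hcore)
    _ = q ^ Fintype.card ι * (core.card * (2 * C * ℓ * t + 1) + 1) := by
        rw [Finset.sum_const, smul_eq_mul]
        ring

/-! ### Lower bound for triangle listing in NCC -/

theorem NCCSolves.mem_reported {κ : ℕ} {A : NCCAlgorithm} {P : GraphProblem κ} {C : ℕ → ℕ}
    {τ : Instance → ℕ} (h : NCCSolves A P C τ) {I : Instance} (hI : I ∈ P.instances) :
    ∃ s ∈ P.legal I, (∀ x ∈ s, ∃ v ∈ I.V, x ∈ A.reported I (τ I) v) ∧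
      ∀ v ∈ I.V, ∀ x ∈ A.reported I (τ I) v, x ∈ s := by
  obtain ⟨-, -, -, -, s, hs, hrep, -⟩ := h I hI
  refine ⟨s, hs, fun x hx => ?_, fun v hv x hx => ?_⟩
  · rw [← hrep, List.mem_toFinset, List.mem_flatMap] at hx
    obtain ⟨v, hv, hx⟩ := hx
    exact ⟨v, (Finset.mem_sort _).mp hv, hx⟩
  · rw [← hrep, List.mem_toFinset, List.mem_flatMap]
    exact ⟨v, (Finset.mem_sort _).mpr hv, hx⟩

/-- The subset of `F` with indicator function `ω`. -/
def edgesOf {F : Finset (ℕ × ℕ)} (ω : F → Bool) : Finset (ℕ × ℕ) :=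
  (Finset.univ.filter fun p => ω p = true).map (Function.Embedding.subtype _)

theorem mem_edgesOf {F : Finset (ℕ × ℕ)} {ω : F → Bool} {p : ℕ × ℕ} :
    p ∈ edgesOf ω ↔ ∃ h : p ∈ F, ω ⟨p, h⟩ = true := by
  simp [edgesOf]

theorem edgesOf_mem_powerset {F : Finset (ℕ × ℕ)} (ω : F → Bool) : edgesOf ω ∈ F.powerset :=
  Finset.mem_powerset.mpr fun _ hp => (mem_edgesOf.mp hp).1

theorem sum_powerset_eq_sum_edgesOf {F : Finset (ℕ × ℕ)} (f : Finset (ℕ × ℕ) → ℕ) :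
    ∑ B ∈ F.powerset, f B = ∑ ω : F → Bool, f (edgesOf ω) := by
  symm
  refine Finset.sum_bij (fun ω _ => edgesOf ω) (fun ω _ => edgesOf_mem_powerset ω) ?_ ?_
    fun _ _ => rfl
  · intro ω _ ω' _ h
    funext ⟨p, hp⟩
    have := Finset.ext_iff.mp h p
    simp only [mem_edgesOf, hp, exists_true_left] at this
    exact Bool.eq_iff_iff.mpr this
  · intro B hB
    refine ⟨fun p => decide (p.1 ∈ B), Finset.mem_univ _, ?_⟩
    ext p
    simp only [mem_edgesOf, decide_eq_true_eq, exists_prop, and_iff_right_iff_imp]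
    exact fun h => Finset.mem_powerset.mp hB h

/-- The last `a` vertices of a lollipop graph. -/
def lollipopCore (a : ℕ) : Finset ℕ := Finset.Ioc (a ^ 3 - a) (a ^ 3)

theorem card_lollipopCore (a : ℕ) : (lollipopCore a).card = a := by
  rw [lollipopCore, Nat.card_Ioc]
  exact Nat.sub_sub_self (Nat.le_self_pow (by norm_num) a)

/-- The free pairs that contain `v`. -/
def pairsAt (a v : ℕ) : Finset (freePairs a) := Finset.univ.filter fun p => p.1.1 = v ∨ p.1.2 = v

/-- The free pairs among the vertices in the list `l`. -/
def pairsIn (a : ℕ) (l : List ℕ) : Finset (freePairs a) :=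
  Finset.univ.filter fun p => p.1.1 ∈ l ∧ p.1.2 ∈ l

theorem Instance.mem_nbrs {I : Instance} {v u : ℕ} : u ∈ I.nbrs v ↔ u ∈ I.V ∧ I.G.Adj v u := by
  simp [Instance.nbrs]

theorem lollipop_conf_zero_congr (A : NCCAlgorithm) {a v : ℕ} {ω ω' : freePairs a → Bool}
    (h : ∀ i ∈ pairsAt a v, ω i = ω' i) :
    A.conf (lollipop a (edgesOf ω)) 0 v = A.conf (lollipop a (edgesOf ω')) 0 v := by
  have hadj : ∀ u, (lollipopGraph a (edgesOf ω)).Adj v u ↔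
      (lollipopGraph a (edgesOf ω')).Adj v u := by
    intro u
    have h1 : ∀ p : ℕ × ℕ, p.1 = v ∨ p.2 = v → (p ∈ edgesOf ω ↔ p ∈ edgesOf ω') := by
      intro p hp
      rw [mem_edgesOf, mem_edgesOf]
      refine exists_congr fun hpF => ?_
      rw [h ⟨p, hpF⟩ (Finset.mem_filter.mpr ⟨Finset.mem_univ _, hp⟩)]
    simp only [lollipopGraph, SimpleGraph.fromRel_adj, h1 (v, u) (Or.inl rfl),
      h1 (u, v) (Or.inr rfl)]
  have h2 : (lollipop a (edgesOf ω)).nbrs v = (lollipop a (edgesOf ω')).nbrs v := by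
    ext u
    rw [Instance.mem_nbrs, Instance.mem_nbrs]
    exact and_congr_right fun _ => hadj u
  have h3 : ∀ B, (lollipop a B).incidentLabel v = fun _ => [] := fun B => by
    funext u
    exact ite_self _
  change A.init _ v _ _ _ = A.init _ v _ _ _
  rw [h2, h3, h3]
  rfl

theorem mem_triangles_lollipop {a : ℕ} {B : Finset (ℕ × ℕ)} {l : List ℕ}
    (h : l ∈ triangles (lollipop a B)) : ∀ u ∈ l, ∀ v ∈ l, u + 1 < v → (u, v) ∈ B := by
  simp only [triangles, Finset.mem_image, Finset.mem_filter, Finset.mem_product] at h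
  obtain ⟨⟨x, y, z⟩, ⟨-, hxy, hyz, h1, h2, h3⟩, rfl⟩ := h
  have h1' := (lollipopGraph_adj_iff hxy).mp h1
  have h2' := (lollipopGraph_adj_iff hyz).mp h2
  have h3' := (lollipopGraph_adj_iff (hxy.trans hyz)).mp h3
  dsimp only at *
  intro u hu v hv huv
  simp only [List.mem_cons, List.not_mem_nil, or_false] at hu hv
  rcases hu with rfl | rfl | rfl <;> rcases hv with rfl | rfl | rfl <;> first | omega | skip
  · exact (h1'.resolve_left (by omega)).1
  · exact (h3'.resolve_left (by omega)).1
  · exact (h2'.resolve_left (by omega)).1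

theorem triple_mem_triangles_lollipop {a : ℕ} {B : Finset (ℕ × ℕ)} (hB : B ∈ (freePairs a).powerset)
    {x y z : ℕ} (hxy : (x, y) ∈ B) (hyz : (y, z) ∈ B) (hxz : (x, z) ∈ B) :
    [x, y, z] ∈ triangles (lollipop a B) := by
  have h1 := Finset.mem_powerset.mp hB hxy
  have h2 := Finset.mem_powerset.mp hB hyz
  have h3 := Finset.mem_powerset.mp hB hxz
  have h1' := mem_freePairs.mp h1
  have h2' := mem_freePairs.mp h2
  simp only [triangles, Finset.mem_image, Finset.mem_filter, Finset.mem_product]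
  refine ⟨(x, y, z), ⟨⟨?_, ?_, ?_⟩, by dsimp only; omega, by dsimp only; omega, ?_, ?_, ?_⟩, rfl⟩
  · exact Finset.mem_Icc.mpr (by dsimp only; omega)
  · exact Finset.mem_Icc.mpr (by dsimp only; omega)
  · exact Finset.mem_Icc.mpr (by dsimp only; omega)
  · exact (lollipopGraph_adj_iff (by dsimp only; omega)).mpr (Or.inr ⟨hxy, h1⟩)
  · exact (lollipopGraph_adj_iff (by dsimp only; omega)).mpr (Or.inr ⟨hyz, h2⟩)
  · exact (lollipopGraph_adj_iff (by dsimp only; omega)).mpr (Or.inr ⟨hxz, h3⟩)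

/-- A pair in one of the three positions leaves at most m choices for the remaining vertex. This
converts a count of triangles into a count of revealed pairs. -/
theorem card_triples_hit_le (I J K : Finset ℕ) (m : ℕ) (hI : I.card ≤ m) (hJ : J.card ≤ m)
    (hK : K.card ≤ m) (S : Finset (ℕ × ℕ)) :
    ((I ×ˢ J ×ˢ K).filter fun t => (t.1, t.2.1) ∈ S ∨ (t.2.1, t.2.2) ∈ S ∨ (t.1, t.2.2) ∈ S).card ≤
      3 * m * S.card := by
  rw [Finset.filter_or, Finset.filter_or]
  have h1 : ((I ×ˢ J ×ˢ K).filter fun t => (t.1, t.2.1) ∈ S).card ≤ S.card * K.card := by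
    rw [← Finset.card_product]
    refine Finset.card_le_card_of_injOn (fun t => ((t.1, t.2.1), t.2.2)) ?_ ?_
    · intro t ht
      simp only [Finset.coe_filter, Finset.mem_product, Set.mem_ofPred_eq] at ht
      exact Finset.mem_product.mpr ⟨ht.2, ht.1.2.2⟩
    · rintro ⟨x, y, z⟩ - ⟨x', y', z'⟩ - h
      simp only [Prod.mk.injEq] at h ⊢
      tauto
  have h2 : ((I ×ˢ J ×ˢ K).filter fun t => (t.2.1, t.2.2) ∈ S).card ≤ S.card * I.card := by
    rw [← Finset.card_product]
    refine Finset.card_le_card_of_injOn (fun t => ((t.2.1, t.2.2), t.1)) ?_ ?_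
    · intro t ht
      simp only [Finset.coe_filter, Finset.mem_product, Set.mem_ofPred_eq] at ht
      exact Finset.mem_product.mpr ⟨ht.2, ht.1.1⟩
    · rintro ⟨x, y, z⟩ - ⟨x', y', z'⟩ - h
      simp only [Prod.mk.injEq] at h ⊢
      tauto
  have h3 : ((I ×ˢ J ×ˢ K).filter fun t => (t.1, t.2.2) ∈ S).card ≤ S.card * J.card := by
    rw [← Finset.card_product]
    refine Finset.card_le_card_of_injOn (fun t => ((t.1, t.2.2), t.2.1)) ?_ ?_
    · intro t ht
      simp only [Finset.coe_filter, Finset.mem_product, Set.mem_ofPred_eq] at ht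
      exact Finset.mem_product.mpr ⟨ht.2, ht.1.2.1⟩
    · rintro ⟨x, y, z⟩ - ⟨x', y', z'⟩ - h
      simp only [Prod.mk.injEq] at h ⊢
      tauto
  refine (Finset.card_union_le _ _).trans
    ((Nat.add_le_add_left (Finset.card_union_le _ _) _).trans ?_)
  have := Nat.mul_le_mul_left S.card hI
  have := Nat.mul_le_mul_left S.card hJ
  have := Nat.mul_le_mul_left S.card hK
  linarith

/-- Linearity of expectation: the three pairs of a triple are distinct coordinates, so all are
present with probability 1/8. -/
theorem sum_card_triples_mul {F : Finset (ℕ × ℕ)} (T : Finset (ℕ × ℕ × ℕ))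
    (hT : ∀ t ∈ T, t.1 < t.2.1 ∧ t.2.1 < t.2.2 ∧
      (t.1, t.2.1) ∈ F ∧ (t.2.1, t.2.2) ∈ F ∧ (t.1, t.2.2) ∈ F) :
    (∑ ω : F → Bool, (T.filter fun t => (t.1, t.2.1) ∈ edgesOf ω ∧ (t.2.1, t.2.2) ∈ edgesOf ω ∧
      (t.1, t.2.2) ∈ edgesOf ω).card) * 8 = T.card * 2 ^ F.card := by
  simp only [Finset.card_filter]
  rw [Finset.sum_comm, Finset.sum_mul, ← smul_eq_mul, ← Finset.sum_const]
  refine Finset.sum_congr rfl fun t ht => ?_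
  obtain ⟨h1, h2, h3, h4, h5⟩ := hT t ht
  have h := card_agree_mul ({⟨_, h3⟩, ⟨_, h4⟩, ⟨_, h5⟩} : Finset F) fun _ => true
  have h6 : ({⟨_, h3⟩, ⟨_, h4⟩, ⟨_, h5⟩} : Finset F).card = 3 := by
    refine Finset.card_eq_three.mpr ⟨_, _, _, ?_, ?_, ?_, rfl⟩ <;>
      simp only [ne_eq, Subtype.mk.injEq, Prod.mk.injEq] <;> omega
  rw [h6, Fintype.card_bool, Fintype.card_coe] at h
  rw [← h, ← Finset.card_filter]
  congr 2
  ext ω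
  simp only [Finset.mem_filter, Finset.mem_univ, true_and, Finset.mem_insert,
    Finset.mem_singleton, forall_eq_or_imp, forall_eq, mem_edgesOf, h3, h4, h5, exists_true_left]
  exact and_congr eq_comm (and_congr eq_comm eq_comm)

theorem lollipop_nodes (a : ℕ) (B : Finset (ℕ × ℕ)) : (lollipop a B).n = a ^ 3 := by
  simp [lollipop, Instance.n]

theorem card_mul_wordBound_le (κ n : ℕ) :
    n * wordBound κ n + 3 ≤ 2 ^ ((κ + 1) * Nat.size n + 2) := by
  have h1 : n ≤ 2 ^ Nat.size n := (Nat.lt_size_self n).le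
  have h2 : 1 ≤ 2 ^ ((κ + 1) * Nat.size n) := Nat.one_le_two_pow
  calc n * wordBound κ n + 3 ≤ 2 ^ Nat.size n * 2 ^ (κ * Nat.size n) + 3 :=
        Nat.add_le_add_right (Nat.mul_le_mul_right _ h1) 3
    _ = 2 ^ ((κ + 1) * Nat.size n) + 3 := by rw [← pow_add]; congr 2; ring
    _ ≤ 2 ^ ((κ + 1) * Nat.size n + 2) := by rw [pow_add]; omega

/-- Every triangle of the box I × J × K contains a pair revealed by its reporter and not known to it
initially. By `card_triples_hit_le` the triangles number at most 3m times the revealed pairs, which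
`ncc_sum_revealed_le` bounds. Only inputs that finish within t rounds are summed, because the
transcript length must be bounded. -/
theorem lollipop_ncc_card_bound {κ : ℕ} (hκ : 1 ≤ κ) {a C : ℕ} (ha : 8 ≤ a) (hC : 1 ≤ C)
    (A : NCCAlgorithm) (τ : Instance → ℕ)
    (hA : NCCSolves A (lollipopTriangles κ hκ {a}) (fun _ => C) τ)
    (t ℓ : ℕ) (hℓ : ℓ = (κ + 1) * Nat.size (a ^ 3) + 2) (I J K : Finset ℕ) (m : ℕ)
    (hI : I.card ≤ m) (hJ : J.card ≤ m) (hK : K.card ≤ m) :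
    ∑ ω : freePairs a → Bool with τ (lollipop a (edgesOf ω)) ≤ t,
      ((I ×ˢ J ×ˢ K).filter fun t => (t.1, t.2.1) ∈ edgesOf ω ∧ (t.2.1, t.2.2) ∈ edgesOf ω ∧
        (t.1, t.2.2) ∈ edgesOf ω).card ≤
    3 * m * (2 ^ (freePairs a).card * (a * (2 * C * ℓ * t + 1) + 1)) := by
  classical
  have hle : a ≤ a ^ 3 := Nat.le_self_pow (by norm_num) a
  have hinst : ∀ ω : freePairs a → Bool,
      lollipop a (edgesOf ω) ∈ (lollipopTriangles κ hκ {a}).instances := fun ω =>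
    ⟨a, rfl, edgesOf ω, edgesOf_mem_powerset ω, rfl⟩
  have hrep : ∀ ω : freePairs a → Bool,
      (∀ x ∈ triangles (lollipop a (edgesOf ω)), ∃ v ∈ Finset.Icc 1 (a ^ 3),
        x ∈ A.reported (lollipop a (edgesOf ω)) (τ (lollipop a (edgesOf ω))) v) ∧
      ∀ v ∈ Finset.Icc 1 (a ^ 3),
        ∀ x ∈ A.reported (lollipop a (edgesOf ω)) (τ (lollipop a (edgesOf ω))) v,
          x ∈ triangles (lollipop a (edgesOf ω)) := by
    intro ω
    obtain ⟨s, rfl, h⟩ := hA.mem_reported (hinst ω)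
    exact h
  -- Reported items are genuine triangles, so their free pairs are edges. Two inputs for which the
  -- same item is reported therefore agree on these pairs, both values being `true`.
  have htrue : ∀ (ω : freePairs a → Bool), ∀ x ∈ triangles (lollipop a (edgesOf ω)),
      ∀ i ∈ pairsIn a x, ω i = true := by
    rintro ω x hx ⟨⟨u, v⟩, huv⟩ hi
    have hi := (Finset.mem_filter.mp hi).2
    exact (mem_edgesOf.mp (mem_triangles_lollipop hx u hi.1 v hi.2 (mem_freePairs.mp huv).2.1)).2
  have hmain := ncc_sum_revealed_le (ι := freePairs a) (α := Bool) (by simp) A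
    (fun ω => lollipop a (edgesOf ω)) (Finset.Icc 1 (a ^ 3)) (lollipopCore a) (pairsAt a)
    (wordBound κ (a ^ 3)) C t ℓ
    (fun v hv => by
      rw [lollipopCore, Finset.mem_Ioc] at hv
      exact Finset.mem_Icc.mpr (by omega))
    (by rw [← Finset.card_pos, card_lollipopCore]; omega)
    (fun _ => rfl)
    (fun ω ω' v _ h => lollipop_conf_zero_congr A h)
    (fun ω ω' v hv hvc => by
      refine lollipop_conf_zero_congr A fun i hi => absurd ?_ hvc
      obtain ⟨⟨u, w⟩, huw⟩ := i
      have h1 := (Finset.mem_filter.mp hi).2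
      have h2 := mem_freePairs.mp huw
      exact Finset.mem_Ioc.mpr (by dsimp only at h1; omega))
    (Finset.univ.filter fun ω => τ (lollipop a (edgesOf ω)) ≤ t)
    (fun ω => τ (lollipop a (edgesOf ω)))
    (fun ω hω => (Finset.mem_filter.mp hω).2)
    (fun ω _ r hr v hv => by
      have := (hA _ (hinst ω)).1 r hr v hv
      rw [lollipop_nodes] at this
      exact this)
    hC
    (by
      rw [Nat.card_Icc, Fintype.card_bool, hℓ]
      exact card_mul_wordBound_le κ (a ^ 3))
    (pairsIn a)
    (fun ω _ ω' _ v hv x hx hx' i hi => by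
      rw [htrue ω x ((hrep ω).2 v hv x hx) i hi, htrue ω' x ((hrep ω').2 v hv x hx') i hi])
  rw [Fintype.card_bool, Fintype.card_coe, card_lollipopCore] at hmain
  refine le_trans ?_ (Nat.mul_le_mul_left (3 * m) hmain)
  rw [Finset.mul_sum]
  refine Finset.sum_le_sum fun ω _ => ?_
  let hit : Finset (freePairs a) → Finset (ℕ × ℕ × ℕ) := fun S =>
    (I ×ˢ J ×ˢ K).filter fun t => (t.1, t.2.1) ∈ S.map (Function.Embedding.subtype _) ∨
      (t.2.1, t.2.2) ∈ S.map (Function.Embedding.subtype _) ∨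
      (t.1, t.2.2) ∈ S.map (Function.Embedding.subtype _)
  have hhit : ∀ S, (hit S).card ≤ 3 * m * S.card := fun S =>
    (card_triples_hit_le I J K m hI hJ hK _).trans (by rw [Finset.card_map])
  have hmem : ∀ (S : Finset (freePairs a)) (p : ℕ × ℕ) (hp : p ∈ freePairs a), ⟨p, hp⟩ ∈ S →
      p ∈ S.map (Function.Embedding.subtype _) := fun S p hp h =>
    Finset.mem_map.mpr ⟨⟨p, hp⟩, h, rfl⟩
  rw [Nat.mul_add, Finset.mul_sum]
  refine le_trans (Finset.card_le_card (t := hit _ ∪ (lollipopCore a).biUnion fun v => hit _) ?_)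
    ((Finset.card_union_le _ _).trans (Nat.add_le_add (hhit _)
      (Finset.card_biUnion_le.trans (Finset.sum_le_sum fun v _ => hhit _))))
  rintro ⟨x, y, z⟩ ht
  obtain ⟨ht, hxy, hyz, hxz⟩ := Finset.mem_filter.mp ht
  dsimp only at hxy hyz hxz
  have hxyF := (mem_edgesOf.mp hxy).1
  have hyzF := (mem_edgesOf.mp hyz).1
  have hxzF := (mem_edgesOf.mp hxz).1
  obtain ⟨v, hv, hrv⟩ := (hrep ω).1 _
    (triple_mem_triangles_lollipop (edgesOf_mem_powerset ω) hxy hyz hxz)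
  have hcoord : ∀ (p : ℕ × ℕ) (hp : p ∈ freePairs a), p.1 ∈ [x, y, z] → p.2 ∈ [x, y, z] →
      (⟨p, hp⟩ : freePairs a) ∈ (A.reported (lollipop a (edgesOf ω))
        (τ (lollipop a (edgesOf ω))) v).toFinset.biUnion (pairsIn a) := fun p hp h1 h2 =>
    Finset.mem_biUnion.mpr ⟨_, List.mem_toFinset.mpr hrv,
      Finset.mem_filter.mpr ⟨Finset.mem_univ _, h1, h2⟩⟩
  by_cases hvc : v ∈ lollipopCore a
  · refine Finset.mem_union_right _ (Finset.mem_biUnion.mpr ⟨v, hvc, Finset.mem_filter.mpr ⟨ht, ?_⟩⟩)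
    have hnot : ∀ (p : ℕ × ℕ) (hp : p ∈ freePairs a), p.1 ∈ [x, y, z] → p.2 ∈ [x, y, z] →
        p.1 ≠ v → p.2 ≠ v → p ∈ ((A.reported (lollipop a (edgesOf ω))
        (τ (lollipop a (edgesOf ω))) v).toFinset.biUnion (pairsIn a) \ pairsAt a v).map
          (Function.Embedding.subtype _) := by
      intro p hp h1 h2 h3 h4
      refine hmem _ p hp (Finset.mem_sdiff.mpr ⟨hcoord p hp h1 h2, fun h => ?_⟩)
      have := (Finset.mem_filter.mp h).2
      tauto
    have h1 := mem_freePairs.mp hxyF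
    have h2 := mem_freePairs.mp hyzF
    -- The reporter v is at most one of x, y, z. The side opposite to it, or the side x y if v is
    -- none of them, is a pair v did not know.
    by_cases hvx : v = x
    · exact Or.inr (Or.inl (hnot (y, z) hyzF (by simp) (by simp) (by dsimp only; omega)
        (by dsimp only; omega)))
    · by_cases hvy : v = y
      · exact Or.inr (Or.inr (hnot (x, z) hxzF (by simp) (by simp) (by dsimp only; omega)
          (by dsimp only; omega)))
      · exact Or.inl (hnot (x, y) hxyF (by simp) (by simp) (by dsimp only; omega)
          (by dsimp only; omega))
  · refine Finset.mem_union_left _ (Finset.mem_filter.mpr ⟨ht, Or.inl (hmem _ _ hxyF ?_)⟩)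
    exact Finset.mem_biUnion.mpr ⟨v, Finset.mem_sdiff.mpr ⟨hv, hvc⟩,
      hcoord _ hxyF (by simp) (by simp)⟩

theorem lollipop_ncc_sum_lower_bound {κ : ℕ} (hκ : 1 ≤ κ) {a C : ℕ} (ha : 12288 ≤ a) (hC : 1 ≤ C)
    (A : NCCAlgorithm) (τ : Instance → ℕ)
    (hA : NCCSolves A (lollipopTriangles κ hκ {a}) (fun _ => C) τ) :
    a * 2 ^ (freePairs a).card ≤ 16 * 12288 * C * ((κ + 1) * Nat.size (a ^ 3) + 2) *
      ∑ B ∈ (freePairs a).powerset, τ (lollipop a B) := by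
  have hle : a ≤ a ^ 3 := Nat.le_self_pow (by norm_num) a
  rw [sum_powerset_eq_sum_edgesOf fun B => τ (lollipop a B)]
  set f : (freePairs a → Bool) → ℕ := fun ω => τ (lollipop a (edgesOf ω)) with hf
  set N := 2 ^ (freePairs a).card with hN
  have hN0 : 0 < N := by positivity
  -- This threshold is 16 times the mean running time. By Markov's inequality at most a 1/16
  -- fraction of the inputs exceed it, and they account for at most half of the expected m ^ 3 / 8
  -- triangles in the box.
  set t := 16 * (∑ ω, f ω) / N with ht
  obtain ⟨ℓ, hℓ⟩ : ∃ ℓ, ℓ = (κ + 1) * Nat.size (a ^ 3) + 2 := ⟨_, rfl⟩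
  obtain ⟨m, hm⟩ : ∃ m, m = a / 4 := ⟨_, rfl⟩
  -- Three blocks of m core vertices, with one vertex skipped between consecutive blocks, so that no
  -- pair from different blocks is a path edge. They fit because 3m + 2 ≤ a.
  set I := Finset.Ioc (a ^ 3 - a) (a ^ 3 - a + m) with hI
  set J := Finset.Ioc (a ^ 3 - a + m + 1) (a ^ 3 - a + m + 1 + m) with hJ
  set K := Finset.Ioc (a ^ 3 - a + m + 1 + m + 1) (a ^ 3 - a + m + 1 + m + 1 + m) with hK
  have hIc : I.card = m := by rw [hI, Nat.card_Ioc]; omega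
  have hJc : J.card = m := by rw [hJ, Nat.card_Ioc]; omega
  have hKc : K.card = m := by rw [hK, Nat.card_Ioc]; omega
  have hfree : ∀ x ∈ I, ∀ y ∈ J, ∀ z ∈ K,
      (x, y) ∈ freePairs a ∧ (y, z) ∈ freePairs a ∧ (x, z) ∈ freePairs a := by
    intro x hx y hy z hz
    rw [hI, Finset.mem_Ioc] at hx
    rw [hJ, Finset.mem_Ioc] at hy
    rw [hK, Finset.mem_Ioc] at hz
    simp only [mem_freePairs]
    omega
  have hgood := lollipop_ncc_card_bound hκ (by omega) hC A τ hA t ℓ hℓ I J K m hIc.le hJc.le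
    hKc.le
  rw [← hN] at hgood
  have hall := sum_card_triples_mul (F := freePairs a) (I ×ˢ J ×ˢ K) (by
    rintro ⟨x, y, z⟩ h
    simp only [Finset.mem_product] at h
    obtain ⟨h1, h2, h3⟩ := hfree x h.1 y h.2.1 z h.2.2
    have := mem_freePairs.mp h1
    have := mem_freePairs.mp h2
    exact ⟨by dsimp only; omega, by dsimp only; omega, h1, h2, h3⟩)
  have hTc : (I ×ˢ J ×ˢ K).card = m ^ 3 := by
    rw [Finset.card_product, Finset.card_product, hIc, hJc, hKc]
    ring
  rw [hTc, ← hN] at hall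
  rw [← Finset.sum_filter_add_sum_filter_not Finset.univ fun ω => f ω ≤ t] at hall
  have hbad : 16 * (Finset.univ.filter fun ω => ¬ f ω ≤ t).card ≤ N := by
    set b := (Finset.univ.filter fun ω => ¬ f ω ≤ t).card with hb
    have h1 : b * (t + 1) ≤ ∑ ω, f ω := by
      refine le_trans ?_ (Finset.sum_le_sum_of_subset (Finset.filter_subset (fun ω => ¬ f ω ≤ t) _))
      rw [← smul_eq_mul]
      refine Finset.card_nsmul_le_sum _ _ _ fun ω hω => ?_
      have := (Finset.mem_filter.mp hω).2
      omega
    have h2 : 16 * ∑ ω, f ω < (t + 1) * N := by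
      rw [mul_comm (t + 1)]
      exact Nat.lt_mul_div_succ _ hN0
    refine Nat.le_of_mul_le_mul_right (?_ : _ ≤ N * (t + 1)) t.succ_pos
    linarith
  have hbadsum : ∑ ω with ¬ f ω ≤ t, ((I ×ˢ J ×ˢ K).filter fun t => (t.1, t.2.1) ∈ edgesOf ω ∧
      (t.2.1, t.2.2) ∈ edgesOf ω ∧ (t.1, t.2.2) ∈ edgesOf ω).card ≤
      (Finset.univ.filter fun ω => ¬ f ω ≤ t).card * m ^ 3 := by
    rw [← smul_eq_mul]
    exact Finset.sum_le_card_nsmul _ _ _ fun ω _ => (Finset.card_filter_le _ _).trans hTc.le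
  have h1 : m ^ 3 * N ≤ 16 * (3 * m * (N * (a * (2 * C * ℓ * t + 1) + 1))) := by
    have := Nat.mul_le_mul_left (m ^ 3) hbad
    have := Nat.mul_le_mul_left 16 hgood
    have := Nat.mul_le_mul_left 16 hbadsum
    linarith
  have h2 : m ^ 2 ≤ 48 * (a * (2 * C * ℓ * t + 1) + 1) := by
    have hmN : 0 < m * N := Nat.mul_pos (by omega) hN0
    refine Nat.le_of_mul_le_mul_left ?_ hmN
    linarith
  have h3 : a ≤ 8 * m := by omega
  have h4 : a * a ≤ a * (6144 * (C * ℓ * t) + 6144) := by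
    have : a * a ≤ (8 * m) * (8 * m) := Nat.mul_le_mul h3 h3
    nlinarith
  have h5 : a ≤ 6144 * (C * ℓ * t) + 6144 := Nat.le_of_mul_le_mul_left h4 (by omega)
  -- As a ≥ 12288, the additive 6144 is at most a / 2 and can be absorbed by doubling.
  have h6 : a ≤ 12288 * (C * ℓ * t) := by omega
  have h7 : t * N ≤ 16 * ∑ ω, f ω := Nat.div_mul_le_self _ _
  calc a * N ≤ 12288 * (C * ℓ * t) * N := Nat.mul_le_mul_right _ h6
    _ = 12288 * (C * ℓ) * (t * N) := by ring
    _ ≤ 12288 * (C * ℓ) * (16 * ∑ ω, f ω) := Nat.mul_le_mul_left _ h7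
    _ = 16 * 12288 * C * ((κ + 1) * Nat.size (a ^ 3) + 2) * ∑ ω, f ω := by rw [← hℓ]; ring

theorem size_le_log {n : ℕ} (hn : 3 ≤ n) : (Nat.size n : ℝ) ≤ 3 * Real.log n ∧ 1 ≤ Real.log n := by
  have hn0 : (0 : ℝ) < n := by exact_mod_cast (by omega : 0 < n)
  have h1 : 1 ≤ Real.log n := by
    rw [Real.le_log_iff_exp_le hn0]
    exact Real.exp_one_lt_three.le.trans (by exact_mod_cast hn)
  refine ⟨?_, h1⟩
  have hs : 0 < Nat.size n := Nat.size_pos.mpr (by omega)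
  have h2 : 2 ^ (Nat.size n - 1) ≤ n := Nat.lt_size.mp (by omega)
  have h3 : ((Nat.size n - 1 : ℕ) : ℝ) * Real.log 2 ≤ Real.log n := by
    rw [← Real.log_pow]
    exact Real.log_le_log (by positivity) (by exact_mod_cast h2)
  rw [Nat.cast_sub hs, Nat.cast_one] at h3
  -- The size exceeds log n / log 2 by at most 1. Since 1 / log 2 < 3 / 2 and log n ≥ 1, the factor
  -- 3 is enough.
  have h4 := Real.log_two_gt_d9
  have h5 : (0 : ℝ) ≤ (Nat.size n : ℝ) - 1 := by
    have : (1 : ℝ) ≤ Nat.size n := by exact_mod_cast hs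
    linarith
  nlinarith

theorem lollipop_ncc_expectation_lower_bound {κ : ℕ} (hκ : 1 ≤ κ) {a : ℕ} (ha : 12288 ≤ a) {C : ℕ}
    {A : NCCAlgorithm} {τ : Instance → ℕ}
    (hA : NCCSolves A (lollipopTriangles κ hκ {a}) (fun _ => C) τ) :
    1 / (16 * 12288 * (3 * κ + 5) : ℝ) * (a / (C * Real.log ((a : ℝ) ^ 3))) ≤
      lollipopExpectation a τ := by
  unfold lollipopExpectation
  -- For C = 0 the claimed bound is 0, by the convention for division by zero.
  rcases Nat.eq_zero_or_pos C with rfl | hC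
  · simp only [Nat.cast_zero, zero_mul, div_zero, mul_zero]
    positivity
  have h := lollipop_ncc_sum_lower_bound hκ ha hC A τ hA
  have hle : a ≤ a ^ 3 := Nat.le_self_pow (by norm_num) a
  obtain ⟨h1, h2⟩ := size_le_log (n := a ^ 3) (by omega)
  push_cast at h1 h2
  set l := Real.log ((a : ℝ) ^ 3)
  have h3 : (a : ℝ) * 2 ^ (freePairs a).card ≤ 16 * 12288 * C *
      ((κ + 1) * Nat.size (a ^ 3) + 2) * ∑ B ∈ (freePairs a).powerset, (τ (lollipop a B) : ℝ) := by
    exact_mod_cast h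
  set s := ∑ B ∈ (freePairs a).powerset, (τ (lollipop a B) : ℝ) with hS
  have hS0 : 0 ≤ s := by positivity
  have hC' : (0 : ℝ) < C := by exact_mod_cast hC
  have h4 : ((κ : ℝ) + 1) * Nat.size (a ^ 3) + 2 ≤ (3 * κ + 5) * l := by
    have := mul_le_mul_of_nonneg_left h1 (by positivity : (0 : ℝ) ≤ (κ : ℝ) + 1)
    linarith
  have h5 : (a : ℝ) * 2 ^ (freePairs a).card ≤ 16 * 12288 * C * ((3 * κ + 5) * l) * s := by
    refine h3.trans ?_
    gcongr
  rw [one_div_mul_eq_div, div_div, div_le_div_iff₀ (by positivity) (by positivity)]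
  linarith

/-- If every input finished within t rounds, so would the average. The factor t + 1 in the bound on
MS pushes the expectation to at least t + 1. -/
theorem lollipop_ncc_exists_slow {κ : ℕ} (hκ : 1 ≤ κ) (t : ℕ) {a : ℕ} (ha : 12288 ≤ a)
    {M S : ℕ} (hMS : a ^ 3 ≤ M * S)
    (hMS' : (M : ℝ) * S ≤ a * (a : ℝ) ^ 3 /
      ((t + 1) * (16 * 12288 * (3 * κ + 5)) * Real.log ((a : ℝ) ^ 3)))
    {A : NCCAlgorithm} {τ : Instance → ℕ}
    (hA : NCCSolves A (lollipopTriangles κ hκ {a}) (fun _ => M * S / a ^ 3) τ) :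
    ∃ B ∈ (freePairs a).powerset, t < τ (lollipop a B) := by
  by_contra! hcon
  have h := lollipop_ncc_expectation_lower_bound hκ ha hA
  have hle : a ≤ a ^ 3 := Nat.le_self_pow (by norm_num) a
  obtain ⟨-, h2⟩ := size_le_log (n := a ^ 3) (by omega)
  push_cast at h2
  set l := Real.log ((a : ℝ) ^ 3)
  have hC : 1 ≤ M * S / a ^ 3 := (Nat.one_le_div_iff (by omega)).mpr hMS
  have hCM : M * S / a ^ 3 * a ^ 3 ≤ M * S := Nat.div_mul_le_self _ _
  set C := M * S / a ^ 3
  have hC' : (1 : ℝ) ≤ C := by exact_mod_cast hC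
  have hCM' : (C : ℝ) * (a : ℝ) ^ 3 ≤ M * S := by exact_mod_cast hCM
  have ha0 : (0 : ℝ) < (a : ℝ) ^ 3 := by
    have : (0 : ℝ) < a := by exact_mod_cast (by omega : 0 < a)
    positivity
  set D : ℝ := 16 * 12288 * (3 * κ + 5) with hD
  have hD0 : 0 < D := by positivity
  have h3 : (C : ℝ) * ((t + 1) * D * l) ≤ a := by
    have := hCM'.trans hMS'
    rw [le_div_iff₀ (by positivity)] at this
    refine le_of_mul_le_mul_right ?_ ha0
    linarith
  have h4 : ((t : ℝ) + 1) ≤ 1 / D * (a / (C * l)) := by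
    rw [one_div_mul_eq_div, div_div, le_div_iff₀ (by positivity)]
    linarith
  have h5 : lollipopExpectation a τ ≤ t := by
    unfold lollipopExpectation
    rw [div_le_iff₀ (by positivity)]
    calc ∑ B ∈ (freePairs a).powerset, (τ (lollipop a B) : ℝ)
        ≤ ∑ B ∈ (freePairs a).powerset, (t : ℝ) :=
          Finset.sum_le_sum fun B hB => by exact_mod_cast hcon B hB
      _ = t * 2 ^ (freePairs a).card := by
          rw [Finset.sum_const, Finset.card_powerset, nsmul_eq_mul]
          push_cast
          ring
  linarith

/-! ### Total correctness of programs -/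

/-- Started in state `m`, the program `p` terminates in a state satisfying `Q`. -/
def Runs (E : Env) (W B : ℕ) (p : Prog) (Q : Machine → Prop) (m : Machine) : Prop :=
  ∃ m', Exec E W B p m m' ∧ Q m'

section Runs

variable {E : Env} {W B : ℕ}

theorem Runs.mono {p : Prog} {Q Q' : Machine → Prop} {m : Machine} (h : Runs E W B p Q m)
    (hQ : ∀ m, Q m → Q' m) : Runs E W B p Q' m :=
  let ⟨m', h1, h2⟩ := h
  ⟨m', h1, hQ m' h2⟩

theorem Runs.skip {Q : Machine → Prop} {m : Machine} (h : Q m) : Runs E W B .skip Q m :=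
  ⟨m, .skip m, h⟩

theorem Runs.seq {p q : Prog} {Q : Machine → Prop} {m : Machine}
    (h : Runs E W B p (Runs E W B q Q) m) : Runs E W B (.seq p q) Q m :=
  let ⟨_, h1, m₃, h2, h3⟩ := h
  ⟨m₃, .seq p q m _ m₃ h1 h2, h3⟩

theorem Runs.store {addr val : WExpr} {Q : Machine → Prop} {m : Machine}
    (ha : addr.eval E m.mem < B) (hv : val.eval E m.mem < W)
    (h : Q { m with mem := Function.update m.mem (addr.eval E m.mem) (val.eval E m.mem) }) :
    Runs E W B (.store addr val) Q m :=
  ⟨_, .store addr val m ha hv, h⟩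

theorem Runs.send {dest word : WExpr} {Q : Machine → Prop} {m : Machine}
    (hd : dest.eval E m.mem < E.M) (hw : word.eval E m.mem < W)
    (h : Q { m with outbox := m.outbox ++ [(dest.eval E m.mem, word.eval E m.mem)] }) :
    Runs E W B (.send dest word) Q m :=
  ⟨_, .send dest word m hd hw, h⟩

theorem Runs.emit {item : List WExpr} {Q : Machine → Prop} {m : Machine}
    (hi : ∀ x ∈ item, x.eval E m.mem < W)
    (h : Q { m with out := m.out ++ [item.map fun x => x.eval E m.mem] }) :
    Runs E W B (.emit item) Q m :=
  ⟨_, .emit item m hi, h⟩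

theorem Runs.halt {Q : Machine → Prop} {m : Machine} (h : Q { m with halted := true }) :
    Runs E W B .halt Q m :=
  ⟨_, .halt m, h⟩

theorem Runs.ite {cond : WExpr} {p q : Prog} {Q : Machine → Prop} {m : Machine}
    (h1 : cond.eval E m.mem ≠ 0 → Runs E W B p Q m)
    (h0 : cond.eval E m.mem = 0 → Runs E W B q Q m) : Runs E W B (.ite cond p q) Q m := by
  by_cases hc : cond.eval E m.mem = 0
  · obtain ⟨m', h2, h3⟩ := h0 hc
    exact ⟨m', .iteFalse cond p q m m' hc h2, h3⟩
  · obtain ⟨m', h2, h3⟩ := h1 hc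
    exact ⟨m', .iteTrue cond p q m m' hc h2, h3⟩

/-- Termination comes from fixing the number N of iterations in advance and indexing the invariant
by the iterations already made. -/
theorem Runs.while {cond : WExpr} {p : Prog} (N : ℕ) (Inv : ℕ → Machine → Prop)
    (hbody : ∀ i < N, ∀ m, Inv i m → cond.eval E m.mem ≠ 0 ∧ Runs E W B p (Inv (i + 1)) m)
    (hend : ∀ m, Inv N m → cond.eval E m.mem = 0) {m : Machine} (h0 : Inv 0 m) :
    Runs E W B (.while cond p) (Inv N) m := by
  have key : ∀ d i, i + d = N → ∀ m, Inv i m → Runs E W B (.while cond p) (Inv N) m := by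
    intro d
    induction d with
    | zero =>
      rintro i rfl m hm
      exact ⟨m, .whileFalse cond p m (hend m hm), hm⟩
    | succ d ih =>
      intro i hi m hm
      obtain ⟨hc, m₂, h2, hm2⟩ := hbody i (by omega) m hm
      obtain ⟨m₃, h3, hm3⟩ := ih (i + 1) (by omega) m₂ hm2
      exact ⟨m₃, .whileTrue cond p m m₂ m₃ hc h2 h3, hm3⟩
  exact key N 0 (zero_add N) m h0

end Runs

/-- `for mem[c] := 0, …, bound - 1 do body` -/
def forLoop (c : ℕ) (bound : WExpr) (body : Prog) : Prog :=
  .seq (.store (.const c) (.const 0))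
    (.while (.lt (.load (.const c)) bound)
      (.seq body (.store (.const c) (.add (.load (.const c)) (.const 1)))))

/-- Total correctness of `forLoop`, for an invariant that does not depend on the loop counter. -/
theorem Runs.forLoop {E : Env} {W B c N : ℕ} {bound : WExpr} {body : Prog}
    (Inv : ℕ → Machine → Prop) (hcB : c < B) (hNW : N < W)
    (hbound : ∀ i m, Inv i m → bound.eval E m.mem = N)
    (hstable : ∀ i m x, Inv i m → Inv i { m with mem := Function.update m.mem c x })
    (hbody : ∀ i < N, ∀ m, Inv i m → m.mem c = i →
      Runs E W B body (fun m' => Inv (i + 1) m' ∧ m'.mem c = i) m)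
    {m : Machine} (h0 : Inv 0 m) : Runs E W B (forLoop c bound body) (Inv N) m := by
  refine Runs.seq (Runs.store hcB (show 0 < W by omega) ?_)
  refine Runs.mono (Runs.while N (fun i m => Inv i m ∧ m.mem c = i) ?_ ?_
    ⟨hstable _ _ _ h0, Function.update_self _ _ _⟩) fun m h => h.1
  · rintro i hi m ⟨hm, hc⟩
    refine ⟨?_, Runs.seq ((hbody i hi m hm hc).mono ?_)⟩
    · simp [WExpr.eval, hbound i m hm, hc, hi]
    · rintro m' ⟨hm', hc'⟩
      refine Runs.store hcB ?_ ⟨hstable _ _ _ hm', ?_⟩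
      · simp only [WExpr.eval, hc']
        omega
      · simp [WExpr.eval, hc']
  · rintro m ⟨hm, hc⟩
    simp [WExpr.eval, hbound N m hm, hc]

theorem getD_flatMap {β γ : Type*} (f : β → List γ) (k : ℕ) (d : γ) (L : List β)
    (hlen : ∀ p ∈ L, (f p).length = k) (i j : ℕ) (hi : i < L.length) (hj : j < k) :
    (L.flatMap f).getD (k * i + j) d = (f L[i]).getD j d := by
  induction L generalizing i with
  | nil => simp at hi
  | cons p L ih =>
    have hp : (f p).length = k := hlen p List.mem_cons_self
    rw [List.flatMap_cons]
    cases i with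
    | zero => rw [List.getD_append _ _ _ _ (by omega)]; simp
    | succ i =>
      rw [List.getD_append_right _ _ _ _ (by rw [hp]; nlinarith)]
      have h1 : k * (i + 1) + j - (f p).length = k * i + j := by
        rw [hp, Nat.mul_succ]
        omega
      rw [h1, ih (fun q hq => hlen q (List.mem_cons_of_mem _ hq)) i (by simpa using hi)]
      rfl

theorem length_flatMap_const {β γ : Type*} (f : β → List γ) (k : ℕ) (L : List β)
    (hlen : ∀ p ∈ L, (f p).length = k) : (L.flatMap f).length = k * L.length := by
  rw [List.length_flatMap, List.map_congr_left hlen, List.map_const', List.sum_replicate,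
    smul_eq_mul, mul_comm]

/-! ### Reporting the labelled edges of a clique -/

/-- The description of the edge `u v`: endpoints, labels of the endpoints, label of the edge. -/
def edgeItem (I : Instance) (u v : ℕ) : List ℕ :=
  [u, v] ++ I.nodeLabel u ++ I.nodeLabel v ++ I.edgeLabel s(u, v)

/-- The clique on the first `k` of `n` nodes; `y` gives the labels of the edges, and of the nodes on
the diagonal. -/
def cliqueInstance (n k : ℕ) (hk : k ≤ n) (y : Sym2 ℕ → ℕ) : Instance where
  V := Finset.range n
  G := SimpleGraph.fromRel fun u v => u < k ∧ v < k
  mem_of_adj := fun u v h => by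
    rw [SimpleGraph.fromRel_adj] at h
    rw [Finset.mem_range]
    omega
  nodeLabel := fun u => [y s(u, u)]
  edgeLabel := fun e => [y e]

theorem cliqueInstance_n (n k : ℕ) (hk : k ≤ n) (y : Sym2 ℕ → ℕ) :
    (cliqueInstance n k hk y).n = n := by
  simp [cliqueInstance, Instance.n]

theorem cliqueInstance_adj {n k : ℕ} {hk : k ≤ n} {y : Sym2 ℕ → ℕ} {u v : ℕ} :
    (cliqueInstance n k hk y).G.Adj u v ↔ u ≠ v ∧ u < k ∧ v < k := by
  simp only [cliqueInstance, SimpleGraph.fromRel_adj]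
  tauto

theorem edgeItem_cliqueInstance {n k : ℕ} {hk : k ≤ n} {y : Sym2 ℕ → ℕ} {u v : ℕ} :
    edgeItem (cliqueInstance n k hk y) u v = [u, v, y s(u, u), y s(v, v), y s(u, v)] := rfl

theorem arboricity_cliqueInstance_le (n k : ℕ) (hk : k ≤ n) (y : Sym2 ℕ → ℕ) :
    arboricity (cliqueInstance n k hk y).G ≤ k := by
  refine arboricity_le_of_coloring _ k (fun _ v => v) ?_ ?_
  · exact fun u v _ h => (cliqueInstance_adj.mp h).2.2
  · exact fun u v w _ _ _ _ h => h

theorem ncard_edgeSet_cliqueInstance_le (n k : ℕ) (hk : k ≤ n) (y : Sym2 ℕ → ℕ) :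
    (cliqueInstance n k hk y).G.edgeSet.ncard ≤ k * k := by
  have hsub : (cliqueInstance n k hk y).G.edgeSet ⊆
      ((Finset.range k ×ˢ Finset.range k).image fun p => s(p.1, p.2) : Finset (Sym2 ℕ)) := by
    intro e
    induction e using Sym2.ind with
    | _ u v =>
      intro h
      have := cliqueInstance_adj.mp (show (cliqueInstance n k hk y).G.Adj u v from h)
      exact Finset.mem_coe.mpr (Finset.mem_image.mpr ⟨(u, v), by simp [this.2.1, this.2.2], rfl⟩)
  refine (Set.ncard_le_ncard hsub (Finset.finite_toSet _)).trans ?_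
  rw [Set.ncard_coe_finset]
  exact Finset.card_image_le.trans (by simp)

/-- The problem of reporting the descriptions of all edges (each in at least one orientation) of a
clique on the first `k n` of `n ≥ N` nodes. -/
def cliqueEdges (κ N : ℕ) (k : ℕ → ℕ) : GraphProblem κ where
  instances := {I | ∃ n ≥ N, 1 ≤ n ∧ 1 ≤ κ ∧ ∃ (hk : k n ≤ n) (y : Sym2 ℕ → ℕ),
    (∀ e, y e < wordBound κ n) ∧ I = cliqueInstance n (k n) hk y}
  legal := fun I => {s | (∀ x ∈ s, ∃ u v, I.G.Adj u v ∧ x = edgeItem I u v) ∧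
    ∀ u v, I.G.Adj u v → edgeItem I u v ∈ s ∨ edgeItem I v u ∈ s}
  labelWords := 1
  outExp := 5
  id_lt := by
    rintro I ⟨n, -, -, hκ, hk, y, -, rfl⟩ v hv
    rw [cliqueInstance_n]
    calc v < n := Finset.mem_range.mp hv
      _ < 2 ^ Nat.size n := Nat.lt_size_self _
      _ ≤ wordBound κ n := Nat.pow_le_pow_right (by norm_num) (Nat.le_mul_of_pos_left _ hκ)
  nodeLabel_words := by
    rintro I ⟨n, -, -, -, hk, y, hy, rfl⟩ v -
    rw [cliqueInstance_n]
    exact ⟨rfl, fun x hx => by rw [List.mem_singleton.mp hx]; exact hy _⟩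
  edgeLabel_words := by
    rintro I ⟨n, -, -, -, hk, y, hy, rfl⟩ e -
    rw [cliqueInstance_n]
    exact ⟨rfl, fun x hx => by rw [List.mem_singleton.mp hx]; exact hy _⟩
  legal_size := by
    rintro I ⟨n, -, hn, -, hk, y, -, rfl⟩ s ⟨hs, -⟩
    rw [cliqueInstance_n]
    have h1 : outSize s ≤ s.card * 5 := by
      refine Finset.sum_le_card_nsmul _ _ _ fun x hx => ?_
      obtain ⟨u, v, -, rfl⟩ := hs x hx
      exact le_rfl
    have h2 : s.card ≤ n * n := by
      have hsub : s ⊆ (Finset.range n ×ˢ Finset.range n).image fun p =>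
          edgeItem (cliqueInstance n (k n) hk y) p.1 p.2 := by
        intro x hx
        obtain ⟨u, v, huv, rfl⟩ := hs x hx
        have := cliqueInstance_adj.mp huv
        refine Finset.mem_image.mpr ⟨(u, v), ?_, rfl⟩
        rw [Finset.mem_product, Finset.mem_range, Finset.mem_range]
        omega
      exact (Finset.card_le_card hsub).trans (Finset.card_image_le.trans (by simp))
    calc outSize s ≤ n * n * 5 := h1.trans (Nat.mul_le_mul_right 5 h2)
      _ ≤ (n + 1) ^ 2 * (n + 1) ^ 3 := by
        refine Nat.mul_le_mul (by nlinarith) ?_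
        calc 5 ≤ 2 ^ 3 := by norm_num
          _ ≤ (n + 1) ^ 3 := Nat.pow_le_pow_left (by omega) 3
      _ = (n + 1) ^ 5 := by ring

/-- Every machine reports the descriptions of its edges and halts. -/
def reportEdges : MPCAlgorithm where
  prog := .seq
    (forLoop 0 (.div .inputLen (.const 5))
      (.emit ((List.range 5).map fun j =>
        .input (.add (.mul (.const 5) (.load (.const 0))) (.const j)))))
    .halt
  memFactor := 5
  outFactor := 1

theorem inputWords_cliqueInstance {n k : ℕ} {hk : k ≤ n} {y : Sym2 ℕ → ℕ} (L : List (ℕ × ℕ)) :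
    inputWords (cliqueInstance n k hk y) L =
      L.flatMap fun p => edgeItem (cliqueInstance n k hk y) p.1 p.2 := rfl

theorem reportEdges_runs {n k : ℕ} {hk : k ≤ n} {y : Sym2 ℕ → ℕ} {E : Env} {W B : ℕ}
    (L : List (ℕ × ℕ)) (hE : E.input = inputWords (cliqueInstance n k hk y) L) (hB : 0 < B)
    (hL : L.length < W)
    (hW : ∀ p ∈ L, ∀ x ∈ edgeItem (cliqueInstance n k hk y) p.1 p.2, x < W) (m : Machine)
    (hm : m.outbox = [] ∧ m.out = []) :
    Runs E W B reportEdges.prog (fun m' => m'.outbox = [] ∧ m'.halted = true ∧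
      m'.out = L.map fun p => edgeItem (cliqueInstance n k hk y) p.1 p.2) m := by
  set I := cliqueInstance n k hk y with hI
  refine Runs.seq ((Runs.forLoop (N := L.length) (fun i m => m.outbox = [] ∧
    m.out = (L.take i).map fun p => edgeItem I p.1 p.2) hB hL ?_ ?_ ?_ (by simpa using hm)).mono ?_)
  · rintro i m -
    simp only [WExpr.eval, hE, hI, inputWords_cliqueInstance]
    rw [length_flatMap_const _ 5 L fun _ _ => rfl]
    exact Nat.mul_div_cancel_left _ (by norm_num)
  · rintro i m x ⟨h1, h2⟩
    exact ⟨h1, h2⟩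
  · rintro i hi m ⟨h1, h2⟩ hc
    have hitem : (((List.range 5).map fun j =>
        WExpr.input (.add (.mul (.const 5) (.load (.const 0))) (.const j))).map fun x =>
          x.eval E m.mem) = edgeItem I L[i].1 L[i].2 := by
      refine List.ext_getElem (by simp [hI, edgeItem_cliqueInstance]) fun j hj hj' => ?_
      have hj5 : j < 5 := by simpa using hj
      simp only [List.getElem_map, List.getElem_range, WExpr.eval, hc, hE]
      exact (getD_flatMap (fun p => edgeItem I p.1 p.2) 5 0 L (fun _ _ => rfl) i j hi hj5).trans
        (List.getD_eq_getElem _ _ hj')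
    refine Runs.emit ?_ ⟨⟨h1, ?_⟩, hc⟩
    · intro x hx
      have h3 : x.eval E m.mem ∈ edgeItem I L[i].1 L[i].2 := by
        rw [← hitem]
        exact List.mem_map_of_mem hx
      exact hW _ (List.getElem_mem hi) _ h3
    · dsimp only
      rw [hitem, h2, List.take_add_one, List.getElem?_eq_getElem hi,
        List.map_append]
      rfl
  · rintro m ⟨h1, h2⟩
    exact Runs.halt ⟨h1, rfl, by simpa using h2⟩

theorem outSize_toFinset {l : List (List ℕ)} (h : l.Nodup) :
    outSize l.toFinset = (l.map List.length).sum :=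
  List.sum_toFinset _ h

/-- No communication is needed, since the input format lists with each edge the labels of both
endpoints. Each edge lies on exactly one machine, so no item is repeated and the output factor is 1.
The hypothesis `hk` ensures that the edges of the clique fit into the total memory. -/
theorem reportEdges_solves {κ N : ℕ} {k M S : ℕ → ℕ}
    (hM : ∀ n ≥ N, M n < wordBound κ n) (hS : ∀ n ≥ N, S n < wordBound κ n)
    (hS0 : ∀ n ≥ N, 0 < S n) (hk : ∀ n ≥ N, k n * k n ≤ M n * S n) :
    MPCSolves reportEdges (cliqueEdges κ N k) M S fun _ => 1 := by
  intro I hI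
  obtain ⟨n, hn, hn1, hκ, hkn, y, hy, hIeq⟩ := id hI
  have hIn : I.n = n := by rw [hIeq, cliqueInstance_n]
  rw [hIn]
  refine ⟨hM n hn, hS n hn, ?_, fun inp hinp => ?_⟩
  · rw [hIeq]
    exact (ncard_edgeSet_cliqueInstance_le _ _ _ _).trans (hk n hn)
  obtain ⟨hlen, hnodup, hmem⟩ := hinp
  have hadj : ∀ i < M n, ∀ p ∈ inp i, I.G.Adj p.1 p.2 := fun i hi p hp =>
    (hmem _).mp (List.mem_map.mpr ⟨p, List.mem_flatMap.mpr ⟨i, List.mem_range.mpr hi, hp⟩, rfl⟩)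
  have hidlt : ∀ v ∈ I.V, v < wordBound κ n := fun v hv => hIn ▸ (cliqueEdges κ N k).id_lt I hI v hv
  let c₀ : ℕ → Machine := fun _ => ⟨fun _ => 0, [], [], false⟩
  have hstep : ∀ i < M n, Runs (mpcEnv I (M n) (S n) inp c₀ i) (wordBound κ n) (5 * S n)
      reportEdges.prog (fun m' => m'.outbox = [] ∧ m'.halted = true ∧
        m'.out = (inp i).map fun p => edgeItem I p.1 p.2) ⟨fun _ => 0, [], [], false⟩ := by
    intro i hi
    subst hIeq
    refine reportEdges_runs (inp i) rfl (Nat.mul_pos (by norm_num) (hS0 n hn))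
      ((hlen i hi).trans_lt (hS n hn)) ?_ _ ⟨rfl, rfl⟩
    intro p hp x hx
    have h1 := hadj i hi p hp
    rw [edgeItem_cliqueInstance] at hx
    simp only [List.mem_cons, List.not_mem_nil, or_false] at hx
    rcases hx with rfl | rfl | rfl | rfl | rfl
    · exact hidlt _ (Instance.mem_of_adj _ _ _ h1)
    · exact hidlt _ (Instance.mem_of_adj _ _ _ h1.symm)
    all_goals exact hy _
  have : Nonempty Machine := ⟨c₀ 0⟩
  choose! c₁ hc₁ using hstep
  let conf : ℕ → ℕ → Machine := fun r => if r = 0 then c₀ else c₁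
  have h0 : conf 0 = c₀ := rfl
  have h1 : conf 1 = c₁ := rfl
  have hbox : ∀ r ≤ 1, ∀ i < M n, (conf r i).outbox = [] := by
    intro r hr i hi
    interval_cases r
    · rfl
    · exact (hc₁ i hi).2.1
  have houtlen : ∀ L : List (ℕ × ℕ),
      ((L.map fun p => edgeItem I p.1 p.2).map List.length).sum = 5 * L.length := by
    intro L
    subst hIeq
    rw [List.map_map]
    change (L.map fun _ => 5).sum = _
    rw [List.map_const', List.sum_replicate, smul_eq_mul, mul_comm]
  refine ⟨conf, ⟨fun i => rfl, ?_, ?_⟩, fun i hi => (hc₁ i hi).2.2.1, ?_⟩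
  · intro r hr i hi
    obtain rfl : r = 0 := Nat.lt_one_iff.mp hr
    rw [zero_add, h0, h1]
    unfold mpcStep
    rw [if_neg (by simp [c₀]), hIn]
    exact (hc₁ i hi).1
  · intro r hr i hi
    rw [hbox r hr i hi]
    refine ⟨Nat.zero_le _, ?_, ?_⟩
    · have : deliver (List.range (M n)) (fun j => (conf r j).outbox) i =
          deliver (List.range (M n)) (fun _ => []) i :=
        deliver_congr (fun j hj => hbox r hr j (List.mem_range.mp hj)) i
      rw [this]
      simp [deliver]
    · interval_cases r
      · simp [h0, c₀]
      · rw [h1, (hc₁ i hi).2.2.2, houtlen]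
        exact Nat.mul_le_mul_left 5 (hlen i hi)
  · have hout : ((List.range (M n)).flatMap fun i => (conf 1 i).out) =
        ((List.range (M n)).flatMap inp).map fun p => edgeItem I p.1 p.2 := by
      rw [List.map_flatMap, List.flatMap_def, List.flatMap_def]
      congr 1
      exact List.map_congr_left fun i hi => (hc₁ i (List.mem_range.mp hi)).2.2.2
    rw [hout]
    refine ⟨_, ⟨?_, ?_⟩, rfl, ?_⟩
    · intro x hx
      rw [List.mem_toFinset] at hx
      obtain ⟨p, hp, rfl⟩ := List.mem_map.mp hx
      obtain ⟨i, hi, hp⟩ := List.mem_flatMap.mp hp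
      exact ⟨p.1, p.2, hadj i (List.mem_range.mp hi) p hp, rfl⟩
    · intro u v huv
      simp only [List.mem_toFinset]
      obtain ⟨p, hp, hpe⟩ := List.mem_map.mp ((hmem s(u, v)).mpr huv)
      rcases Sym2.eq_iff.mp hpe with ⟨h1, h2⟩ | ⟨h1, h2⟩
      · exact Or.inl (List.mem_map.mpr ⟨p, hp, by rw [h1, h2]⟩)
      · exact Or.inr (List.mem_map.mpr ⟨p, hp, by rw [h1, h2]⟩)
    · rw [outSize_toFinset]
      · exact (one_mul _).ge
      · refine List.Nodup.map ?_ hnodup.of_map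
        subst hIeq
        rintro ⟨u, v⟩ ⟨u', v'⟩ h
        dsimp only at h
        rw [edgeItem_cliqueInstance, edgeItem_cliqueInstance] at h
        simp only [List.cons.injEq] at h
        exact Prod.ext h.1 h.2.1

/-! ### The clique problem in NCC -/

/-- The extension by zero of a function on `F`. -/
def extendZero {F : Finset (Sym2 ℕ)} {W : ℕ} (ω : F → Fin W) (e : Sym2 ℕ) : ℕ :=
  if h : e ∈ F then (ω ⟨e, h⟩ : ℕ) else 0

theorem cliqueInstance_conf_zero_congr (A : NCCAlgorithm) {n k : ℕ} (hk : k ≤ n) {v : ℕ}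
    {y y' : Sym2 ℕ → ℕ} (h : ∀ e, v ∈ e → y e = y' e) :
    A.conf (cliqueInstance n k hk y) 0 v = A.conf (cliqueInstance n k hk y') 0 v := by
  have h1 : (cliqueInstance n k hk y).incidentLabel v =
      (cliqueInstance n k hk y').incidentLabel v := by
    funext u
    have h2 : (cliqueInstance n k hk y).edgeLabel s(v, u) =
        (cliqueInstance n k hk y').edgeLabel s(v, u) :=
      congrArg (fun x => [x]) (h s(v, u) (Sym2.mem_mk_left v u))
    unfold Instance.incidentLabel
    rw [h2]
    rfl
  change A.init _ v _ [y s(v, v)] _ = A.init _ v _ [y' s(v, v)] _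
  rw [h s(v, v) (Sym2.mem_mk_left v v), h1]
  rfl

/-- The coordinates are all node and edge labels of the clique, independent words. For a complete
bipartite half of the clique, every edge forces its reporter to reveal a label it did not know, and
for a fixed reporter these labels are distinct. Comparing the h ^ 2 revealed labels, h = ⌊k/2⌋, with
`ncc_sum_revealed_le` gives h = O(C t). -/
theorem clique_ncc_bound {κ N : ℕ} (hκ : 2 ≤ κ) {k : ℕ → ℕ} {C : ℕ → ℕ} {A : NCCAlgorithm}
    {τ : Instance → ℕ} {N' t : ℕ} (hA : NCCSolves A ((cliqueEdges κ N k).restrict N') C τ)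
    (hτ : ∀ I ∈ ((cliqueEdges κ N k).restrict N').instances, τ I ≤ t) {n : ℕ} (hn : N ≤ n)
    (hn' : N' ≤ n) (hn1 : 1 ≤ n) (hkn : k n ≤ n) (hk2 : 2 ≤ k n) (hC : 1 ≤ C n) :
    k n ≤ 24 * C n * t + 13 := by
  classical
  set K := k n with hK
  set W := wordBound κ n with hW
  set F := (Finset.range K).sym2 with hF
  -- This is where κ ≥ 2 enters: it gives n W + 3 ≤ W ^ 2, so a message with its address is worth ℓ
  -- = 2 coordinates.
  have hWn : (n + 1) * (n + 1) ≤ W := by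
    have : n + 1 ≤ 2 ^ Nat.size n := Nat.lt_size_self n
    calc (n + 1) * (n + 1) ≤ 2 ^ Nat.size n * 2 ^ Nat.size n := Nat.mul_le_mul this this
      _ = 2 ^ (2 * Nat.size n) := by rw [← pow_add]; congr 1; ring
      _ ≤ W := Nat.pow_le_pow_right (by norm_num) (Nat.mul_le_mul_right _ hκ)
  have hW4 : 4 ≤ W := by nlinarith
  let inst : (F → Fin W) → Instance := fun ω => cliqueInstance n K hkn (extendZero ω)
  have hinst : ∀ ω, inst ω ∈ ((cliqueEdges κ N k).restrict N').instances := by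
    intro ω
    refine ⟨⟨n, hn, hn1, by omega, hkn, extendZero ω, fun e => ?_, rfl⟩, ?_⟩
    · unfold extendZero
      split_ifs with h
      · exact (ω ⟨e, h⟩).2
      · exact (by omega : 0 < W)
    · rw [cliqueInstance_n]
      exact hn'
  let known : ℕ → Finset F := fun v => Finset.univ.filter fun e => v ∈ e.1
  -- Only the first two entries of an item name vertices; the labels that follow may coincide with
  -- vertex names. An item for u, w reveals the labels of u, of w and of the edge between them.
  let coords : List ℕ → Finset F := fun l => Finset.univ.filter fun e => ∀ u ∈ e.1, u ∈ l.take 2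
  have hrep : ∀ ω, ∃ s : Finset (List ℕ), ((∀ x ∈ s, ∃ u v, (inst ω).G.Adj u v ∧
        x = edgeItem (inst ω) u v) ∧
      ∀ u v, (inst ω).G.Adj u v → edgeItem (inst ω) u v ∈ s ∨ edgeItem (inst ω) v u ∈ s) ∧
      (∀ x ∈ s, ∃ v ∈ Finset.range n, x ∈ A.reported (inst ω) (τ (inst ω)) v) ∧
      ∀ v ∈ Finset.range n, ∀ x ∈ A.reported (inst ω) (τ (inst ω)) v, x ∈ s := fun ω =>
    hA.mem_reported (hinst ω)
  have hzero : ∀ ω ω' : F → Fin W, ∀ v, (∀ i ∈ known v, ω i = ω' i) →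
      A.conf (inst ω) 0 v = A.conf (inst ω') 0 v := by
    intro ω ω' v h
    refine cliqueInstance_conf_zero_congr A hkn fun e he => ?_
    unfold extendZero
    split_ifs with heF
    · rw [h ⟨e, heF⟩ (Finset.mem_filter.mpr ⟨Finset.mem_univ _, he⟩)]
    · rfl
  have hmain := ncc_sum_revealed_le (ι := F) (α := Fin W) (by rw [Fintype.card_fin]; omega) A inst
    (Finset.range n) (Finset.range K) known W (C n) t 2
    (Finset.range_subset_range.mpr hkn) ⟨0, Finset.mem_range.mpr (by omega)⟩ (fun _ => rfl)
    (fun ω ω' v _ h => hzero ω ω' v h)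
    (fun ω ω' v _ hv => hzero ω ω' v fun i hi => absurd
      (Finset.mem_sym2_iff.mp i.2 v (Finset.mem_filter.mp hi).2) hv)
    Finset.univ (fun ω => τ (inst ω)) (fun ω _ => hτ _ (hinst ω))
    (fun ω _ r hr v hv => by
      have := (hA _ (hinst ω)).1 r hr v hv
      rw [cliqueInstance_n] at this
      exact this)
    hC
    (by
      rw [Fintype.card_fin, Finset.card_range, sq]
      nlinarith)
    coords
    (by
      intro ω _ ω' _ v hv x hx hx' i hi
      obtain ⟨s, ⟨hs, -⟩, -, hs'⟩ := hrep ω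
      obtain ⟨s₂, ⟨hs₂, -⟩, -, hs₂'⟩ := hrep ω'
      obtain ⟨u, w, -, rfl⟩ := hs x (hs' v hv x hx)
      obtain ⟨u', w', -, h⟩ := hs₂ _ (hs₂' v hv _ hx')
      rw [edgeItem_cliqueInstance, edgeItem_cliqueInstance] at h
      simp only [List.cons.injEq, and_true] at h
      obtain ⟨rfl, rfl, h1, h2, h3⟩ := h
      obtain ⟨e, he⟩ := i
      have hi := (Finset.mem_filter.mp hi).2
      have hval : extendZero ω e = extendZero ω' e := by
        induction e using Sym2.ind with
        | _ b c =>
          have hb : b = u ∨ b = w := by simpa [edgeItem] using hi b (Sym2.mem_mk_left b c)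
          have hc : c = u ∨ c = w := by simpa [edgeItem] using hi c (Sym2.mem_mk_right b c)
          rcases hb with rfl | rfl <;> rcases hc with rfl | rfl
          · exact h1
          · exact h3
          · rw [Sym2.eq_swap]; exact h3
          · exact h2
      unfold extendZero at hval
      rw [dif_pos he, dif_pos he] at hval
      exact Fin.ext hval)
  rw [Fintype.card_fin, Finset.card_range] at hmain
  set h := K / 2 with hh
  let D : Finset (ℕ × ℕ) := Finset.range h ×ˢ Finset.Ico h (2 * h)
  have hDc : D.card = h * h := by
    simp only [D, Finset.card_product, Finset.card_range, Nat.card_Ico]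
    congr 1
    omega
  have hDmem : ∀ p ∈ D, p.1 < h ∧ h ≤ p.2 ∧ p.2 < 2 * h := fun p hp => by
    simpa [D] using hp
  have hpt : ∀ ω ∈ (Finset.univ : Finset (F → Fin W)), h * h ≤
      ((Finset.range n \ Finset.range K).biUnion fun v =>
          (A.reported (inst ω) (τ (inst ω)) v).toFinset.biUnion coords).card +
        ∑ v ∈ Finset.range K,
          ((A.reported (inst ω) (τ (inst ω)) v).toFinset.biUnion coords \ known v).card := by
    intro ω _
    have hcount : ∀ (φ : ℕ × ℕ → Sym2 ℕ) (Q : Finset F), Set.InjOn φ D →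
        (D.filter fun p => φ p ∈ Q.map (Function.Embedding.subtype _)).card ≤ Q.card := by
      intro φ Q hφ
      rw [← Finset.card_map (Function.Embedding.subtype _)]
      refine Finset.card_le_card_of_injOn φ (fun p hp => (Finset.mem_filter.mp hp).2)
        (hφ.mono fun p hp => (Finset.mem_filter.mp hp).1)
    -- A coordinate of the item for p that v does not know: the label of the other endpoint if v is
    -- an endpoint, and the edge label otherwise. On `D` the two ends come from disjoint ranges, so
    -- this choice is injective for each v.
    let φ : ℕ → ℕ × ℕ → Sym2 ℕ := fun v p =>
      if p.1 = v then s(p.2, p.2) else if p.2 = v then s(p.1, p.1) else s(p.1, p.2)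
    have hφ₀ : Set.InjOn (fun p : ℕ × ℕ => s(p.1, p.2)) D := by
      rintro ⟨u, w⟩ h1 ⟨u', w'⟩ h2 h3
      have h1 := hDmem _ h1
      have h2 := hDmem _ h2
      simp only [Sym2.eq_iff, Prod.mk.injEq] at h3 h1 h2 ⊢
      omega
    have hφ : ∀ v, Set.InjOn (φ v) D := by
      rintro v ⟨u, w⟩ h1 ⟨u', w'⟩ h2 h3
      have h1 := hDmem _ h1
      have h2 := hDmem _ h2
      simp only [φ, Prod.mk.injEq] at h3 h1 h2 ⊢
      split_ifs at h3 <;> simp only [Sym2.eq_iff] at h3 <;> omega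
    rw [← hDc]
    refine le_trans (Finset.card_le_card (t := (D.filter fun p => s(p.1, p.2) ∈ Finset.map _ _) ∪
      (Finset.range K).biUnion fun v => D.filter fun p => φ v p ∈ Finset.map _ _) ?_)
      ((Finset.card_union_le _ _).trans (Nat.add_le_add (hcount _ _ hφ₀)
        (Finset.card_biUnion_le.trans (Finset.sum_le_sum fun v _ => hcount _ _ (hφ v)))))
    rintro ⟨u, w⟩ hp
    obtain ⟨hu, hw, hw'⟩ := hDmem _ hp
    dsimp only at hu hw hw'
    obtain ⟨s, ⟨-, hs⟩, hs', -⟩ := hrep ω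
    obtain ⟨x, hx, hux, hwx⟩ : ∃ x ∈ s, u ∈ x.take 2 ∧ w ∈ x.take 2 := by
      rcases hs u w (cliqueInstance_adj.mpr (by omega)) with h1 | h1
      · exact ⟨_, h1, by simp [edgeItem], by simp [edgeItem]⟩
      · exact ⟨_, h1, by simp [edgeItem], by simp [edgeItem]⟩
    obtain ⟨v, hv, hxv⟩ := hs' x hx
    have hmemF : ∀ b c, b < K → c < K → s(b, c) ∈ F := fun b c hb hc =>
      Finset.mk_mem_sym2_iff.mpr ⟨Finset.mem_range.mpr hb, Finset.mem_range.mpr hc⟩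
    have hcoord : ∀ b c (hbc : s(b, c) ∈ F), b ∈ x.take 2 → c ∈ x.take 2 →
        (⟨s(b, c), hbc⟩ : F) ∈
          (A.reported (inst ω) (τ (inst ω)) v).toFinset.biUnion coords := by
      intro b c hbc hb hc
      refine Finset.mem_biUnion.mpr ⟨x, List.mem_toFinset.mpr hxv,
        Finset.mem_filter.mpr ⟨Finset.mem_univ _, fun d hd => ?_⟩⟩
      rcases Sym2.mem_iff.mp hd with rfl | rfl
      · exact hb
      · exact hc
    by_cases hvK : v < K
    · refine Finset.mem_union_right _ (Finset.mem_biUnion.mpr ⟨v, Finset.mem_range.mpr hvK,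
        Finset.mem_filter.mpr ⟨hp, ?_⟩⟩)
      have hnot : ∀ b c, b < K → c < K → b ∈ x.take 2 → c ∈ x.take 2 → b ≠ v → c ≠ v →
          s(b, c) ∈ ((A.reported (inst ω) (τ (inst ω)) v).toFinset.biUnion coords \ known v).map
            (Function.Embedding.subtype _) := by
        intro b c hb hc hbx hcx hbv hcv
        refine Finset.mem_map.mpr ⟨⟨s(b, c), hmemF b c hb hc⟩, Finset.mem_sdiff.mpr
          ⟨hcoord b c _ hbx hcx, fun hkn => ?_⟩, rfl⟩
        rcases Sym2.mem_iff.mp (Finset.mem_filter.mp hkn).2 with h1 | h1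
        · exact hbv h1.symm
        · exact hcv h1.symm
      simp only [φ]
      split_ifs with h1 h2
      · exact hnot w w (by omega) (by omega) hwx hwx (by omega) (by omega)
      · exact hnot u u (by omega) (by omega) hux hux h1 h1
      · exact hnot u w (by omega) (by omega) hux hwx h1 h2
    · refine Finset.mem_union_left _ (Finset.mem_filter.mpr ⟨hp, Finset.mem_map.mpr
        ⟨⟨s(u, w), hmemF u w (by omega) (by omega)⟩, ?_, rfl⟩⟩)
      refine Finset.mem_biUnion.mpr ⟨v, Finset.mem_sdiff.mpr ⟨hv, ?_⟩, hcoord u w _ hux hwx⟩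
      rwa [Finset.mem_range]
  have hsum := (Finset.card_nsmul_le_sum _ _ _ hpt).trans hmain
  rw [Finset.card_univ, Fintype.card_fun, Fintype.card_fin, smul_eq_mul] at hsum
  have h1 : h * h ≤ K * (2 * C n * 2 * t + 1) + 1 :=
    Nat.le_of_mul_le_mul_left hsum (pow_pos (by omega) _)
  have h2 : K ≤ 2 * h + 1 := by omega
  have h3 : 1 ≤ h := by omega
  have h4 : h * h ≤ h * (12 * (C n * t) + 4) := by
    have : K * (2 * C n * 2 * t + 1) ≤ (3 * h) * (2 * C n * 2 * t + 1) :=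
      Nat.mul_le_mul_right _ (by omega)
    nlinarith
  have h5 := Nat.le_of_mul_le_mul_left h4 h3
  have : 24 * C n * t = 24 * (C n * t) := by ring
  omega

/-! ### Impossibility of simulation with constant slowdown -/

theorem not_mpcLeNCC {κ : ℕ} (hκ : 2 ≤ κ) (a M S : ℕ → ℕ)
    (ha : ∀ᶠ n in Filter.atTop, 2 * a n ≤ n + 1)
    (hMS : ∀ᶠ n in Filter.atTop, n ≤ M n * S n ∧
      (M n : ℝ) * S n ≤ (a n : ℝ) * n / (1 * Real.log n)) :
    ¬ MPCLeNCC (boundedArboricity κ a) (fun _ => 1) M S (fun n => M n * S n / n) := by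
  intro hsim
  obtain ⟨N, hN⟩ := Filter.eventually_atTop.mp (ha.and hMS)
  -- The bound a keeps the arboricity small, and the square root keeps the at most k ^ 2 edges
  -- within the total memory.
  let k : ℕ → ℕ := fun n => min (a n) (Nat.sqrt (M n * S n))
  have hreal : ∀ n ≥ max N 3, 1 ≤ Real.log n ∧ a n ≤ n ∧ n ≤ M n * S n ∧
      ((M n * S n : ℕ) : ℝ) * Real.log n ≤ a n * n := by
    intro n hn
    obtain ⟨h1, h2, h3⟩ := hN n (by omega)
    have hlog := (size_le_log (n := n) (by omega)).2
    refine ⟨hlog, by omega, h2, ?_⟩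
    rwa [one_mul, le_div_iff₀ (by linarith), ← Nat.cast_mul] at h3
  have hle : ∀ n ≥ max N 3, M n * S n < wordBound κ n := by
    intro n hn
    obtain ⟨hlog, h1, h2, h3⟩ := hreal n hn
    have h4 : M n * S n ≤ n * n := by
      have h5 : ((M n * S n : ℕ) : ℝ) ≤ ((M n * S n : ℕ) : ℝ) * Real.log n :=
        le_mul_of_one_le_right (Nat.cast_nonneg _) hlog
      have h6 : (a n : ℝ) * n ≤ n * n := by
        have : (a n : ℝ) ≤ n := by exact_mod_cast h1
        gcongr
      exact_mod_cast h5.trans (h3.trans h6)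
    have h7 := Nat.lt_size_self n
    calc M n * S n ≤ n * n := h4
      _ < 2 ^ Nat.size n * 2 ^ Nat.size n := Nat.mul_lt_mul'' h7 h7
      _ = 2 ^ (2 * Nat.size n) := by rw [← pow_add]; congr 1; ring
      _ ≤ wordBound κ n := Nat.pow_le_pow_right (by norm_num) (Nat.mul_le_mul_right _ hκ)
  have hpos : ∀ n ≥ max N 3, 0 < M n ∧ 0 < S n := by
    intro n hn
    have h2 := (hreal n hn).2.2.1
    have : 0 < M n * S n := by omega
    exact ⟨Nat.pos_of_mul_pos_right this, Nat.pos_of_mul_pos_left this⟩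
  have hfam : cliqueEdges κ (max N 3) k ∈ boundedArboricity κ a := by
    rintro I ⟨n, hn, -, -, hkn, y, -, rfl⟩
    rw [cliqueInstance_n]
    refine (arboricity_cliqueInstance_le _ _ _ _).trans ?_
    exact_mod_cast min_le_left (a n) _
  obtain ⟨K, N', A, τ, hA, hτ⟩ := hsim _ hfam reportEdges (fun _ => 1) (reportEdges_solves
    (fun n hn => (Nat.le_mul_of_pos_right _ (hpos n hn).2).trans_lt (hle n hn))
    (fun n hn => (Nat.le_mul_of_pos_left _ (hpos n hn).1).trans_lt (hle n hn))
    (fun n hn => (hpos n hn).2)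
    (fun n hn => (Nat.mul_le_mul (min_le_right _ _) (min_le_right _ _)).trans (Nat.sqrt_le _)))
  -- A simulation with K rounds implies k ≤ 24 C K + 13, which k ≥ C D contradicts. As C log n ≤ a,
  -- any n with log n ≥ D ^ 2 gives C D ^ 2 ≤ a ≤ n, hence both C D ≤ a and (C D) ^ 2 ≤ C n ≤ MS.
  obtain ⟨D, hD⟩ : ∃ D, D = 24 * K + 14 := ⟨_, rfl⟩
  obtain ⟨n, hn, hlogD⟩ := ((Filter.eventually_ge_atTop (max (max N 3) N')).and
    ((Real.tendsto_log_atTop.comp tendsto_natCast_atTop_atTop).eventually_ge_atTop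
      ((D : ℝ) * D))).exists
  dsimp only [Function.comp_apply] at hlogD
  obtain ⟨hlog, h1, h2, h3⟩ := hreal n (by omega)
  have hC1 : 1 ≤ M n * S n / n := (Nat.one_le_div_iff (by omega)).mpr h2
  have hCn : M n * S n / n * n ≤ M n * S n := Nat.div_mul_le_self _ _
  obtain ⟨C, hC⟩ : ∃ C, C = M n * S n / n := ⟨_, rfl⟩
  rw [← hC] at hC1 hCn
  have h4 : C * (D * D) ≤ a n := by
    have h5 : ((C * n : ℕ) : ℝ) * (D * D) ≤ a n * n :=
      le_trans (mul_le_mul (by exact_mod_cast hCn) hlogD (by positivity) (by positivity)) h3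
    have h6 : C * n * (D * D) ≤ a n * n := by exact_mod_cast h5
    refine Nat.le_of_mul_le_mul_right (?_ : _ ≤ a n * n) (by omega : 0 < n)
    linarith
  have hkn : C * D ≤ k n := by
    refine le_min ?_ (Nat.le_sqrt.mpr ?_)
    · refine le_trans (Nat.mul_le_mul_left C ?_) h4
      exact Nat.le_mul_of_pos_right _ (by omega)
    · calc C * D * (C * D) = C * (C * (D * D)) := by ring
        _ ≤ C * n := Nat.mul_le_mul_left _ (h4.trans h1)
        _ ≤ M n * S n := hCn
  have hk2 : D ≤ k n := (Nat.le_mul_of_pos_left D hC1).trans hkn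
  have := clique_ncc_bound hκ hA (t := K) (fun I hI => by simpa using hτ I hI) (n := n) (by omega)
    (by omega) (by omega) ((min_le_left _ _).trans h1) (by omega) (by rw [← hC]; exact hC1)
  rw [← hC] at this
  have : C * D = 24 * C * K + 14 * C := by rw [hD]; ring
  omega

/-! ### The triangle listing program -/

namespace WExpr

def cell (k : ℕ) : WExpr := .load (.const k)

/-- Truncated subtraction expresses minimum, maximum and disequality without branching. -/
def min (x y : WExpr) : WExpr := .sub x (.sub x y)

def max (x y : WExpr) : WExpr := .add x (.sub y x)

def ne (x y : WExpr) : WExpr := .add (.sub x y) (.sub y x)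

def pow (x : WExpr) : ℕ → WExpr
  | 0 => .const 1
  | t + 1 => .mul (pow x t) x

variable (E : Env) (mem : ℕ → ℕ)

@[simp] theorem eval_cell (k : ℕ) : (cell k).eval E mem = mem k := rfl

@[simp] theorem eval_min (x y : WExpr) :
    (min x y).eval E mem = Min.min (x.eval E mem) (y.eval E mem) := by
  simp only [min, eval]
  omega

@[simp] theorem eval_max (x y : WExpr) :
    (max x y).eval E mem = Max.max (x.eval E mem) (y.eval E mem) := by
  simp only [max, eval]
  omega

theorem eval_ne (x y : WExpr) : (ne x y).eval E mem ≠ 0 ↔ x.eval E mem ≠ y.eval E mem := by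
  simp only [ne, eval]
  omega

@[simp] theorem eval_pow (x : WExpr) (t : ℕ) : (pow x t).eval E mem = x.eval E mem ^ t := by
  induction t with
  | zero => rfl
  | succ t ih => rw [pow_succ, ← ih]; rfl

theorem eval_lt (x y : WExpr) : (lt x y).eval E mem ≠ 0 ↔ x.eval E mem < y.eval E mem := by
  simp [eval]

end WExpr

/-- The code of the edge `p` among the last `a` vertices. -/
def edgeCode (a : ℕ) (p : ℕ × ℕ) : ℕ :=
  (min p.1 p.2 - (a ^ 3 - a + 1)) * a + (max p.1 p.2 - (a ^ 3 - a + 1))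

/-- The message sent for the input edge `p`. -/
def edgeMessage (a D : ℕ) (p : ℕ × ℕ) : List (ℕ × ℕ) :=
  if a ^ 3 - a < p.1 ∧ a ^ 3 - a < p.2 then [(edgeCode a p / D, edgeCode a p)] else []

/-- The code of the triple `{u, v, k}` for `u < v`. -/
def tripleCode (a u v k : ℕ) : ℕ :=
  (min k u * a + (u + v + k - (min k u + max k v))) * a + max k v

/-- The message sent to the machine in charge of the triple `y`, which consists of an edge code
and a vertex `k < q`. -/
def tripleMessage (a q D y : ℕ) : List (ℕ × ℕ) :=
  if y % q < a ∧ y % q ≠ y / q / a ∧ y % q ≠ y / q % a then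
    [(tripleCode a (y / q / a) (y / q % a) (y % q) / D,
      tripleCode a (y / q / a) (y / q % a) (y % q))]
  else []

/-- The triple of vertices with code `s`. -/
def tripleItem (a s : ℕ) : List ℕ :=
  [a ^ 3 - a + 1 + s / a / a, a ^ 3 - a + 1 + s / a % a, a ^ 3 - a + 1 + s % a]

section Programs

open WExpr

/-- Compute `a = n ^ (1 / 3)` and the least `b` with `a ≤ b ^ T`. -/
def setupProg (T : ℕ) : Prog :=
  .seq (.while (.lt (.pow (cell 1) 3) .numNodes) (.store (.const 1) (.add (cell 1) (.const 1))))
    (.while (.lt (.pow (cell 2) T) (cell 1)) (.store (.const 2) (.add (cell 2) (.const 1))))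

def firstVertex : WExpr := .sub .numNodes (cell 1)

def inputPair (j : ℕ) : WExpr := .input (.add (.mul (.const 2) (cell 3)) (.const j))

def edgeCodeExpr : WExpr :=
  .add (.mul (.sub (.min (inputPair 0) (inputPair 1)) (.add firstVertex (.const 1))) (cell 1))
    (.sub (.max (inputPair 0) (inputPair 1)) (.add firstVertex (.const 1)))

def sendEdges : Prog :=
  forLoop 3 (.div .inputLen (.const 2))
    (.ite (.mul (.lt firstVertex (inputPair 0)) (.lt firstVertex (inputPair 1)))
      (.send (.div edgeCodeExpr (.div .memSize (cell 2))) edgeCodeExpr) .skip)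

/-- Execute `body` for every received word and every `mem[4] < b`. -/
def spread (body : Prog) : Prog := forLoop 3 .inboxLen (forLoop 4 (cell 2) body)

def childExpr : WExpr := .add (.mul (.inboxWord (cell 3)) (cell 2)) (cell 4)

def forwardChild : Prog := .send (.div childExpr (.div .memSize (cell 2))) childExpr

/-- After T extensions a word is e * b ^ T + k. The quotient e is an edge code, and the remainder k
is a candidate third vertex, to be discarded unless it is below a and off the edge. -/
def thirdExpr (T : ℕ) : WExpr := .mod childExpr (.pow (cell 2) T)

def lowExpr (T : ℕ) : WExpr := .div (.div childExpr (.pow (cell 2) T)) (cell 1)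

def highExpr (T : ℕ) : WExpr := .mod (.div childExpr (.pow (cell 2) T)) (cell 1)

def tripleCodeExpr (T : ℕ) : WExpr :=
  .add (.mul (.add (.mul (.min (thirdExpr T) (lowExpr T)) (cell 1))
    (.sub (.add (.add (lowExpr T) (highExpr T)) (thirdExpr T))
      (.add (.min (thirdExpr T) (lowExpr T)) (.max (thirdExpr T) (highExpr T))))) (cell 1))
    (.max (thirdExpr T) (highExpr T))

def sendTriple (T : ℕ) : Prog :=
  .ite (.mul (.lt (thirdExpr T) (cell 1))
      (.mul (.ne (thirdExpr T) (lowExpr T)) (.ne (thirdExpr T) (highExpr T))))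
    (.send (.div (tripleCodeExpr T) (.div .memSize (.const 3))) (tripleCodeExpr T)) .skip

def counterExpr : WExpr := .add (.const 8) (.mod (.inboxWord (cell 3)) (.div .memSize (.const 3)))

def tripleExprs : List WExpr :=
  [.add (.add firstVertex (.const 1)) (.div (.div (.inboxWord (cell 3)) (cell 1)) (cell 1)),
   .add (.add firstVertex (.const 1)) (.mod (.div (.inboxWord (cell 3)) (cell 1)) (cell 1)),
   .add (.add firstVertex (.const 1)) (.mod (.inboxWord (cell 3)) (cell 1))]

/-- Report every triple for which three messages have been received. -/
def collectTriples : Prog :=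
  forLoop 3 .inboxLen
    (.seq (.store counterExpr (.add (.load counterExpr) (.const 1)))
      (.ite (.ne (.load counterExpr) (.const 3)) .skip (.emit tripleExprs)))

/-- Cell 0 counts rounds: setup and sending of edges in round 0, replication in rounds 1 to T - 1,
messages to triples in round T, collection in round T + 1. `halt` only sets a flag, so the final
store is still executed. -/
def trianglesProg (T : ℕ) : Prog :=
  .seq
    (.ite (cell 0)
      (.ite (.lt (cell 0) (.const T)) (spread forwardChild)
        (.ite (.lt (.const T) (cell 0)) (.seq collectTriples .halt) (spread (sendTriple T))))
      (.seq (setupProg T) sendEdges))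
    (.store (.const 0) (.add (cell 0) (.const 1)))

end Programs

/-- The state of a machine at the beginning of round `r ≥ 1`. -/
structure Ready (r a b : ℕ) (m : Machine) : Prop where
  phase : m.mem 0 = r
  mem_one : m.mem 1 = a
  mem_two : m.mem 2 = b
  counters : ∀ x, 8 ≤ x → m.mem x = 0
  out : m.out = []
  halted : m.halted = false

/-! ### Correctness of the components of the program -/

section Runs

variable {E : Env} {W B a b T : ℕ}

theorem setupProg_runs (hn : E.n = a ^ 3) (hbT : a ≤ b ^ T) (hmin : ∀ c < b, c ^ T < a)
    (hB : 2 < B) (haW : a < W) (hbW : b < W) (m : Machine) (h1 : m.mem 1 = 0) (h2 : m.mem 2 = 0) :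
    Runs E W B (setupProg T)
      (fun m' => m' = { m with mem := Function.update (Function.update m.mem 1 a) 2 b }) m := by
  refine Runs.seq ((Runs.while a (fun i m' => m' = { m with mem := Function.update m.mem 1 i })
    ?_ ?_ ?_).mono ?_)
  -- Only stored, sent and emitted values have to be words, so the powers computed in loop
  -- conditions need no bound.
  · rintro i hi _ rfl
    refine ⟨?_, Runs.store (by simp only [WExpr.eval]; omega) ?_ ?_⟩
    · rw [WExpr.eval_lt]
      simp only [WExpr.eval_pow, WExpr.eval_cell, Function.update_self, WExpr.eval, hn]
      exact Nat.pow_lt_pow_left hi (by norm_num)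
    · simp only [WExpr.eval, WExpr.eval_cell, Function.update_self]
      omega
    · simp [WExpr.eval]
  · rintro _ rfl
    simp [WExpr.eval, hn]
  · rw [← h1, Function.update_eq_self]
  · rintro _ rfl
    refine Runs.while b (fun i m' =>
      m' = { m with mem := Function.update (Function.update m.mem 1 a) 2 i }) ?_ ?_ ?_
    · rintro i hi _ rfl
      refine ⟨?_, Runs.store hB ?_ ?_⟩
      · rw [WExpr.eval_lt]
        simpa using hmin i hi
      · simp only [WExpr.eval, WExpr.eval_cell, Function.update_self]
        omega
      · simp [WExpr.eval]
    · rintro _ rfl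
      simpa [WExpr.eval] using hbT
    · congr 1
      rw [eq_comm, Function.update_eq_self_iff]
      simp [h2]

theorem edgeCodeExpr_eval {mem : ℕ → ℕ} {p : ℕ × ℕ} (hn : E.n = a ^ 3) (h1 : mem 1 = a)
    (hp : (inputPair 0).eval E mem = p.1) (hq : (inputPair 1).eval E mem = p.2) :
    edgeCodeExpr.eval E mem = edgeCode a p := by
  simp [edgeCodeExpr, edgeCode, WExpr.eval, firstVertex, hn, h1, hp, hq]

theorem sendEdges_runs {D : ℕ} (hn : E.n = a ^ 3) (hD : E.S / b = D) (L : List (ℕ × ℕ))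
    (hL : E.input = L.flatMap fun p => [p.1, p.2]) (hB : 3 < B) (hLW : L.length < W)
    (hbound : ∀ p ∈ L, a ^ 3 - a < p.1 → a ^ 3 - a < p.2 →
      edgeCode a p / D < E.M ∧ edgeCode a p < W)
    (m : Machine) (h1 : m.mem 1 = a) (h2 : m.mem 2 = b) (hout : m.outbox = []) :
    Runs E W B sendEdges (fun m' => (∀ c, c ≠ 3 → m'.mem c = m.mem c) ∧ m'.out = m.out ∧
      m'.halted = m.halted ∧ m'.outbox = L.flatMap (edgeMessage a D)) m := by
  refine (Runs.forLoop (N := L.length) (fun i m' => (∀ c, c ≠ 3 → m'.mem c = m.mem c) ∧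
    m'.out = m.out ∧ m'.halted = m.halted ∧ m'.outbox = (L.take i).flatMap (edgeMessage a D))
    hB hLW ?_ ?_ ?_ ⟨fun _ _ => rfl, rfl, rfl, by simpa using hout⟩).mono ?_
  · rintro i m' -
    simp only [WExpr.eval, hL]
    rw [length_flatMap_const _ 2 L fun _ _ => rfl]
    exact Nat.mul_div_cancel_left _ (by norm_num)
  · rintro i m' x ⟨h3, h4⟩
    exact ⟨fun c hc => (Function.update_of_ne hc _ _).trans (h3 c hc), h4⟩
  · rintro i hi m' ⟨h3, h4, h5, h6⟩ hc
    have hp : (inputPair 0).eval E m'.mem = L[i].1 := by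
      simp only [inputPair, WExpr.eval, WExpr.eval_cell, hc, hL]
      rw [getD_flatMap _ 2 0 L (fun _ _ => rfl) i 0 hi (by norm_num)]
      rfl
    have hq : (inputPair 1).eval E m'.mem = L[i].2 := by
      simp only [inputPair, WExpr.eval, WExpr.eval_cell, hc, hL]
      rw [getD_flatMap _ 2 0 L (fun _ _ => rfl) i 1 hi (by norm_num)]
      rfl
    have hm1 : m'.mem 1 = a := (h3 1 (by norm_num)).trans h1
    have hm2 : m'.mem 2 = b := (h3 2 (by norm_num)).trans h2
    have hcond : (WExpr.mul (.lt firstVertex (inputPair 0))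
        (.lt firstVertex (inputPair 1))).eval E m'.mem ≠ 0 ↔
          a ^ 3 - a < L[i].1 ∧ a ^ 3 - a < L[i].2 := by
      change _ * _ ≠ 0 ↔ _
      rw [mul_ne_zero_iff, WExpr.eval_lt, WExpr.eval_lt, hp, hq]
      simp [firstVertex, WExpr.eval, hn, hm1]
    have hcode := edgeCodeExpr_eval hn hm1 hp hq
    have hdest : (WExpr.div edgeCodeExpr (.div .memSize (.cell 2))).eval E m'.mem =
        edgeCode a L[i] / D := by
      simp only [WExpr.eval, WExpr.eval_cell, hcode, hm2, hD]
    have htake : (L.take (i + 1)).flatMap (edgeMessage a D) =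
        (L.take i).flatMap (edgeMessage a D) ++ edgeMessage a D L[i] := by
      rw [List.take_add_one, List.getElem?_eq_getElem hi, List.flatMap_append]
      simp
    refine Runs.ite (fun hne => ?_) (fun he => ?_)
    · have hin := hcond.mp hne
      obtain ⟨hb1, hb2⟩ := hbound _ (List.getElem_mem hi) hin.1 hin.2
      refine Runs.send (by rwa [hdest]) (by rwa [hcode]) ⟨⟨h3, h4, h5, ?_⟩, hc⟩
      dsimp only
      rw [htake, h6, hdest, hcode, edgeMessage, if_pos hin]
    · refine Runs.skip ⟨⟨h3, h4, h5, ?_⟩, hc⟩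
      rw [htake, h6, edgeMessage, if_neg fun h => hcond.mpr h he, List.append_nil]
  · rintro m' ⟨h3, h4, h5, h6⟩
    exact ⟨h3, h4, h5, by simpa using h6⟩

theorem getD_snd_eq (l : List (ℕ × ℕ)) {i : ℕ} (hi : i < l.length) :
    (l.getD i (0, 0)).2 = (l.map Prod.snd)[i]'(by simpa using hi) := by
  rw [List.getD_eq_getElem _ _ hi, List.getElem_map]

theorem spread_runs {h : ℕ → List (ℕ × ℕ)} {body : Prog} {words : List ℕ}
    (hwords : E.inbox.map Prod.snd = words) (hB : 4 < B) (hlen : words.length < W) (hbW : b < W)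
    (m : Machine) (h2 : m.mem 2 = b) (hout : m.outbox = [])
    (hbody : ∀ x ∈ words, ∀ r < b, ∀ m' : Machine, (∀ c, c ≠ 3 → c ≠ 4 → m'.mem c = m.mem c) →
      childExpr.eval E m'.mem = x * b + r →
      Runs E W B body (fun m'' => m'' = { m' with outbox := m'.outbox ++ h (x * b + r) }) m') :
    Runs E W B (spread body) (fun m' => (∀ c, c ≠ 3 → c ≠ 4 → m'.mem c = m.mem c) ∧
      m'.out = m.out ∧ m'.halted = m.halted ∧
      m'.outbox = words.flatMap fun x => (List.range b).flatMap fun r => h (x * b + r)) m := by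
  set H : ℕ → List (ℕ × ℕ) := fun x => (List.range b).flatMap fun r => h (x * b + r) with hH
  have hlen' : E.inbox.length = words.length := by rw [← hwords, List.length_map]
  refine (Runs.forLoop (N := words.length) (bound := .inboxLen) (fun i m' =>
    (∀ c, c ≠ 3 → c ≠ 4 → m'.mem c = m.mem c) ∧ m'.out = m.out ∧ m'.halted = m.halted ∧
      m'.outbox = (words.take i).flatMap H)
    (by omega) hlen (fun _ _ _ => hlen') ?_ ?_
    ⟨fun _ _ _ => rfl, rfl, rfl, by simpa using hout⟩).mono ?_
  · rintro i m' x ⟨h3, h4⟩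
    exact ⟨fun c hc hc' => (Function.update_of_ne hc _ _).trans (h3 c hc hc'), h4⟩
  · rintro i hi m' ⟨h3, h4, h5, h6⟩ hc
    have htake : (words.take (i + 1)).flatMap H = (words.take i).flatMap H ++ H words[i] := by
      rw [List.take_add_one, List.getElem?_eq_getElem hi, List.flatMap_append]
      simp
    refine (Runs.forLoop (N := b) (fun r m'' =>
      (∀ c, c ≠ 3 → c ≠ 4 → m''.mem c = m.mem c) ∧ m''.mem 3 = i ∧ m''.out = m.out ∧
        m''.halted = m.halted ∧ m''.outbox = (words.take i).flatMap H ++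
          (List.range r).flatMap fun r => h (words[i] * b + r)) hB hbW ?_ ?_ ?_
      ⟨h3, hc, h4, h5, by simpa using h6⟩).mono ?_
    · rintro r m'' ⟨h7, -⟩
      exact (h7 2 (by norm_num) (by norm_num)).trans h2
    · rintro r m'' x ⟨h7, h8, h9⟩
      exact ⟨fun c hc hc' => (Function.update_of_ne hc' _ _).trans (h7 c hc hc'),
        (Function.update_of_ne (show (3 : ℕ) ≠ 4 by norm_num) x m''.mem).trans h8, h9⟩
    · rintro r hr m'' ⟨h7, h8, h9, h10, h11⟩ hcr
      refine (hbody words[i] (List.getElem_mem hi) r hr m'' h7 ?_).mono ?_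
      · simp only [childExpr, WExpr.eval, WExpr.eval_cell, h8, hcr,
          (h7 2 (by norm_num) (by norm_num)).trans h2]
        rw [getD_snd_eq _ (by omega)]
        simp only [hwords]
      · rintro _ rfl
        refine ⟨⟨h7, h8, h9, h10, ?_⟩, hcr⟩
        dsimp only
        rw [h11, List.range_succ, List.flatMap_append, List.append_assoc]
        simp
    · rintro m'' ⟨h7, h8, h9, h10, h11⟩
      exact ⟨⟨h7, h9, h10, by rw [htake, h11]⟩, h8⟩
  · rintro m' ⟨h3, h4, h5, h6⟩
    exact ⟨h3, h4, h5, by simpa using h6⟩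

theorem forwardChild_runs {D : ℕ} (hD : E.S / b = D) {x : ℕ} (m : Machine) (h2 : m.mem 2 = b)
    (hx : childExpr.eval E m.mem = x) (hdest : x / D < E.M) (hxW : x < W) :
    Runs E W B forwardChild (fun m' => m' = { m with outbox := m.outbox ++ [(x / D, x)] }) m := by
  have hd : (WExpr.div childExpr (.div .memSize (.cell 2))).eval E m.mem = x / D := by
    simp only [WExpr.eval, WExpr.eval_cell, hx, h2, hD]
  exact Runs.send (by rwa [hd]) (by rwa [hx]) (by rw [hd, hx])

theorem sendTriple_runs {D : ℕ} (hD : E.S / 3 = D) {y : ℕ} (m : Machine) (h1 : m.mem 1 = a)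
    (h2 : m.mem 2 = b) (hy : childExpr.eval E m.mem = y)
    (hbound : ∀ p ∈ tripleMessage a (b ^ T) D y, p.1 < E.M ∧ p.2 < W) :
    Runs E W B (sendTriple T)
      (fun m' => m' = { m with outbox := m.outbox ++ tripleMessage a (b ^ T) D y }) m := by
  have hk : (thirdExpr T).eval E m.mem = y % b ^ T := by
    simp [thirdExpr, WExpr.eval, hy, h2]
  have hu : (lowExpr T).eval E m.mem = y / b ^ T / a := by
    simp [lowExpr, WExpr.eval, hy, h2, h1]
  have hv : (highExpr T).eval E m.mem = y / b ^ T % a := by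
    simp [highExpr, WExpr.eval, hy, h2, h1]
  have hcode : (tripleCodeExpr T).eval E m.mem =
      tripleCode a (y / b ^ T / a) (y / b ^ T % a) (y % b ^ T) := by
    simp [tripleCodeExpr, tripleCode, WExpr.eval, hk, hu, hv, h1]
  have hdest : (WExpr.div (tripleCodeExpr T) (.div .memSize (.const 3))).eval E m.mem =
      tripleCode a (y / b ^ T / a) (y / b ^ T % a) (y % b ^ T) / D := by
    simp only [WExpr.eval, hcode, hD]
  have hcond : (WExpr.mul (.lt (thirdExpr T) (.cell 1)) (.mul (.ne (thirdExpr T) (lowExpr T))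
      (.ne (thirdExpr T) (highExpr T)))).eval E m.mem ≠ 0 ↔
      (y % b ^ T < a ∧ y % b ^ T ≠ y / b ^ T / a ∧ y % b ^ T ≠ y / b ^ T % a) := by
    change _ * (_ * _) ≠ 0 ↔ _
    rw [mul_ne_zero_iff, mul_ne_zero_iff, WExpr.eval_lt, WExpr.eval_ne, WExpr.eval_ne, hk, hu, hv,
      WExpr.eval_cell, h1]
  unfold tripleMessage at hbound ⊢
  refine Runs.ite (fun hne => ?_) (fun he => ?_)
  · rw [if_pos (hcond.mp hne)] at hbound ⊢
    obtain ⟨hb1, hb2⟩ := hbound _ (List.mem_singleton_self _)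
    exact Runs.send (by rwa [hdest]) (by rwa [hcode]) (by rw [hdest, hcode])
  · rw [if_neg fun h => hcond.mpr h he]
    exact Runs.skip (by rw [List.append_nil])

theorem eq_of_div_eq_of_mod_eq {x y D : ℕ} (h1 : x / D = y / D) (h2 : x % D = y % D) : x = y := by
  rw [← Nat.div_add_mod x D, h1, h2, Nat.div_add_mod]

/-- All received codes lie in one block of length D, so their residues modulo D address distinct
counters. A triple is emitted at the moment its counter becomes 3, hence once even if further copies
arrive. -/
theorem collectTriples_runs {D j : ℕ} (hn : E.n = a ^ 3) (hD : E.S / 3 = D) {words : List ℕ}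
    (hwords : E.inbox.map Prod.snd = words) (hlen : words.length < W) (ha : 0 < a)
    (hB : 8 + D < B) (hW3 : a ^ 3 < W) (hD0 : 0 < D)
    (hblock : ∀ x ∈ words, x / D = j ∧ x < a ^ 3)
    (m : Machine) (h1 : m.mem 1 = a) (hcount : ∀ x, 8 ≤ x → m.mem x = 0) (hout : m.out = []) :
    Runs E W B collectTriples (fun m' => m'.mem 0 = m.mem 0 ∧ m'.outbox = m.outbox ∧
      ∃ l : List ℕ, m'.out = l.map (tripleItem a) ∧ l.Nodup ∧ l.length ≤ words.length ∧
        ∀ x, x ∈ l ↔ 3 ≤ words.count x) m := by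
  have hlen' : E.inbox.length = words.length := by rw [← hwords, List.length_map]
  refine (Runs.forLoop (N := words.length) (bound := .inboxLen) (fun i m' => (∀ c < 3, m'.mem c = m.mem c) ∧
    m'.outbox = m.outbox ∧ (∀ x, x / D = j → m'.mem (8 + x % D) = (words.take i).count x) ∧
      ∃ l : List ℕ, m'.out = l.map (tripleItem a) ∧ l.Nodup ∧ l.length ≤ i ∧
        ∀ x, x ∈ l ↔ 3 ≤ (words.take i).count x)
    (by omega) hlen (fun _ _ _ => hlen') ?_ ?_
    ⟨fun _ _ => rfl, rfl, fun x _ => by rw [hcount _ (by omega)]; rfl,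
      [], by rw [hout]; rfl, List.nodup_nil, le_rfl, by simp⟩).mono ?_
  · rintro i m' x ⟨h3, h4, h5, h6⟩
    exact ⟨fun c hc => (Function.update_of_ne (by omega) _ _).trans (h3 c hc), h4,
      fun x hx => (Function.update_of_ne (by omega) _ _).trans (h5 x hx), h6⟩
  · rintro i hi m' ⟨h3, h4, h5, l, h6, h7, h8, h9⟩ hc
    obtain ⟨x, hx⟩ : ∃ x, x = words[i] := ⟨_, rfl⟩
    obtain ⟨hxj, hxa⟩ := hblock x (hx ▸ List.getElem_mem hi)
    have hword : ∀ mem : ℕ → ℕ, mem 3 = i → (WExpr.inboxWord (.cell 3)).eval E mem = x := by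
      intro mem hmem
      simp only [WExpr.eval, WExpr.eval_cell, hmem]
      rw [getD_snd_eq _ (by omega), hx]
      simp only [hwords]
    have haddr : ∀ mem : ℕ → ℕ, mem 3 = i → counterExpr.eval E mem = 8 + x % D := by
      intro mem hmem
      have := hword mem hmem
      simp only [counterExpr, WExpr.eval] at this ⊢
      rw [this, hD]
    have hmod : x % D < D := Nat.mod_lt _ hD0
    have htake : ∀ z, (words.take (i + 1)).count z =
        (words.take i).count z + if x = z then 1 else 0 := by
      intro z
      rw [List.take_add_one, List.getElem?_eq_getElem hi, List.count_append, ← hx]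
      congr 1
      simp [List.count_singleton]
    have hval : (WExpr.add (.load counterExpr) (.const 1)).eval E m'.mem =
        (words.take (i + 1)).count x := by
      simp only [WExpr.eval]
      rw [haddr _ hc, h5 x hxj, htake, if_pos rfl]
    refine Runs.seq (Runs.store (by rw [haddr _ hc]; omega) ?_ ?_)
    · rw [hval]
      exact (List.count_le_length.trans ((List.take_sublist _ _).length_le)).trans_lt hlen
    rw [haddr _ hc, hval]
    set mem' := Function.update m'.mem (8 + x % D) ((words.take (i + 1)).count x) with hmem'
    have hother : ∀ c < 8, mem' c = m'.mem c := fun c hc => Function.update_of_ne (by omega) _ _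
    have hc' : mem' 3 = i := (hother 3 (by norm_num)).trans hc
    have hload : (WExpr.load counterExpr).eval E mem' = (words.take (i + 1)).count x := by
      change mem' (counterExpr.eval E mem') = _
      rw [haddr _ hc', hmem', Function.update_self]
    have hcounts : ∀ z, z / D = j → mem' (8 + z % D) = (words.take (i + 1)).count z := by
      intro z hz
      by_cases hzx : z = x
      · rw [hzx, hmem', Function.update_self]
      · rw [hmem', Function.update_of_ne, h5 z hz, htake, if_neg (Ne.symm hzx), add_zero]
        intro h
        exact hzx (eq_of_div_eq_of_mod_eq (hz.trans hxj.symm) (by omega))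
    have hlow : ∀ c < 3, mem' c = m.mem c := fun c hc =>
      (hother c (by omega)).trans (h3 c hc)
    refine Runs.ite (fun hne => ?_) (fun he => ?_)
    · rw [WExpr.eval_ne, hload] at hne
      refine Runs.skip ⟨⟨hlow, h4, hcounts, l, h6, h7, by omega, fun z => ?_⟩, hc'⟩
      rw [h9 z, htake z]
      by_cases hxz : x = z
      · subst hxz
        rw [htake, if_pos rfl] at hne
        rw [if_pos rfl]
        change _ ≠ 3 at hne
        omega
      · rw [if_neg hxz, add_zero]
    · have he' : (words.take (i + 1)).count x = 3 := by
        by_contra hcon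
        exact (WExpr.eval_ne E mem' _ _).mpr (by rw [hload]; exact hcon) he
      have hmap : (tripleExprs.map fun e => e.eval E mem') = tripleItem a x := by
        have h10 := hword mem' hc'
        have h11 : mem' 1 = a := (hlow 1 (by norm_num)).trans h1
        have h12 : firstVertex.eval E mem' = a ^ 3 - a := by
          simp [firstVertex, WExpr.eval, hn, h11]
        change [firstVertex.eval E mem' + 1 +
            (WExpr.inboxWord (.cell 3)).eval E mem' / mem' 1 / mem' 1,
          firstVertex.eval E mem' + 1 + (WExpr.inboxWord (.cell 3)).eval E mem' / mem' 1 % mem' 1,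
          firstVertex.eval E mem' + 1 + (WExpr.inboxWord (.cell 3)).eval E mem' % mem' 1] = _
        rw [h10, h11, h12]
        rfl
      have hale : a ≤ a ^ 3 := Nat.le_self_pow (by norm_num) a
      have hitem : ∀ z ∈ tripleItem a x, z < W := by
        have h13 : x / a / a < a := by
          rw [Nat.div_div_eq_div_mul, Nat.div_lt_iff_lt_mul (Nat.mul_pos ha ha)]
          calc x < a ^ 3 := hxa
            _ = a * (a * a) := by ring
        have h14 := Nat.mod_lt (x / a) ha
        have h15 := Nat.mod_lt x ha
        intro z hz
        simp only [tripleItem, List.mem_cons, List.not_mem_nil, or_false] at hz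
        omega
      have hxl : x ∉ l := by
        rw [h9 x]
        rw [htake, if_pos rfl] at he'
        omega
      refine Runs.emit ?_ ⟨⟨hlow, h4, hcounts, l ++ [x], ?_, ?_, ?_, fun z => ?_⟩, hc'⟩
      · intro e hmem
        refine hitem _ ?_
        rw [← hmap]
        exact List.mem_map_of_mem hmem
      · dsimp only
        rw [hmap, h6, List.map_append]
        rfl
      · exact List.nodup_append.mpr ⟨h7, List.nodup_singleton x, fun z hz w hw => by
          rintro rfl
          exact hxl (List.mem_singleton.mp hw ▸ hz)⟩
      · rw [List.length_append, List.length_singleton]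
        omega
      · rw [List.mem_append, List.mem_singleton, h9 z, htake z]
        by_cases hxz : x = z
        · subst hxz
          rw [htake, if_pos rfl] at he'
          simp [he']
        · rw [if_neg hxz, add_zero]
          exact or_iff_left (Ne.symm hxz)
  · rintro m' ⟨h3, h4, -, l, h5, h6, h7, h8⟩
    rw [List.take_length] at h8
    exact ⟨h3 0 (by norm_num), h4, l, h5, h6, h7, h8⟩

end Runs

/-- The relations between the parameters of the triangle listing program. -/
structure ListingParams (T a b M S W : ℕ) : Prop where
  two_le_a : 2 ≤ a
  one_le_T : 1 ≤ T
  T_le : T + 2 ≤ a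
  a_le : a ≤ b ^ T
  pow_lt : ∀ c < b, c ^ T < a
  b_le : b ≤ S
  three_le_S : 3 ≤ S
  edges_le : a ^ 2 * b ^ (T - 1) ≤ M * (S / b)
  triples_le : a ^ 3 ≤ M * (S / 3)
  words_le : a ^ 2 * b ^ T ≤ W
  nodes_lt : a ^ 3 < W
  S_lt : S < W
  M_lt : M < W

theorem ListingParams.a_le_nodes {T a b M S W : ℕ} (_ : ListingParams T a b M S W) : a ≤ a ^ 3 :=
  Nat.le_self_pow (by norm_num) a

namespace ListingParams

variable {T a b M S W : ℕ}

theorem b_pos (hp : ListingParams T a b M S W) : 0 < b := by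
  rcases Nat.eq_zero_or_pos b with rfl | h
  · have := hp.a_le
    rw [zero_pow (by have := hp.one_le_T; omega)] at this
    have := hp.two_le_a
    omega
  · exact h

theorem block_pos (hp : ListingParams T a b M S W) : 0 < S / b := Nat.div_pos hp.b_le hp.b_pos

theorem third_pos (hp : ListingParams T a b M S W) : 0 < S / 3 := Nat.div_pos hp.three_le_S (by norm_num)

end ListingParams

theorem update_eq_of_ne {f : ℕ → ℕ} {i c v w : ℕ} (h : c ≠ i) (hw : f c = w) :
    Function.update f i v c = w :=
  (Function.update_of_ne h v f).trans hw

/-! ### One round of the program on one machine -/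

section Phases

variable {E : Env} {T a b M S W : ℕ}

theorem trianglesProg_start (hp : ListingParams T a b M S W) (hn : E.n = a ^ 3) (hM : E.M = M)
    (hS : E.S = S) (L : List (ℕ × ℕ)) (hL : E.input = L.flatMap fun p => [p.1, p.2])
    (hLS : L.length ≤ S)
    (hbound : ∀ p ∈ L, a ^ 3 - a < p.1 → a ^ 3 - a < p.2 →
      edgeCode a p / (S / b) < M ∧ edgeCode a p < W) :
    Runs E W (9 * S) (trianglesProg T)
      (fun m => Ready 1 a b m ∧ m.outbox = L.flatMap (edgeMessage a (S / b)))
      ⟨fun _ => 0, [], [], false⟩ := by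
  have h1 := hp.three_le_S
  have h2 := hp.S_lt
  have h3 := hp.b_le
  have h4 := hp.nodes_lt
  have h5 := hp.a_le_nodes
  refine Runs.seq (Runs.ite (fun h => absurd rfl h) fun _ => Runs.seq ?_)
  refine (setupProg_runs hn hp.a_le hp.pow_lt (by omega) (by omega) (by omega) _ rfl rfl).mono ?_
  rintro _ rfl
  refine (sendEdges_runs (a := a) (b := b) hn (by rw [hS]) L hL (by omega) (by omega)
    (by rwa [hM]) _ (by simp) (by simp) rfl).mono ?_
  rintro m ⟨h6, h7, h8, h9⟩
  have h0 : m.mem 0 = 0 := (h6 0 (by norm_num)).trans (by simp)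
  refine Runs.store (by simp only [WExpr.eval]; omega)
    (by simp only [WExpr.eval, WExpr.eval_cell, h0]; omega)
    ⟨⟨by simp [WExpr.eval, h0], ?_, ?_, ?_, h7, h8⟩, h9⟩
  · dsimp only
    refine update_eq_of_ne (show (1 : ℕ) ≠ 0 by norm_num) ?_
    exact (h6 1 (by norm_num)).trans (by simp)
  · dsimp only
    refine update_eq_of_ne (show (2 : ℕ) ≠ 0 by norm_num) ?_
    exact (h6 2 (by norm_num)).trans (by simp)
  · intro x hx
    dsimp only
    refine update_eq_of_ne (show x ≠ 0 by omega) ?_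
    refine (h6 x (by omega)).trans ?_
    dsimp only
    rw [Function.update_of_ne (by omega), Function.update_of_ne (by omega)]

theorem Ready.next {r : ℕ} {m m' : Machine} (h : Ready r a b m)
    (hmem : ∀ c, c ≠ 3 → c ≠ 4 → m'.mem c = m.mem c) (hout : m'.out = m.out)
    (hhalted : m'.halted = m.halted) {B : ℕ} (hB : 0 < B) (hr : r + 1 < W)
    {o : List (ℕ × ℕ)} (ho : m'.outbox = o) :
    Runs E W B (.store (.const 0) (.add (.cell 0) (.const 1)))
      (fun m'' => Ready (r + 1) a b m'' ∧ m''.outbox = o) m' := by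
  have h0 : m'.mem 0 = r := (hmem 0 (by norm_num) (by norm_num)).trans h.phase
  refine Runs.store hB (by simpa [WExpr.eval, h0] using hr)
    ⟨⟨by simp [WExpr.eval, h0], ?_, ?_, ?_, hout.trans h.out, hhalted.trans h.halted⟩, ho⟩
  · dsimp only
    refine update_eq_of_ne (show (1 : ℕ) ≠ 0 by norm_num) ?_
    exact (hmem 1 (by norm_num) (by norm_num)).trans h.mem_one
  · dsimp only
    refine update_eq_of_ne (show (2 : ℕ) ≠ 0 by norm_num) ?_
    exact (hmem 2 (by norm_num) (by norm_num)).trans h.mem_two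
  · intro x hx
    dsimp only
    refine update_eq_of_ne (show x ≠ 0 by omega) ?_
    exact (hmem x (by omega) (by omega)).trans (h.counters x hx)

theorem trianglesProg_forward (hp : ListingParams T a b M S W) (hM : E.M = M) (hS : E.S = S)
    {r : ℕ} (hr : 1 ≤ r) (hrT : r < T) {words : List ℕ} (hwords : E.inbox.map Prod.snd = words)
    (hlen : words.length ≤ S)
    (hbound : ∀ x ∈ words, ∀ i < b, (x * b + i) / (S / b) < M ∧ x * b + i < W)
    {m : Machine} (hm : Ready r a b m) (hout : m.outbox = []) :
    Runs E W (9 * S) (trianglesProg T)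
      (fun m' => Ready (r + 1) a b m' ∧ m'.outbox = words.flatMap fun x =>
        (List.range b).flatMap fun i => [((x * b + i) / (S / b), x * b + i)]) m := by
  have h1 := hp.three_le_S
  have h2 := hp.S_lt
  have h3 := hp.b_le
  have h4 := hp.nodes_lt
  have h5 := hp.a_le_nodes
  have h6 := hp.T_le
  refine Runs.seq (Runs.ite (fun _ => Runs.ite (fun _ => ?_) fun h => ?_) fun h => ?_)
  · refine (spread_runs (h := fun y => [(y / (S / b), y)]) hwords (by omega) (by omega) (by omega)
      m hm.mem_two hout ?_).mono ?_
    · intro x hx i hi m' hmem hc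
      obtain ⟨hb1, hb2⟩ := hbound x hx i hi
      exact forwardChild_runs (b := b) (by rw [hS]) m'
        ((hmem 2 (by norm_num) (by norm_num)).trans hm.mem_two) hc (by rwa [hM]) hb2
    · rintro m' ⟨h7, h8, h9, h10⟩
      exact hm.next h7 h8 h9 (by omega) (by omega) h10
  · exact absurd h ((WExpr.eval_lt _ _ _ _).mpr (by simpa [WExpr.eval, hm.phase] using hrT))
  · rw [WExpr.eval_cell, hm.phase] at h
    omega

theorem trianglesProg_triples (hp : ListingParams T a b M S W) (hM : E.M = M) (hS : E.S = S)
    {words : List ℕ} (hwords : E.inbox.map Prod.snd = words) (hlen : words.length ≤ S)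
    (hbound : ∀ x ∈ words, ∀ i < b, ∀ p ∈ tripleMessage a (b ^ T) (S / 3) (x * b + i),
      p.1 < M ∧ p.2 < W)
    {m : Machine} (hm : Ready T a b m) (hout : m.outbox = []) :
    Runs E W (9 * S) (trianglesProg T)
      (fun m' => Ready (T + 1) a b m' ∧ m'.outbox = words.flatMap fun x =>
        (List.range b).flatMap fun i => tripleMessage a (b ^ T) (S / 3) (x * b + i)) m := by
  have h1 := hp.three_le_S
  have h2 := hp.S_lt
  have h3 := hp.b_le
  have h4 := hp.nodes_lt
  have h5 := hp.a_le_nodes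
  have h6 := hp.T_le
  have h7 := hp.one_le_T
  refine Runs.seq (Runs.ite (fun _ => Runs.ite (fun h => ?_)
    fun _ => Runs.ite (fun h => ?_) fun _ => ?_) fun h => ?_)
  · exact absurd ((WExpr.eval_lt _ _ _ _).mp h) (by simp [WExpr.eval, hm.phase])
  · exact absurd ((WExpr.eval_lt _ _ _ _).mp h) (by simp [WExpr.eval, hm.phase])
  · refine (spread_runs (h := tripleMessage a (b ^ T) (S / 3)) hwords (by omega) (by omega)
      (by omega) m hm.mem_two hout ?_).mono ?_
    · intro x hx i hi m' hmem hc
      exact sendTriple_runs (by rw [hS]) m' ((hmem 1 (by norm_num) (by norm_num)).trans hm.mem_one)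
        ((hmem 2 (by norm_num) (by norm_num)).trans hm.mem_two) hc (by
          rw [hM]
          exact hbound x hx i hi)
    · rintro m' ⟨h7, h8, h9, h10⟩
      exact hm.next h7 h8 h9 (by omega) (by omega) h10
  · rw [WExpr.eval_cell, hm.phase] at h
    omega

theorem trianglesProg_collect (hp : ListingParams T a b M S W) (hn : E.n = a ^ 3) (hS : E.S = S)
    {j : ℕ} {words : List ℕ} (hwords : E.inbox.map Prod.snd = words) (hlen : words.length ≤ S)
    (hblock : ∀ x ∈ words, x / (S / 3) = j ∧ x < a ^ 3)
    {m : Machine} (hm : Ready (T + 1) a b m) (hout : m.outbox = []) :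
    Runs E W (9 * S) (trianglesProg T) (fun m' => m'.halted = true ∧ m'.outbox = [] ∧
      ∃ l : List ℕ, m'.out = l.map (tripleItem a) ∧ l.Nodup ∧ l.length ≤ S ∧
        ∀ x, x ∈ l ↔ 3 ≤ words.count x) m := by
  have h1 := hp.three_le_S
  have h2 := hp.S_lt
  have h4 := hp.nodes_lt
  have h5 := hp.a_le_nodes
  have h6 := hp.T_le
  refine Runs.seq (Runs.ite (fun _ => Runs.ite (fun h => ?_)
    fun _ => Runs.ite (fun _ => Runs.seq ?_) fun h => ?_) fun h => ?_)
  · have := (WExpr.eval_lt _ _ _ _).mp h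
    simp [WExpr.eval, hm.phase] at this
  · refine (collectTriples_runs hn (by rw [hS]) hwords (by omega) (by omega) (by omega) h4
      hp.third_pos hblock m hm.mem_one hm.counters hm.out).mono ?_
    rintro m' ⟨h7, h8, l, h9, h10, h11, h12⟩
    have h0 : m'.mem 0 = T + 1 := h7.trans hm.phase
    refine Runs.halt (Runs.store (by simp only [WExpr.eval]; omega)
      (by simp only [WExpr.eval, WExpr.eval_cell, h0]; omega)
      ⟨rfl, h8.trans hout, l, h9, h10, by omega, h12⟩)
  · exact absurd h ((WExpr.eval_lt _ _ _ _).mpr (by simp [WExpr.eval, hm.phase]))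
  · rw [WExpr.eval_cell, hm.phase] at h
    omega

end Phases

/-! ### Counting messages -/

/-- The words received by machine `j`. -/
def inboxWords (M : ℕ) (o : ℕ → List (ℕ × ℕ)) (j : ℕ) : List ℕ :=
  (deliver (List.range M) o j).map Prod.snd

/-- The order of arrival depends on the adversarial distribution of the edges, but the
multiplicities do not. The later invariants are therefore stated through `count`. -/
theorem count_inboxWords (M : ℕ) (o : ℕ → List (ℕ × ℕ)) (j y : ℕ) :
    (inboxWords M o j).count y = ∑ i ∈ Finset.range M, (o i).count (j, y) := by
  have h1 : ∀ (i : ℕ) (l : List (ℕ × ℕ)),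
      (((l.filter fun m => m.1 = j).map fun m => (i, m.2)).map Prod.snd).count y =
        l.count (j, y) := by
    intro i l
    induction l with
    | nil => rfl
    | cons p l ih =>
      obtain ⟨d, w⟩ := p
      by_cases hd : d = j
      · rw [List.filter_cons_of_pos (by simpa using hd), List.map_cons, List.map_cons,
          List.count_cons, List.count_cons, ih]
        simp [hd]
      · rw [List.filter_cons_of_neg (by simpa using hd), ih, List.count_cons_of_ne]
        simp [hd]
  induction M with
  | zero => rfl
  | succ M ih =>
    rw [Finset.sum_range_succ, ← ih, inboxWords, inboxWords, deliver, deliver, List.range_succ,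
      List.flatMap_append, List.map_append, List.count_append]
    congr 1
    rw [List.flatMap_singleton, h1]

theorem sum_map_eq_sum_range_count {N : ℕ} {L : List ℕ} (hL : ∀ x ∈ L, x < N) (φ : ℕ → ℕ) :
    (L.map φ).sum = ∑ x ∈ Finset.range N, L.count x * φ x := by
  rw [Finset.sum_list_map_count]
  refine Finset.sum_subset (fun x hx => Finset.mem_range.mpr (hL x (List.mem_toFinset.mp hx)))
    fun x _ hx => ?_
  rw [List.count_eq_zero_of_not_mem (fun h => hx (List.mem_toFinset.mpr h)), zero_smul]

/-- This yields the receiving capacities: a block holds D codes, each arriving at most c times, with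
c = 1 during replication and c = 3 for triples. -/
theorem length_le_of_count_le {L : List ℕ} {c D j : ℕ} (hD : 0 < D) (hL : ∀ x ∈ L, x / D = j)
    (hc : ∀ x, L.count x ≤ c) : L.length ≤ c * D := by
  have hsub : ∀ x ∈ L, x < (j + 1) * D := fun x hx => by
    rw [← hL x hx, Nat.add_one_mul]
    exact Nat.lt_div_mul_add hD
  have h1 := sum_map_eq_sum_range_count hsub fun _ => 1
  rw [List.map_const', List.sum_replicate, smul_eq_mul, mul_one] at h1
  rw [h1]
  calc ∑ x ∈ Finset.range ((j + 1) * D), L.count x * 1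
      = ∑ x ∈ Finset.Ico (j * D) ((j + 1) * D), L.count x * 1 := by
        symm
        refine Finset.sum_subset (fun x hx => Finset.mem_range.mpr (Finset.mem_Ico.mp hx).2)
          fun x hx hx' => ?_
        rw [List.count_eq_zero_of_not_mem, zero_mul]
        intro h
        refine hx' (Finset.mem_Ico.mpr ⟨?_, Finset.mem_range.mp hx⟩)
        rw [← hL x h]
        exact Nat.div_mul_le_self x D
    _ ≤ (Finset.Ico (j * D) ((j + 1) * D)).card • c :=
        Finset.sum_le_card_nsmul _ _ _ fun x _ => by rw [mul_one]; exact hc x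
    _ = c * D := by
        rw [Nat.card_Ico, Nat.add_one_mul, Nat.add_sub_cancel_left, smul_eq_mul, mul_comm]

open Classical in
/-- If every machine processes its words by `h`, the words with property `P` being distributed over
the machines in blocks of length `D`, then this is what machine `j` receives. -/
theorem count_inboxWords_flatMap {M N D : ℕ} {P : ℕ → Prop} {o o' : ℕ → List (ℕ × ℕ)}
    {h : ℕ → List (ℕ × ℕ)} (hP : ∀ y, P y → y < N) (hdest : ∀ y, P y → y / D < M)
    (ho : ∀ j < M, ∀ y, (inboxWords M o j).count y = if P y ∧ y / D = j then 1 else 0)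
    (ho' : ∀ i < M, o' i = (inboxWords M o i).flatMap h) (j y : ℕ) :
    (inboxWords M o' j).count y =
      ∑ x ∈ Finset.range N, if P x then (h x).count (j, y) else 0 := by
  have h1 : ∀ i ∈ Finset.range M, (o' i).count (j, y) =
      ∑ x ∈ Finset.range N, (if P x ∧ x / D = i then 1 else 0) * (h x).count (j, y) := by
    intro i hi
    have hi := Finset.mem_range.mp hi
    have hmem : ∀ x ∈ inboxWords M o i, x < N := by
      intro x hx
      have := List.count_pos_iff.mpr hx
      rw [ho i hi x] at this
      by_contra hcon
      rw [if_neg fun h => hcon (hP x h.1)] at this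
      exact lt_irrefl _ this
    rw [ho' i hi, List.count_flatMap]
    exact (sum_map_eq_sum_range_count hmem _).trans
      (Finset.sum_congr rfl fun x _ => by rw [ho i hi x]; rfl)
  rw [count_inboxWords, Finset.sum_congr rfl h1, Finset.sum_comm]
  refine Finset.sum_congr rfl fun x _ => ?_
  rw [← Finset.sum_mul]
  by_cases hx : P x
  · simp [hx, hdest x hx]
  · simp [hx]

theorem sum_range_mul_eq {β : Type*} [AddCommMonoid β] (N b : ℕ) (f : ℕ → β) :
    ∑ x ∈ Finset.range N, ∑ i ∈ Finset.range b, f (x * b + i) =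
      ∑ y ∈ Finset.range (N * b), f y := by
  induction N with
  | zero => simp
  | succ N ih => rw [Finset.sum_range_succ, ih, Nat.succ_mul, Finset.sum_range_add]

theorem count_flatMap_range (b : ℕ) (g : ℕ → List (ℕ × ℕ)) (p : ℕ × ℕ) :
    ((List.range b).flatMap g).count p = ∑ i ∈ Finset.range b, (g i).count p := by
  induction b with
  | zero => rfl
  | succ b ih =>
    rw [Finset.sum_range_succ, ← ih, List.range_succ, List.flatMap_append, List.count_append,
      List.flatMap_singleton]

open Classical in
theorem count_inboxWords_spread {M N b D : ℕ} (hb : 0 < b) {P : ℕ → Prop}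
    {o o' : ℕ → List (ℕ × ℕ)} {g : ℕ → List (ℕ × ℕ)} (hP : ∀ y, P y → y < N)
    (hdest : ∀ y, P y → y / D < M)
    (ho : ∀ j < M, ∀ y, (inboxWords M o j).count y = if P y ∧ y / D = j then 1 else 0)
    (ho' : ∀ i < M, o' i = (inboxWords M o i).flatMap fun x =>
      (List.range b).flatMap fun i => g (x * b + i)) (j y : ℕ) :
    (inboxWords M o' j).count y =
      ∑ z ∈ Finset.range (N * b), if P (z / b) then (g z).count (j, y) else 0 := by
  rw [count_inboxWords_flatMap hP hdest ho ho', ← sum_range_mul_eq]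
  refine Finset.sum_congr rfl fun x _ => ?_
  rw [count_flatMap_range]
  have hdiv : ∀ i ∈ Finset.range b, (x * b + i) / b = x := fun i hi => by
    rw [mul_comm, Nat.mul_add_div hb, Nat.div_eq_of_lt (Finset.mem_range.mp hi), add_zero]
  by_cases hx : P x
  · rw [if_pos hx]
    exact Finset.sum_congr rfl fun i hi => by rw [hdiv i hi, if_pos hx]
  · rw [if_neg hx]
    exact (Finset.sum_eq_zero fun i hi => by rw [hdiv i hi, if_neg hx]).symm

/-- Adjacency of the last `a` vertices, numbered from `0`. -/
def coreAdj (a : ℕ) (B : Finset (ℕ × ℕ)) (u v : ℕ) : Prop :=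
  (lollipopGraph a B).Adj (a ^ 3 - a + 1 + u) (a ^ 3 - a + 1 + v)

def IsEdgeCode (a : ℕ) (B : Finset (ℕ × ℕ)) (e : ℕ) : Prop :=
  e / a < e % a ∧ coreAdj a B (e / a) (e % a)

def IsTriangleCode (a : ℕ) (B : Finset (ℕ × ℕ)) (s : ℕ) : Prop :=
  s / a / a < s / a % a ∧ s / a % a < s % a ∧ coreAdj a B (s / a / a) (s / a % a) ∧
    coreAdj a B (s / a % a) (s % a) ∧ coreAdj a B (s / a / a) (s % a)

/-! ### Codes of edges and triples, and the multiplicities of the messages -/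

theorem mul_add_div_mod {x q k : ℕ} (hk : k < q) : (x * q + k) / q = x ∧ (x * q + k) % q = k := by
  constructor
  · rw [mul_comm, Nat.mul_add_div (by omega), Nat.div_eq_of_lt hk, add_zero]
  · rw [add_comm, Nat.add_mul_mod_self_right, Nat.mod_eq_of_lt hk]

theorem IsEdgeCode.lt {a : ℕ} {B : Finset (ℕ × ℕ)} {e : ℕ} (ha : 0 < a) (h : IsEdgeCode a B e) :
    e < a ^ 2 := by
  have h1 := Nat.mod_lt e ha
  have h2 : e / a < a := h.1.trans h1
  rw [sq]
  exact (Nat.div_lt_iff_lt_mul ha).mp h2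

theorem IsTriangleCode.lt {a : ℕ} {B : Finset (ℕ × ℕ)} {s : ℕ} (ha : 0 < a)
    (h : IsTriangleCode a B s) : s < a ^ 3 := by
  have h1 : s / a / a < a := h.1.trans (Nat.mod_lt _ ha)
  rw [Nat.div_lt_iff_lt_mul ha, Nat.div_lt_iff_lt_mul ha] at h1
  exact h1.trans_eq (by ring)

theorem lollipopGraph_adj_le {a : ℕ} {B : Finset (ℕ × ℕ)} {u v : ℕ}
    (h : (lollipopGraph a B).Adj u v) : u ≠ v ∧ u ≤ a ^ 3 ∧ v ≤ a ^ 3 := by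
  have h1 := Finset.mem_Icc.mp (lollipopGraph_mem a B u v h)
  have h2 := Finset.mem_Icc.mp (lollipopGraph_mem a B v u h.symm)
  exact ⟨h.ne, h1.2, h2.2⟩

theorem edgeCode_eq_iff {a y u v : ℕ} (hne : u ≠ v) (hu : u ≤ a ^ 3) (hv : v ≤ a ^ 3) :
    (a ^ 3 - a < u ∧ a ^ 3 - a < v) ∧ edgeCode a (u, v) = y ↔
      y / a < y % a ∧ s(u, v) = s(a ^ 3 - a + 1 + y / a, a ^ 3 - a + 1 + y % a) := by
  have hle : a ≤ a ^ 3 := Nat.le_self_pow (by norm_num) a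
  rw [Sym2.eq_iff]
  constructor
  · rintro ⟨⟨h1, h2⟩, rfl⟩
    unfold edgeCode
    obtain ⟨h3, h4⟩ := mul_add_div_mod (x := min u v - (a ^ 3 - a + 1))
      (q := a) (k := max u v - (a ^ 3 - a + 1)) (by omega)
    dsimp only
    rw [h3, h4]
    omega
  · rintro ⟨h1, h2⟩
    have ha : a ≠ 0 := by
      rintro rfl
      simp only [ne_eq, OfNat.ofNat_ne_zero, not_false_eq_true, zero_pow] at hu hv
      omega
    have hX : y / a * a + y % a = y := Nat.div_add_mod' y a
    have hY : y % a < a := Nat.mod_lt _ (Nat.pos_of_ne_zero ha)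
    unfold edgeCode
    generalize y / a = X at *
    generalize y % a = Y at *
    dsimp only
    rw [show min u v - (a ^ 3 - a + 1) = X by omega, show max u v - (a ^ 3 - a + 1) = Y by omega]
    exact ⟨by omega, hX⟩

theorem edgeCode_lt {a : ℕ} {p : ℕ × ℕ} (h1 : p.1 ≤ a ^ 3) (h2 : p.2 ≤ a ^ 3)
    (h3 : a ^ 3 - a < p.1) (h4 : a ^ 3 - a < p.2) : edgeCode a p < a ^ 2 := by
  unfold edgeCode
  have h5 : min p.1 p.2 - (a ^ 3 - a + 1) + 1 ≤ a := by omega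
  have h6 : max p.1 p.2 - (a ^ 3 - a + 1) < a := by omega
  have := Nat.mul_le_mul_right a h5
  rw [sq]
  linarith [Nat.add_one_mul (min p.1 p.2 - (a ^ 3 - a + 1)) a]

theorem sum_map_ite_eq_count {β γ : Type*} [DecidableEq γ] (f : β → γ) (c : γ) (l : List β) :
    (l.map fun p => if f p = c then 1 else 0).sum = (l.map f).count c := by
  induction l with
  | nil => rfl
  | cons p l ih =>
    rw [List.map_cons, List.map_cons, List.sum_cons, ih, List.count_cons, add_comm]
    simp

open Classical in
-- Each edge is held by exactly one machine, in one orientation, and its code ignores the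
-- orientation. Hence each code is sent exactly once.
theorem count_inboxWords_edges {a : ℕ} {B : Finset (ℕ × ℕ)} {M S D : ℕ} {inp : ℕ → List (ℕ × ℕ)}
    (hinp : IsMPCInput (lollipop a B) M S inp) {o : ℕ → List (ℕ × ℕ)}
    (ho : ∀ i < M, o i = (inp i).flatMap (edgeMessage a D)) (j y : ℕ) :
    (inboxWords M o j).count y = if IsEdgeCode a B y ∧ y / D = j then 1 else 0 := by
  obtain ⟨-, hnodup, hmem⟩ := hinp
  set L := (List.range M).flatMap inp with hL
  have h1 : ∑ i ∈ Finset.range M, (o i).count (j, y) = (L.flatMap (edgeMessage a D)).count (j, y) := by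
    rw [hL, List.flatMap_assoc, count_flatMap_range]
    exact Finset.sum_congr rfl fun i hi => by rw [ho i (Finset.mem_range.mp hi)]
  set e := s(a ^ 3 - a + 1 + y / a, a ^ 3 - a + 1 + y % a) with he
  have h2 : ∀ p ∈ L, (edgeMessage a D p).count (j, y) =
      if (y / a < y % a ∧ y / D = j) ∧ s(p.1, p.2) = e then 1 else 0 := by
    intro p hp
    obtain ⟨h3, h4, h5⟩ := lollipopGraph_adj_le
      (show (lollipopGraph a B).Adj p.1 p.2 from (hmem _).mp (List.mem_map.mpr ⟨p, hp, rfl⟩))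
    have h6 := edgeCode_eq_iff (y := y) h3 h4 h5
    rw [Prod.mk.eta] at h6
    have h7 : (y / a < y % a ∧ y / D = j) ∧ s(p.1, p.2) = e ↔
        ((a ^ 3 - a < p.1 ∧ a ^ 3 - a < p.2) ∧ edgeCode a p = y) ∧ y / D = j := by
      rw [h6, he]
      tauto
    rw [if_congr h7 rfl rfl]
    unfold edgeMessage
    by_cases hc : a ^ 3 - a < p.1 ∧ a ^ 3 - a < p.2
    · rw [if_pos hc, List.count_singleton]
      refine if_congr ?_ rfl rfl
      rw [beq_iff_eq, Prod.mk.injEq]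
      constructor
      · rintro ⟨rfl, rfl⟩
        exact ⟨⟨hc, rfl⟩, rfl⟩
      · rintro ⟨⟨-, rfl⟩, rfl⟩
        exact ⟨rfl, rfl⟩
    · rw [if_neg hc, if_neg fun h => hc h.1.1]
      rfl
  rw [count_inboxWords, h1, List.count_flatMap]
  have h3 : (L.map (List.count (j, y) ∘ edgeMessage a D)) =
      L.map fun p => if (y / a < y % a ∧ y / D = j) ∧ s(p.1, p.2) = e then 1 else 0 :=
    List.map_congr_left h2
  rw [h3]
  by_cases hy : y / a < y % a ∧ y / D = j
  · simp only [hy.1, hy.2, true_and, and_true]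
    rw [sum_map_ite_eq_count fun p : ℕ × ℕ => s(p.1, p.2)]
    have h4 : e ∈ L.map (fun p => s(p.1, p.2)) ↔ IsEdgeCode a B y :=
      (hmem e).trans ⟨fun h => ⟨hy.1, h⟩, fun h => h.2⟩
    by_cases h5 : IsEdgeCode a B y
    · rw [if_pos h5, List.count_eq_one_of_mem hnodup (h4.mpr h5)]
    · rw [if_neg h5, List.count_eq_zero_of_not_mem fun h => h5 (h4.mp h)]
  · simp only [hy, false_and, if_false]
    rw [if_neg fun h => hy ⟨h.1.1, h.2⟩]
    simp

theorem IsEdgeCode.lt_of_div {a b r y : ℕ} {B : Finset (ℕ × ℕ)} (ha : 0 < a) (hb : 0 < b)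
    (h : IsEdgeCode a B (y / b ^ r)) : y < a ^ 2 * b ^ r :=
  (Nat.div_lt_iff_lt_mul (pow_pos hb r)).mp (h.lt ha)

theorem ListingParams.dest_lt {T a b M S W r y : ℕ} {B : Finset (ℕ × ℕ)}
    (hp : ListingParams T a b M S W) (hr : r < T) (h : IsEdgeCode a B (y / b ^ r)) :
    y / (S / b) < M := by
  have h1 := hp.two_le_a
  rw [Nat.div_lt_iff_lt_mul hp.block_pos]
  calc y < a ^ 2 * b ^ r := h.lt_of_div (by omega) hp.b_pos
    _ ≤ a ^ 2 * b ^ (T - 1) := Nat.mul_le_mul_left _ (Nat.pow_le_pow_right hp.b_pos (by omega))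
    _ ≤ M * (S / b) := hp.edges_le

open Classical in
theorem count_inboxWords_forward {T a b M S W r : ℕ} {B : Finset (ℕ × ℕ)}
    (hp : ListingParams T a b M S W) (hr : r < T) {o o' : ℕ → List (ℕ × ℕ)}
    (ho : ∀ j < M, ∀ y, (inboxWords M o j).count y =
      if IsEdgeCode a B (y / b ^ r) ∧ y / (S / b) = j then 1 else 0)
    (ho' : ∀ i < M, o' i = (inboxWords M o i).flatMap fun x =>
      (List.range b).flatMap fun k => [((x * b + k) / (S / b), x * b + k)]) (j y : ℕ) :
    (inboxWords M o' j).count y =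
      if IsEdgeCode a B (y / b ^ (r + 1)) ∧ y / (S / b) = j then 1 else 0 := by
  have ha : 0 < a := by have := hp.two_le_a; omega
  rw [count_inboxWords_spread hp.b_pos (N := a ^ 2 * b ^ r) (g := fun z => [(z / (S / b), z)])
    (fun y hy => hy.lt_of_div ha hp.b_pos) (fun y hy => hp.dest_lt hr hy) ho ho']
  have h1 : ∀ z, z / b / b ^ r = z / b ^ (r + 1) := fun z => by
    rw [Nat.div_div_eq_div_mul, pow_succ, mul_comm]
  have h2 : ∀ z, (if IsEdgeCode a B (z / b / b ^ r) then
      [(z / (S / b), z)].count (j, y) else 0) =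
      if z = y then (if IsEdgeCode a B (y / b ^ (r + 1)) ∧ y / (S / b) = j then 1 else 0)
        else 0 := by
    intro z
    rw [h1]
    simp only [List.count_singleton, beq_iff_eq, Prod.mk.injEq]
    by_cases hz : z = y
    · subst hz
      by_cases h3 : IsEdgeCode a B (z / b ^ (r + 1)) <;> simp [h3]
    · simp [hz]
  rw [Finset.sum_congr rfl fun z _ => h2 z, Finset.sum_ite_eq']
  by_cases h3 : IsEdgeCode a B (y / b ^ (r + 1)) ∧ y / (S / b) = j
  · rw [if_pos (Finset.mem_range.mpr ?_)]
    exact (h3.1.lt_of_div ha hp.b_pos).trans_eq (by ring)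
  · rw [if_neg h3, ite_self]

theorem tripleCode_cases {a u v k : ℕ} (huv : u < v) (hku : k ≠ u) (hkv : k ≠ v) :
    (k < u ∧ tripleCode a u v k = (k * a + u) * a + v) ∨
      (u < k ∧ k < v ∧ tripleCode a u v k = (u * a + k) * a + v) ∨
      (v < k ∧ tripleCode a u v k = (u * a + v) * a + k) := by
  unfold tripleCode
  rcases lt_or_gt_of_ne hku with h | h
  · refine Or.inl ⟨h, ?_⟩
    rw [min_eq_left h.le, max_eq_right (h.trans huv).le, show u + v + k - (k + v) = u by omega]
  · rcases lt_or_gt_of_ne hkv with h' | h'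
    · refine Or.inr (Or.inl ⟨h, h', ?_⟩)
      rw [min_eq_right h.le, max_eq_right h'.le, show u + v + k - (u + v) = k by omega]
    · refine Or.inr (Or.inr ⟨h', ?_⟩)
      rw [min_eq_right h.le, max_eq_left h'.le, show u + v + k - (u + k) = v by omega]

theorem digits_eq {a x y z : ℕ} (hy : y < a) (hz : z < a) :
    ((x * a + y) * a + z) / a / a = x ∧ ((x * a + y) * a + z) / a % a = y ∧
      ((x * a + y) * a + z) % a = z := by
  obtain ⟨h1, h2⟩ := mul_add_div_mod (x := x * a + y) hz
  obtain ⟨h3, h4⟩ := mul_add_div_mod (x := x) hy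
  rw [h1, h2, h3, h4]
  exact ⟨rfl, rfl, rfl⟩

theorem eq_digits (a s : ℕ) : s = (s / a / a * a + s / a % a) * a + s % a := by
  rw [Nat.div_add_mod', Nat.div_add_mod']

/-- The message `z`, consisting of an edge and a vertex, is sent to the triple `s`. -/
def SentTo (a q : ℕ) (B : Finset (ℕ × ℕ)) (z s : ℕ) : Prop :=
  IsEdgeCode a B (z / q) ∧ (z % q < a ∧ z % q ≠ z / q / a ∧ z % q ≠ z / q % a) ∧
    tripleCode a (z / q / a) (z / q % a) (z % q) = s

/-- A message for the triple X < Y < Z consists of one of its three sides and the opposite vertex.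
So there are three candidate messages, each present exactly when its side is an edge. -/
theorem sentTo_iff {a q : ℕ} {B : Finset (ℕ × ℕ)} {z s : ℕ} (ha : 0 < a) (hq : a ≤ q) :
    SentTo a q B z s ↔ s / a / a < s / a % a ∧ s / a % a < s % a ∧
      (z = (s / a % a * a + s % a) * q + s / a / a ∧ coreAdj a B (s / a % a) (s % a) ∨
        z = (s / a / a * a + s % a) * q + s / a % a ∧ coreAdj a B (s / a / a) (s % a) ∨
        z = (s / a / a * a + s / a % a) * q + s % a ∧ coreAdj a B (s / a / a) (s / a % a)) := by
  constructor
  · rintro ⟨⟨huv, hadj⟩, ⟨hk, hku, hkv⟩, rfl⟩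
    have hv : z / q % a < a := Nat.mod_lt _ ha
    have hz : z = (z / q / a * a + z / q % a) * q + z % q := by
      rw [Nat.div_add_mod', Nat.div_add_mod']
    rcases tripleCode_cases (a := a) huv hku hkv with ⟨h1, h2⟩ | ⟨h1, h1', h2⟩ | ⟨h1, h2⟩
    · obtain ⟨h3, h4, h5⟩ := digits_eq (x := z % q) (huv.trans hv) hv
      rw [h2, h3, h4, h5]
      exact ⟨h1, huv, Or.inl ⟨hz, hadj⟩⟩
    · obtain ⟨h3, h4, h5⟩ := digits_eq (x := z / q / a) hk hv
      rw [h2, h3, h4, h5]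
      exact ⟨h1, h1', Or.inr (Or.inl ⟨hz, hadj⟩)⟩
    · obtain ⟨h3, h4, h5⟩ := digits_eq (x := z / q / a) hv hk
      rw [h2, h3, h4, h5]
      exact ⟨huv, h1, Or.inr (Or.inr ⟨hz, hadj⟩)⟩
  · rintro ⟨hxy, hyz, h⟩
    have hza : s % a < a := Nat.mod_lt _ ha
    have hs := eq_digits a s
    generalize s / a / a = X at *
    generalize s / a % a = Y at *
    generalize s % a = Z at *
    unfold SentTo IsEdgeCode
    rcases h with ⟨rfl, hadj⟩ | ⟨rfl, hadj⟩ | ⟨rfl, hadj⟩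
    · obtain ⟨h1, h2⟩ := mul_add_div_mod (x := Y * a + Z) (q := q) (k := X) (by omega)
      obtain ⟨h3, h4⟩ := mul_add_div_mod (x := Y) hza
      rw [h1, h2, h3, h4]
      refine ⟨⟨hyz, hadj⟩, by omega, ?_⟩
      have := tripleCode_cases (a := a) (k := X) hyz (by omega) (by omega)
      omega
    · obtain ⟨h1, h2⟩ := mul_add_div_mod (x := X * a + Z) (q := q) (k := Y) (by omega)
      obtain ⟨h3, h4⟩ := mul_add_div_mod (x := X) hza
      rw [h1, h2, h3, h4]
      refine ⟨⟨hxy.trans hyz, hadj⟩, by omega, ?_⟩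
      have := tripleCode_cases (a := a) (k := Y) (hxy.trans hyz) (by omega) (by omega)
      omega
    · obtain ⟨h1, h2⟩ := mul_add_div_mod (x := X * a + Y) (q := q) (k := Z) (by omega)
      obtain ⟨h3, h4⟩ := mul_add_div_mod (x := X) (hyz.trans hza)
      rw [h1, h2, h3, h4]
      refine ⟨⟨hxy, hadj⟩, by omega, ?_⟩
      have := tripleCode_cases (a := a) (k := Z) hxy (by omega) (by omega)
      omega

open Classical in
-- The three candidates differ in the last digit in base q, the opposite vertex. Three arrivals
-- therefore mean that all three sides are edges.
theorem card_sentTo {a q N : ℕ} {B : Finset (ℕ × ℕ)} {s : ℕ} (ha : 0 < a) (hq : a ≤ q)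
    (hN : a ^ 2 * q ≤ N) :
    ((Finset.range N).filter fun z => SentTo a q B z s).card ≤ 3 ∧
      (0 < ((Finset.range N).filter fun z => SentTo a q B z s).card → s < a ^ 3) ∧
      (3 ≤ ((Finset.range N).filter fun z => SentTo a q B z s).card ↔ IsTriangleCode a B s) := by
  set A := (Finset.range N).filter fun z => SentTo a q B z s with hA
  set z₁ := (s / a % a * a + s % a) * q + s / a / a with hz₁
  set z₂ := (s / a / a * a + s % a) * q + s / a % a with hz₂
  set z₃ := (s / a / a * a + s / a % a) * q + s % a with hz₃
  have hza : s % a < a := Nat.mod_lt _ ha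
  have hmem : ∀ z, z ∈ A ↔ SentTo a q B z s := by
    intro z
    rw [hA, Finset.mem_filter, Finset.mem_range, and_iff_right_iff_imp]
    intro h
    refine lt_of_lt_of_le ?_ hN
    exact (Nat.div_lt_iff_lt_mul (by omega)).mp (h.1.lt ha)
  have hsub : A ⊆ {z₁, z₂, z₃} := by
    intro z hz
    have := ((sentTo_iff ha hq).mp ((hmem z).mp hz)).2.2
    simp only [Finset.mem_insert, Finset.mem_singleton]
    tauto
  have hcard : A.card ≤ 3 := (Finset.card_le_card hsub).trans Finset.card_le_three
  have hne : s / a / a < s / a % a → s / a % a < s % a → z₁ ≠ z₂ ∧ z₁ ≠ z₃ ∧ z₂ ≠ z₃ := by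
    intro h1 h2
    have h3 := (mul_add_div_mod (x := s / a % a * a + s % a) (q := q) (k := s / a / a) (by omega)).2
    have h4 := (mul_add_div_mod (x := s / a / a * a + s % a) (q := q) (k := s / a % a) (by omega)).2
    have h5 := (mul_add_div_mod (x := s / a / a * a + s / a % a) (q := q) (k := s % a) (by omega)).2
    rw [← hz₁] at h3
    rw [← hz₂] at h4
    rw [← hz₃] at h5
    refine ⟨fun h => ?_, fun h => ?_, fun h => ?_⟩
    · rw [h] at h3
      omega
    · rw [h] at h3
      omega
    · rw [h] at h4
      omega
  refine ⟨hcard, fun h => ?_, fun h => ?_, fun h => ?_⟩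
  · obtain ⟨z, hz⟩ := Finset.card_pos.mp h
    have h1 := ((sentTo_iff ha hq).mp ((hmem z).mp hz)).1
    have h2 : s / a / a < a := h1.trans (Nat.mod_lt _ ha)
    rw [Nat.div_lt_iff_lt_mul ha, Nat.div_lt_iff_lt_mul ha] at h2
    exact h2.trans_eq (by ring)
  · obtain ⟨z, hz⟩ := Finset.card_pos.mp (lt_of_lt_of_le (by norm_num : 0 < 3) h)
    obtain ⟨h1, h2, -⟩ := (sentTo_iff ha hq).mp ((hmem z).mp hz)
    obtain ⟨hne₁, hne₂, hne₃⟩ := hne h1 h2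
    have heq : A = {z₁, z₂, z₃} := Finset.eq_of_subset_of_card_le hsub (by
      rw [Finset.card_eq_three.mpr ⟨_, _, _, hne₁, hne₂, hne₃, rfl⟩]
      exact h)
    have hall : ∀ z ∈ ({z₁, z₂, z₃} : Finset ℕ), _ := fun z hz =>
      ((sentTo_iff ha hq).mp ((hmem z).mp (heq ▸ hz))).2.2
    have hm₁ := hall z₁ (by simp)
    have hm₂ := hall z₂ (by simp)
    have hm₃ := hall z₃ (by simp)
    rw [← hz₁, ← hz₂, ← hz₃] at hm₁ hm₂ hm₃
    simp only [hne₁, hne₂, hne₃, hne₁.symm, hne₂.symm, hne₃.symm, false_and, true_and, false_or,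
      or_false] at hm₁ hm₂ hm₃
    exact ⟨h1, h2, hm₃, hm₁, hm₂⟩
  · obtain ⟨h1, h2, h3, h4, h5⟩ := h
    obtain ⟨hne₁, hne₂, hne₃⟩ := hne h1 h2
    have heq : ({z₁, z₂, z₃} : Finset ℕ) ⊆ A := by
      intro z hz
      rw [hmem, sentTo_iff ha hq]
      refine ⟨h1, h2, ?_⟩
      simp only [Finset.mem_insert, Finset.mem_singleton] at hz
      tauto
    rw [← Finset.card_eq_three.mpr ⟨_, _, _, hne₁, hne₂, hne₃, rfl⟩]
    exact Finset.card_le_card heq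

open Classical in
theorem count_inboxWords_triples {T a b M S W : ℕ} {B : Finset (ℕ × ℕ)}
    (hp : ListingParams T a b M S W) {o o' : ℕ → List (ℕ × ℕ)}
    (ho : ∀ j < M, ∀ y, (inboxWords M o j).count y =
      if IsEdgeCode a B (y / b ^ (T - 1)) ∧ y / (S / b) = j then 1 else 0)
    (ho' : ∀ i < M, o' i = (inboxWords M o i).flatMap fun x =>
      (List.range b).flatMap fun k => tripleMessage a (b ^ T) (S / 3) (x * b + k)) (j s : ℕ) :
    (inboxWords M o' j).count s ≤ 3 ∧
      (0 < (inboxWords M o' j).count s → s / (S / 3) = j ∧ s < a ^ 3) ∧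
      (3 ≤ (inboxWords M o' j).count s ↔ s / (S / 3) = j ∧ IsTriangleCode a B s) := by
  have ha : 0 < a := by have := hp.two_le_a; omega
  have hT : b ^ (T - 1) * b = b ^ T := by
    rw [← pow_succ, Nat.sub_add_cancel hp.one_le_T]
  have h1 : ∀ z, z / b / b ^ (T - 1) = z / b ^ T := fun z => by
    rw [Nat.div_div_eq_div_mul, mul_comm, hT]
  have hcount : (inboxWords M o' j).count s = if s / (S / 3) = j then
      ((Finset.range (a ^ 2 * b ^ (T - 1) * b)).filter fun z => SentTo a (b ^ T) B z s).card
      else 0 := by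
    rw [count_inboxWords_spread hp.b_pos (N := a ^ 2 * b ^ (T - 1))
      (fun y hy => hy.lt_of_div ha hp.b_pos)
      (fun y hy => hp.dest_lt (by have := hp.one_le_T; omega) hy) ho ho']
    have h2 : ∀ z, (if IsEdgeCode a B (z / b / b ^ (T - 1)) then
        (tripleMessage a (b ^ T) (S / 3) z).count (j, s) else 0) =
        if s / (S / 3) = j then (if SentTo a (b ^ T) B z s then 1 else 0) else 0 := by
      intro z
      rw [h1]
      unfold tripleMessage SentTo
      by_cases h3 : IsEdgeCode a B (z / b ^ T)
      · by_cases h4 : z % b ^ T < a ∧ z % b ^ T ≠ z / b ^ T / a ∧ z % b ^ T ≠ z / b ^ T % a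
        · simp only [h3, h4, if_true, true_and, List.count_singleton, beq_iff_eq, Prod.mk.injEq,
            ne_eq, not_false_eq_true]
          by_cases h5 : tripleCode a (z / b ^ T / a) (z / b ^ T % a) (z % b ^ T) = s
          · simp [h5]
          · simp [h5]
        · rw [if_pos h3, if_neg h4]
          simp only [h4, false_and, and_false, if_false, ite_self]
          rfl
      · simp only [h3, if_false, false_and, ite_self]
    rw [Finset.sum_congr rfl fun z _ => h2 z]
    split_ifs with h3
    · rw [Finset.card_filter]
    · exact Finset.sum_const_zero
  obtain ⟨h2, h3, h4⟩ := card_sentTo (B := B) (s := s) (N := a ^ 2 * b ^ (T - 1) * b) ha hp.a_le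
    (by rw [mul_assoc, hT])
  rw [hcount]
  split_ifs with h5
  · exact ⟨h2, fun h => ⟨h5, h3 h⟩, h4.trans ⟨fun h => ⟨h5, h⟩, fun h => h.2⟩⟩
  · exact ⟨by norm_num, fun h => absurd h (lt_irrefl 0), by omega, fun h => absurd h.1 h5⟩

theorem SentTo.lt {a q : ℕ} {B : Finset (ℕ × ℕ)} {z s : ℕ} (ha : 0 < a) (hq : a ≤ q)
    (h : SentTo a q B z s) : s < a ^ 3 := by
  have h2 : s / a / a < a := ((sentTo_iff ha hq).mp h).1.trans (Nat.mod_lt _ ha)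
  rw [Nat.div_lt_iff_lt_mul ha, Nat.div_lt_iff_lt_mul ha] at h2
  exact h2.trans_eq (by ring)

theorem length_flatMap_le {α β : Type*} {l : List α} {f : α → List β} {c : ℕ}
    (h : ∀ x ∈ l, (f x).length ≤ c) : (l.flatMap f).length ≤ l.length * c := by
  induction l with
  | nil => simp
  | cons x l ih =>
    rw [List.flatMap_cons, List.length_append, List.length_cons, Nat.add_one_mul, add_comm]
    exact Nat.add_le_add (ih fun y hy => h y (List.mem_cons_of_mem _ hy))
      (h x List.mem_cons_self)

/-! ### The execution of the triangle listing program -/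

theorem exists_mpcStep {κ : ℕ} {A : MPCAlgorithm} {I : Instance} {M S : ℕ}
    {inp : ℕ → List (ℕ × ℕ)} {c : ℕ → Machine} {Q : ℕ → Machine → Prop}
    (h : ∀ i < M, (c i).halted = false ∧ Runs (mpcEnv I M S inp c i) (wordBound κ I.n)
      (A.memFactor * S) A.prog (Q i) { c i with outbox := [] }) :
    ∃ c' : ℕ → Machine, ∀ i < M, mpcStep κ A I M S inp c i (c' i) ∧ Q i (c' i) := by
  have h1 : ∀ i, ∃ m', i < M → mpcStep κ A I M S inp c i m' ∧ Q i m' := by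
    intro i
    by_cases hi : i < M
    · obtain ⟨h2, m', h3, h4⟩ := h i hi
      refine ⟨m', fun _ => ⟨?_, h4⟩⟩
      rw [mpcStep, if_neg (by simp [h2])]
      exact h3
    · exact ⟨c i, fun h => absurd h hi⟩
  choose c' hc' using h1
  exact ⟨c', fun i hi => hc' i hi⟩

/-- Dependent choice: a successor is only guaranteed for configurations that satisfy the invariant,
so the two are constructed together. -/
theorem exists_run (Inv : ℕ → (ℕ → Machine) → Prop) (Step : (ℕ → Machine) → (ℕ → Machine) → Prop)
    {c₀ : ℕ → Machine} (h0 : Inv 0 c₀) (hstep : ∀ r c, Inv r c → ∃ c', Step c c' ∧ Inv (r + 1) c') :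
    ∃ conf : ℕ → ℕ → Machine, conf 0 = c₀ ∧ ∀ r, Step (conf r) (conf (r + 1)) ∧ Inv r (conf r) := by
  choose next hnext using hstep
  let run : (r : ℕ) → {c // Inv r c} := fun r =>
    Nat.rec ⟨c₀, h0⟩ (fun r c => ⟨next r c.1 c.2, (hnext r c.1 c.2).2⟩) r
  exact ⟨fun r => (run r).1, rfl, fun r => ⟨(hnext r (run r).1 (run r).2).1, (run r).2⟩⟩

/-- The words on the way to the machines in round `r`. -/
abbrev inFlight (M : ℕ) (c : ℕ → Machine) (j : ℕ) : List ℕ := inboxWords M (fun i => (c i).outbox) j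

open Classical in
/-- The state of the machines at the beginning of round `1 ≤ r ≤ T`: every edge is represented
by all words that extend its code by `r - 1` digits in base `b`. -/
structure EdgeRound (a b M S : ℕ) (B : Finset (ℕ × ℕ)) (r : ℕ) (c : ℕ → Machine) : Prop where
  ready : ∀ i < M, Ready r a b (c i)
  length_outbox : ∀ i < M, (c i).outbox.length ≤ S
  count : ∀ j < M, ∀ y, (inFlight M c j).count y =
    if IsEdgeCode a B (y / b ^ (r - 1)) ∧ y / (S / b) = j then 1 else 0

/-- The state of the machines at the beginning of round `r`, when the edges have been sent to the
triples which contain them. -/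
structure TripleRound (a b M S : ℕ) (B : Finset (ℕ × ℕ)) (r : ℕ) (c : ℕ → Machine) : Prop where
  ready : ∀ i < M, Ready r a b (c i)
  length_outbox : ∀ i < M, (c i).outbox.length ≤ S
  count_le : ∀ j < M, ∀ s, (inFlight M c j).count s ≤ 3
  of_count_pos : ∀ j < M, ∀ s, 0 < (inFlight M c j).count s → s / (S / 3) = j ∧ s < a ^ 3
  count_eq : ∀ j < M, ∀ s, 3 ≤ (inFlight M c j).count s ↔ s / (S / 3) = j ∧ IsTriangleCode a B s

/-- Machine `i` has halted and reported all triangles with a code in its block. -/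
structure Finished (a S : ℕ) (B : Finset (ℕ × ℕ)) (i : ℕ) (m : Machine) : Prop where
  halted : m.halted = true
  outbox : m.outbox = []
  out : ∃ l : List ℕ, m.out = l.map (tripleItem a) ∧ l.Nodup ∧ l.length ≤ S ∧
    ∀ s, s ∈ l ↔ s / (S / 3) = i ∧ IsTriangleCode a B s

theorem EdgeRound.of_mem {a b M S : ℕ} {B : Finset (ℕ × ℕ)} {r : ℕ} {c : ℕ → Machine}
    (h : EdgeRound a b M S B r c) {j : ℕ} (hj : j < M) {y : ℕ} (hy : y ∈ inFlight M c j) :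
    IsEdgeCode a B (y / b ^ (r - 1)) ∧ y / (S / b) = j := by
  have h1 := List.count_pos_iff.mpr hy
  rw [h.count j hj] at h1
  by_contra h2
  rw [if_neg h2] at h1
  exact lt_irrefl _ h1

theorem EdgeRound.length_le {a b M S : ℕ} {B : Finset (ℕ × ℕ)} {r : ℕ} {c : ℕ → Machine}
    (h : EdgeRound a b M S B r c) (hS : 0 < S / b) {j : ℕ} (hj : j < M) :
    (inFlight M c j).length ≤ S / b := by
  refine (length_le_of_count_le hS (fun x hx => (h.of_mem hj hx).2) (c := 1) fun x => ?_).trans_eq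
    (one_mul _)
  rw [h.count j hj]
  split_ifs <;> norm_num

theorem TripleRound.length_le {a b M S : ℕ} {B : Finset (ℕ × ℕ)} {r : ℕ} {c : ℕ → Machine}
    (h : TripleRound a b M S B r c) (hS : 0 < S / 3) {j : ℕ} (hj : j < M) :
    (inFlight M c j).length ≤ S :=
  (length_le_of_count_le hS
    (fun x hx => (h.of_count_pos j hj x (List.count_pos_iff.mpr hx)).1)
    (h.count_le j hj)).trans (Nat.mul_div_le S 3)

theorem Ready.clear {r a b : ℕ} {m : Machine} (h : Ready r a b m) :
    Ready r a b { m with outbox := [] } :=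
  ⟨h.phase, h.mem_one, h.mem_two, h.counters, h.out, h.halted⟩

theorem div_pow_extend {b x k r : ℕ} (hr : 1 ≤ r) (hk : k < b) :
    (x * b + k) / b ^ r = x / b ^ (r - 1) := by
  obtain ⟨r, rfl⟩ := Nat.exists_eq_add_of_le' hr
  rw [Nat.add_sub_cancel, pow_succ', ← Nat.div_div_eq_div_mul, (mul_add_div_mod hk).1]

theorem length_spread_le {S b : ℕ} {words : List ℕ} (hw : words.length ≤ S / b)
    {h : ℕ → ℕ → List (ℕ × ℕ)} (hh : ∀ x k, (h x k).length ≤ 1) :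
    (words.flatMap fun x => (List.range b).flatMap fun k => h x k).length ≤ S := by
  refine (length_flatMap_le (c := b) fun x _ => ?_).trans
    ((Nat.mul_le_mul_right b hw).trans (Nat.div_mul_le_self S b))
  exact (length_flatMap_le (c := 1) fun k _ => hh x k).trans_eq (by simp)

theorem length_edgeMessage_le (a D : ℕ) (p : ℕ × ℕ) : (edgeMessage a D p).length ≤ 1 := by
  unfold edgeMessage
  split_ifs <;> simp

theorem length_tripleMessage_le (a q D y : ℕ) : (tripleMessage a q D y).length ≤ 1 := by
  unfold tripleMessage
  split_ifs <;> simp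

theorem tripleMessage_bound {T a b M S W y : ℕ} {B : Finset (ℕ × ℕ)}
    (hp : ListingParams T a b M S W) (hy : IsEdgeCode a B (y / b ^ T)) {p : ℕ × ℕ}
    (h : p ∈ tripleMessage a (b ^ T) (S / 3) y) : p.1 < M ∧ p.2 < W := by
  unfold tripleMessage at h
  split_ifs at h with h1
  · obtain rfl := List.mem_singleton.mp h
    have ha : 0 < a := by have := hp.two_le_a; omega
    have h2 := SentTo.lt ha hp.a_le ⟨hy, h1, rfl⟩
    exact ⟨(Nat.div_lt_iff_lt_mul hp.third_pos).mpr (h2.trans_le hp.triples_le),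
      h2.trans hp.nodes_lt⟩
  · simp at h

/-- The triangle listing algorithm with `T + 2` rounds. -/
def trianglesAlg (T : ℕ) : MPCAlgorithm := ⟨trianglesProg T, 9, 1⟩

section Steps

variable {κ T a b M S : ℕ} {B : Finset (ℕ × ℕ)} {inp : ℕ → List (ℕ × ℕ)} {c : ℕ → Machine}

theorem trianglesAlg_start (hp : ListingParams T a b M S (wordBound κ (a ^ 3)))
    (hinp : IsMPCInput (lollipop a B) M S inp) (hc : ∀ i, c i = ⟨fun _ => 0, [], [], false⟩) :
    ∃ c' : ℕ → Machine, (∀ i < M, mpcStep κ (trianglesAlg T) (lollipop a B) M S inp c i (c' i)) ∧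
      EdgeRound a b M S B 1 c' := by
  have ha : 0 < a := by have := hp.two_le_a; omega
  obtain ⟨c', hc'⟩ := exists_mpcStep (κ := κ) (A := trianglesAlg T) (I := lollipop a B) (M := M)
    (S := S) (inp := inp) (c := c) (Q := fun i m => Ready 1 a b m ∧
      m.outbox = (inp i).flatMap (edgeMessage a (S / b))) (by
    intro i hi
    rw [hc i, lollipop_nodes]
    refine ⟨rfl, trianglesProg_start hp (lollipop_nodes a B) rfl rfl (inp i) ?_ (hinp.1 i hi) ?_⟩
    · simp [mpcEnv, inputWords, lollipop]
    · intro p hpL h1 h2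
      have hadj : (lollipopGraph a B).Adj p.1 p.2 := (hinp.2.2 _).mp
        (List.mem_map.mpr ⟨p, List.mem_flatMap.mpr ⟨i, List.mem_range.mpr hi, hpL⟩, rfl⟩)
      obtain ⟨-, h3, h4⟩ := lollipopGraph_adj_le hadj
      have h5 := edgeCode_lt h3 h4 h1 h2
      refine ⟨(Nat.div_lt_iff_lt_mul hp.block_pos).mpr ?_, ?_⟩
      · exact h5.trans_le ((Nat.le_mul_of_pos_right _ (pow_pos hp.b_pos _)).trans hp.edges_le)
      · exact h5.trans_le ((Nat.le_mul_of_pos_right _ (pow_pos hp.b_pos _)).trans hp.words_le))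
  refine ⟨c', fun i hi => (hc' i hi).1, fun i hi => (hc' i hi).2.1, fun i hi => ?_, ?_⟩
  · rw [(hc' i hi).2.2]
    exact (length_flatMap_le fun p _ => length_edgeMessage_le a _ p).trans
      ((mul_one _).trans_le (hinp.1 i hi))
  · intro j _ y
    rw [Nat.sub_self, pow_zero, Nat.div_one]
    exact count_inboxWords_edges hinp (fun i hi => (hc' i hi).2.2) j y

theorem trianglesAlg_forward (hp : ListingParams T a b M S (wordBound κ (a ^ 3))) {r : ℕ}
    (hr : 1 ≤ r) (hrT : r < T) (h : EdgeRound a b M S B r c) :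
    ∃ c' : ℕ → Machine, (∀ i < M, mpcStep κ (trianglesAlg T) (lollipop a B) M S inp c i (c' i)) ∧
      EdgeRound a b M S B (r + 1) c' := by
  have ha : 0 < a := by have := hp.two_le_a; omega
  obtain ⟨c', hc'⟩ := exists_mpcStep (κ := κ) (A := trianglesAlg T) (I := lollipop a B) (M := M)
    (S := S) (inp := inp) (c := c) (Q := fun i m => Ready (r + 1) a b m ∧
      m.outbox = (inFlight M c i).flatMap fun x =>
        (List.range b).flatMap fun k => [((x * b + k) / (S / b), x * b + k)]) (by
    intro i hi
    rw [lollipop_nodes]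
    refine ⟨(h.ready i hi).halted, trianglesProg_forward (words := inFlight M c i) hp
      rfl rfl hr hrT rfl ((h.length_le hp.block_pos hi).trans (Nat.div_le_self S b)) ?_ (h.ready i hi).clear rfl⟩
    intro x hx k hk
    have h1 : IsEdgeCode a B ((x * b + k) / b ^ r) := by
      rw [div_pow_extend hr hk]
      exact (h.of_mem hi hx).1
    refine ⟨hp.dest_lt hrT h1, ?_⟩
    exact ((h1.lt_of_div ha hp.b_pos).trans_le
      (Nat.mul_le_mul_left _ (Nat.pow_le_pow_right hp.b_pos hrT.le))).trans_le hp.words_le)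
  refine ⟨c', fun i hi => (hc' i hi).1, fun i hi => (hc' i hi).2.1, fun i hi => ?_, ?_⟩
  · rw [(hc' i hi).2.2]
    exact length_spread_le (h.length_le hp.block_pos hi) fun _ _ => le_rfl
  · intro j _ y
    have h1 := count_inboxWords_forward hp (show r - 1 < T by omega) h.count
      (fun i hi => (hc' i hi).2.2) j y
    rwa [Nat.sub_add_cancel hr] at h1

theorem trianglesAlg_triples (hp : ListingParams T a b M S (wordBound κ (a ^ 3)))
    (h : EdgeRound a b M S B T c) :
    ∃ c' : ℕ → Machine, (∀ i < M, mpcStep κ (trianglesAlg T) (lollipop a B) M S inp c i (c' i)) ∧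
      TripleRound a b M S B (T + 1) c' := by
  obtain ⟨c', hc'⟩ := exists_mpcStep (κ := κ) (A := trianglesAlg T) (I := lollipop a B) (M := M)
    (S := S) (inp := inp) (c := c) (Q := fun i m => Ready (T + 1) a b m ∧
      m.outbox = (inFlight M c i).flatMap fun x =>
        (List.range b).flatMap fun k => tripleMessage a (b ^ T) (S / 3) (x * b + k)) (by
    intro i hi
    rw [lollipop_nodes]
    refine ⟨(h.ready i hi).halted, trianglesProg_triples (words := inFlight M c i) hp rfl rfl rfl
      ((h.length_le hp.block_pos hi).trans (Nat.div_le_self S b)) ?_ (h.ready i hi).clear rfl⟩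
    intro x hx k hk p hmem
    refine tripleMessage_bound (B := B) hp ?_ hmem
    rw [div_pow_extend hp.one_le_T hk]
    exact (h.of_mem hi hx).1)
  have hcount := count_inboxWords_triples hp h.count fun i hi => (hc' i hi).2.2
  refine ⟨c', fun i hi => (hc' i hi).1, fun i hi => (hc' i hi).2.1, fun i hi => ?_,
    fun j _ s => (hcount j s).1, fun j _ s => (hcount j s).2.1, fun j _ s => (hcount j s).2.2⟩
  rw [(hc' i hi).2.2]
  exact length_spread_le (h.length_le hp.block_pos hi) fun _ _ => length_tripleMessage_le _ _ _ _

theorem trianglesAlg_collect (hp : ListingParams T a b M S (wordBound κ (a ^ 3)))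
    (h : TripleRound a b M S B (T + 1) c) :
    ∃ c' : ℕ → Machine, (∀ i < M, mpcStep κ (trianglesAlg T) (lollipop a B) M S inp c i (c' i)) ∧
      ∀ i < M, Finished a S B i (c' i) := by
  obtain ⟨c', hc'⟩ := exists_mpcStep (κ := κ) (A := trianglesAlg T) (I := lollipop a B) (M := M)
    (S := S) (inp := inp) (c := c) (Q := fun i m => m.halted = true ∧ m.outbox = [] ∧
      ∃ l : List ℕ, m.out = l.map (tripleItem a) ∧ l.Nodup ∧ l.length ≤ S ∧
        ∀ x, x ∈ l ↔ 3 ≤ (inFlight M c i).count x) (by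
    intro i hi
    rw [lollipop_nodes]
    exact ⟨(h.ready i hi).halted, trianglesProg_collect (words := inFlight M c i) hp
      (lollipop_nodes a B) rfl rfl (h.length_le hp.third_pos hi)
      (fun x hx => h.of_count_pos i hi x (List.count_pos_iff.mpr hx)) (h.ready i hi).clear rfl⟩)
  refine ⟨c', fun i hi => (hc' i hi).1, fun i hi => ?_⟩
  obtain ⟨-, h1, h2, l, h3, h4, h5, h6⟩ := hc' i hi
  exact ⟨h1, h2, l, h3, h4, h5, fun s => (h6 s).trans (h.count_eq i hi s)⟩

theorem trianglesAlg_idle (h : ∀ i < M, Finished a S B i (c i)) :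
    ∃ c' : ℕ → Machine, (∀ i < M, mpcStep κ (trianglesAlg T) (lollipop a B) M S inp c i (c' i)) ∧
      ∀ i < M, Finished a S B i (c' i) := by
  refine ⟨fun i => { c i with outbox := [] }, fun i hi => ?_, fun i hi =>
    ⟨(h i hi).halted, rfl, (h i hi).out⟩⟩
  rw [mpcStep, if_pos (h i hi).halted]

/-- The state of the machines at the beginning of round `r`. -/
structure ListingInv (T a b M S : ℕ) (B : Finset (ℕ × ℕ)) (r : ℕ) (c : ℕ → Machine) : Prop where
  initial : r = 0 → ∀ i, c i = ⟨fun _ => 0, [], [], false⟩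
  edges : 1 ≤ r → r ≤ T → EdgeRound a b M S B r c
  triples : r = T + 1 → TripleRound a b M S B r c
  finished : T + 2 ≤ r → ∀ i < M, Finished a S B i (c i)

theorem ListingInv.next (hp : ListingParams T a b M S (wordBound κ (a ^ 3)))
    (hinp : IsMPCInput (lollipop a B) M S inp) {r : ℕ} (h : ListingInv T a b M S B r c) :
    ∃ c' : ℕ → Machine, (∀ i < M, mpcStep κ (trianglesAlg T) (lollipop a B) M S inp c i (c' i)) ∧
      ListingInv T a b M S B (r + 1) c' := by
  have hT := hp.one_le_T
  rcases Nat.eq_zero_or_pos r with rfl | hr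
  · obtain ⟨c', h1, h2⟩ := trianglesAlg_start hp hinp (h.initial rfl)
    exact ⟨c', h1, by omega, fun _ _ => h2, by omega, by omega⟩
  rcases lt_trichotomy r T with hrT | rfl | hrT
  · obtain ⟨c', h1, h2⟩ := trianglesAlg_forward (inp := inp) hp hr hrT (h.edges hr hrT.le)
    exact ⟨c', h1, by omega, fun _ _ => h2, by omega, by omega⟩
  · obtain ⟨c', h1, h2⟩ := trianglesAlg_triples (inp := inp) hp (h.edges hr le_rfl)
    exact ⟨c', h1, by omega, by omega, fun _ => h2, by omega⟩
  · rcases Nat.eq_or_lt_of_le hrT with rfl | hrT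
    · obtain ⟨c', h1, h2⟩ := trianglesAlg_collect (inp := inp) hp (h.triples rfl)
      exact ⟨c', h1, by omega, by omega, by omega, fun _ => h2⟩
    · obtain ⟨c', h1, h2⟩ := trianglesAlg_idle (κ := κ) (T := T) (inp := inp) (h.finished hrT)
      exact ⟨c', h1, by omega, by omega, by omega, fun _ => h2⟩

theorem deliver_eq_nil {M : ℕ} {o : ℕ → List (ℕ × ℕ)} (ho : ∀ j < M, o j = []) (i : ℕ) :
    deliver (List.range M) o i = [] := by
  rw [deliver, List.flatMap_eq_nil_iff]
  intro j hj
  rw [ho j (List.mem_range.mp hj)]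
  rfl

theorem ListingInv.capacity {W : ℕ} (hp : ListingParams T a b M S W) {r : ℕ}
    (h : ListingInv T a b M S B r c) {i : ℕ} (hi : i < M) :
    (c i).outbox.length ≤ S ∧ (deliver (List.range M) (fun j => (c j).outbox) i).length ≤ S ∧
      ((c i).out.map List.length).sum ≤ 9 * S := by
  have hlen : (deliver (List.range M) (fun j => (c j).outbox) i).length =
      (inFlight M c i).length := List.length_map _ |>.symm
  rcases Nat.eq_zero_or_pos r with rfl | hr
  · have h1 := h.initial rfl
    rw [deliver_eq_nil fun j _ => by rw [h1 j], h1 i]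
    simp
  rw [hlen]
  by_cases hrT : r ≤ T
  · have h1 := h.edges hr hrT
    refine ⟨h1.length_outbox i hi, (h1.length_le hp.block_pos hi).trans (Nat.div_le_self S b), ?_⟩
    rw [(h1.ready i hi).out]
    simp
  by_cases hrT' : r = T + 1
  · have h1 := h.triples hrT'
    refine ⟨h1.length_outbox i hi, h1.length_le hp.third_pos hi, ?_⟩
    rw [(h1.ready i hi).out]
    simp
  · have h1 := h.finished (by omega)
    rw [← hlen, deliver_eq_nil fun j hj => (h1 j hj).outbox, (h1 i hi).outbox]
    refine ⟨Nat.zero_le _, Nat.zero_le _, ?_⟩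
    obtain ⟨l, h2, -, h3, -⟩ := (h1 i hi).out
    rw [h2, List.map_map, show List.length ∘ tripleItem a = fun _ => 3 from rfl, List.map_const',
      List.sum_replicate, smul_eq_mul]
    omega

end Steps

/-! ### The output -/

theorem tripleItem_injective (a : ℕ) : Function.Injective (tripleItem a) := by
  intro s t h
  simp only [tripleItem, List.cons.injEq, and_true, Nat.add_left_cancel_iff] at h
  rw [eq_digits a s, eq_digits a t, h.1, h.2.1, h.2.2]

theorem mem_triangles_iff_code {a : ℕ} {B : Finset (ℕ × ℕ)} {x : List ℕ} :
    x ∈ triangles (lollipop a B) ↔ ∃ s, IsTriangleCode a B s ∧ tripleItem a s = x := by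
  simp only [triangles, Finset.mem_image, Finset.mem_filter]
  constructor
  · rintro ⟨⟨u, v, w⟩, ⟨-, huv, hvw, h1, h2, h3⟩, rfl⟩
    dsimp only at huv hvw h1 h2 h3 ⊢
    obtain ⟨-, -, hw⟩ := lollipopGraph_adj_le h2
    -- As w ≥ u + 2, the edge between u and w is not a path edge, so u lies among the last a
    -- vertices.
    have hu : a ^ 3 - a < u := by
      change (lollipopGraph a B).Adj u w at h3
      simp only [lollipopGraph, SimpleGraph.fromRel_adj, freePairs, Finset.mem_filter,
        Finset.mem_product, Finset.mem_Ioc] at h3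
      omega
    have hv : a ^ 3 - a < v := hu.trans huv
    obtain ⟨w, rfl⟩ := Nat.exists_eq_add_of_le (hv.trans hvw)
    obtain ⟨v, rfl⟩ := Nat.exists_eq_add_of_le hv
    obtain ⟨u, rfl⟩ := Nat.exists_eq_add_of_le hu
    have hle : a ≤ a ^ 3 := Nat.le_self_pow (by norm_num) a
    obtain ⟨h4, h5, h6⟩ := digits_eq (a := a) (x := u) (y := v) (z := w) (by omega) (by omega)
    refine ⟨(u * a + v) * a + w, ?_, ?_⟩
    · unfold IsTriangleCode coreAdj
      rw [h4, h5, h6]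
      exact ⟨by omega, by omega, h1, h2, h3⟩
    · rw [tripleItem, h4, h5, h6]
  · rintro ⟨s, ⟨h1, h2, h3, h4, h5⟩, rfl⟩
    refine ⟨(_, _, _), ⟨?_, ?_, ?_, h3, h4, h5⟩, rfl⟩
    · simp only [Finset.mem_product]
      exact ⟨lollipopGraph_mem a B _ _ h3, lollipopGraph_mem a B _ _ h4,
        lollipopGraph_mem a B _ _ h4.symm⟩
    · dsimp only
      omega
    · dsimp only
      omega

/-- The blocks of length S / 3 are disjoint and the M of them cover all codes below a ^ 3. Each
triangle is therefore reported exactly once, with output factor 1. -/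
theorem represents_triangles {a M S : ℕ} {B : Finset (ℕ × ℕ)} {c : ℕ → Machine} (ha : 0 < a)
    (hS : 0 < S / 3) (hM : a ^ 3 ≤ M * (S / 3)) (h : ∀ i < M, Finished a S B i (c i)) :
    Represents ((List.range M).flatMap fun i => (c i).out) (triangles (lollipop a B)) 1 := by
  choose! l hout hnodup hlen hmem using fun i hi => (h i hi).out
  set D := (List.range M).flatMap l with hD
  have h1 : ((List.range M).flatMap fun i => (c i).out) = D.map (tripleItem a) := by
    rw [hD, List.map_flatMap]
    exact List.flatMap_congr fun i hi => hout i (List.mem_range.mp hi)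
  have h2 : D.Nodup := by
    rw [hD, List.nodup_flatMap]
    refine ⟨fun i hi => hnodup i (List.mem_range.mp hi), ?_⟩
    refine (List.nodup_range (n := M)).imp_of_mem fun {i j} hi hj hij => ?_
    intro s hs hs'
    exact hij ((((hmem i (List.mem_range.mp hi) s).mp hs).1).symm.trans
      ((hmem j (List.mem_range.mp hj) s).mp hs').1)
  have h3 : ∀ s, s ∈ D ↔ IsTriangleCode a B s := by
    intro s
    rw [hD, List.mem_flatMap]
    constructor
    · rintro ⟨i, hi, hs⟩
      exact ((hmem i (List.mem_range.mp hi) s).mp hs).2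
    · intro hs
      have h4 : s / (S / 3) < M := (Nat.div_lt_iff_lt_mul hS).mpr ((hs.lt ha).trans_le hM)
      exact ⟨_, List.mem_range.mpr h4, (hmem _ h4 s).mpr ⟨rfl, hs⟩⟩
  have h4 : (D.map (tripleItem a)).toFinset = triangles (lollipop a B) := by
    ext x
    rw [mem_triangles_iff_code, List.mem_toFinset, List.mem_map]
    exact exists_congr fun s => and_congr_left' (h3 s)
  rw [h1]
  refine ⟨h4, ?_⟩
  rw [← h4, outSize_toFinset (h2.map (tripleItem_injective a)), one_mul]

theorem trianglesAlg_run {κ T a b M S R : ℕ} {B : Finset (ℕ × ℕ)}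
    (hp : ListingParams T a b M S (wordBound κ (a ^ 3))) (hR : T + 2 ≤ R)
    {inp : ℕ → List (ℕ × ℕ)} (hinp : IsMPCInput (lollipop a B) M S inp) :
    ∃ conf, IsMPCRun κ (trianglesAlg T) (lollipop a B) M S inp R conf ∧
      (∀ i < M, (conf R i).halted = true) ∧
      Represents ((List.range M).flatMap fun i => (conf R i).out) (triangles (lollipop a B)) 1 := by
  obtain ⟨conf, h0, h⟩ := exists_run (ListingInv T a b M S B)
    (fun c c' => ∀ i < M, mpcStep κ (trianglesAlg T) (lollipop a B) M S inp c i (c' i))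
    (c₀ := fun _ => ⟨fun _ => 0, [], [], false⟩)
    ⟨fun _ _ => rfl, by omega, by omega, by omega⟩ fun r c hc => hc.next hp hinp
  have hfin := (h R).2.finished hR
  refine ⟨conf, ⟨fun i => by rw [h0], fun r _ => (h r).1, fun r _ i hi => (h r).2.capacity hp hi⟩,
    fun i hi => (hfin i hi).halted, represents_triangles ?_ hp.third_pos hp.triples_le hfin⟩
  have := hp.two_le_a
  omega

/-! ### Parameters of the triangle listing program -/

theorem pow_lt_wordBound {κ n x : ℕ} (hκ : κ ≠ 0) (hx : x ≤ n ^ κ) : x < wordBound κ n := by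
  rw [wordBound, mul_comm, pow_mul]
  exact hx.trans_lt (Nat.pow_lt_pow_left (Nat.lt_size_self n) hκ)

/-- Bernoulli's inequality: (1 - 1/b) ^ T ≥ 1 - T/b ≥ 1/2. It shows that rounding b up costs at most
a factor 2 in b ^ T, so the number of copies stays linear in n. -/
theorem pow_le_two_mul_pred_pow {b T : ℕ} (hb : 2 * T < b) : b ^ T ≤ 2 * (b - 1) ^ T := by
  have hb0 : (0 : ℝ) < b := by exact_mod_cast (by omega : 0 < b)
  have h1 : (1 : ℝ) - T / b ≤ (1 - 1 / b) ^ T := by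
    have h2 : (1 : ℝ) / b ≤ 1 := (div_le_one hb0).mpr (by exact_mod_cast (by omega : 1 ≤ b))
    have := one_add_mul_le_pow (a := -(1 / (b : ℝ))) (by linarith) T
    rw [← sub_eq_add_neg] at this
    calc (1 : ℝ) - T / b = 1 + T * -(1 / (b : ℝ)) := by ring
      _ ≤ _ := this
  have h2 : (T : ℝ) / b ≤ 1 / 2 := by
    rw [div_le_div_iff₀ hb0 (by norm_num)]
    exact_mod_cast (by omega : T * 2 ≤ 1 * b)
  have h3 : ((b - 1 : ℕ) : ℝ) = b * (1 - 1 / b) := by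
    rw [Nat.cast_sub (by omega), Nat.cast_one, mul_sub, mul_one, mul_one_div_cancel hb0.ne']
  have h4 : (b : ℝ) ^ T ≤ 2 * ((b - 1 : ℕ) : ℝ) ^ T := by
    rw [h3, mul_pow]
    nlinarith [pow_pos hb0 T]
  exact_mod_cast h4

theorem exists_listingParams {κ : ℕ} (hκ : 2 ≤ κ) {δ : ℝ} (hδ : 0 < δ) :
    ∃ a₀ : ℕ, ∀ a ≥ a₀, ∀ M S : ℕ, ((a : ℝ) ^ 3) ^ δ ≤ S → 6 * a ^ 3 ≤ M * S →
      M ≤ (a ^ 3) ^ κ → S ≤ (a ^ 3) ^ κ →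
      ∃ b, ListingParams ⌈1 / δ⌉₊ a b M S (wordBound κ (a ^ 3)) := by
  set T := ⌈1 / δ⌉₊ with hT
  have hT1 : 1 ≤ T := Nat.one_le_ceil_iff.mpr (by positivity)
  have hTδ : 1 ≤ δ * T := by
    have := Nat.le_ceil (1 / δ)
    rwa [div_le_iff₀' hδ] at this
  obtain ⟨a₁, ha₁⟩ := Filter.eventually_atTop.mp
    (((tendsto_rpow_atTop hδ).comp tendsto_natCast_atTop_atTop).eventually_ge_atTop 2)
  refine ⟨max a₁ (max ((2 * T) ^ T + 1) (T + 2)), fun a ha M S hS hMS hMn hSn => ?_⟩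
  simp only [ge_iff_le, max_le_iff] at ha
  obtain ⟨ha₁', haT, haT'⟩ := ha
  have ha2 : 2 ≤ a := by omega
  have hx : (2 : ℝ) ≤ (a : ℝ) ^ δ := ha₁ a ha₁'
  have hex : ∃ b, a ≤ b ^ T := ⟨a, Nat.le_self_pow (by omega) a⟩
  obtain ⟨b, hb, hmin⟩ : ∃ b, a ≤ b ^ T ∧ ∀ c < b, c ^ T < a :=
    ⟨Nat.find hex, Nat.find_spec hex, fun c hc => not_le.mp (Nat.find_min hex hc)⟩
  -- Otherwise a ≤ b ^ T ≤ (2T) ^ T, against the choice of the lower bound on a.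
  have hbT : 2 * T < b := by
    by_contra hcon
    have := Nat.pow_le_pow_left (not_lt.mp hcon) T
    omega
  have hb2 : b ^ T ≤ 2 * a :=
    (pow_le_two_mul_pred_pow hbT).trans (Nat.mul_le_mul_left 2 (hmin _ (by omega)).le)
  have hbx : (b : ℝ) - 1 < (a : ℝ) ^ δ := by
    have h1 : ((b - 1 : ℕ) : ℝ) ^ T < ((a : ℝ) ^ δ) ^ T := by
      calc ((b - 1 : ℕ) : ℝ) ^ T < a := by exact_mod_cast hmin (b - 1) (by omega)
        _ = (a : ℝ) ^ (1 : ℝ) := (Real.rpow_one _).symm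
        _ ≤ (a : ℝ) ^ (δ * T) :=
          Real.rpow_le_rpow_of_exponent_le (by exact_mod_cast (by omega : 1 ≤ a)) hTδ
        _ = ((a : ℝ) ^ δ) ^ T := Real.rpow_mul_natCast (Nat.cast_nonneg a) δ T
    have h2 := lt_of_pow_lt_pow_left₀ T (by linarith) h1
    rwa [Nat.cast_sub (by omega), Nat.cast_one] at h2
  have hSx : ((a : ℝ) ^ δ) ^ 3 ≤ S := by
    rwa [Real.rpow_pow_comm (Nat.cast_nonneg a)]
  generalize (a : ℝ) ^ δ = x at *
  -- Here x = a ^ δ ≥ 2 and S ≥ x ^ 3, while b < x + 1. So S exceeds both b and 3.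
  have hx3 : 4 * x ≤ x ^ 3 := by
    nlinarith [mul_nonneg (mul_nonneg (by linarith : 0 ≤ x) (sub_nonneg.mpr hx))
      (by linarith : 0 ≤ x + 2)]
  have hbS : b ≤ S := by
    have : (b : ℝ) ≤ S := by linarith
    exact_mod_cast this
  have hS3 : 3 ≤ S := by
    have : (3 : ℝ) ≤ S := by linarith
    exact_mod_cast this
  have hedges : a ^ 2 * b ^ T ≤ 2 * a ^ 3 :=
    (Nat.mul_le_mul_left _ hb2).trans_eq (by ring)
  refine ⟨b, ha2, hT1, haT', hb, hmin, hbS, hS3, ?_, ?_, ?_, ?_, ?_, ?_⟩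
  · have h1 : S ≤ 2 * b * (S / b) := by
      have h2 := Nat.div_add_mod S b
      have h3 := Nat.mod_lt S (show b > 0 by omega)
      have h4 : b * 1 ≤ b * (S / b) := Nat.mul_le_mul_left b (Nat.div_pos hbS (by omega))
      linarith
    refine Nat.le_of_mul_le_mul_left ?_ (show 0 < 2 * b by omega)
    calc 2 * b * (a ^ 2 * b ^ (T - 1)) = 2 * (a ^ 2 * b ^ T) := by
          conv_rhs => rw [← Nat.sub_add_cancel hT1, pow_succ]
          ring
      _ ≤ 2 * (2 * a ^ 3) := Nat.mul_le_mul_left 2 hedges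
      _ ≤ 6 * a ^ 3 := by omega
      _ ≤ M * S := hMS
      _ ≤ M * (2 * b * (S / b)) := Nat.mul_le_mul_left M h1
      _ = 2 * b * (M * (S / b)) := by ring
  -- Rounding S / 3 down loses at most another factor 2 because S ≥ 3. This is the origin of the
  -- constant 6; the replication phase needs only 4.
  · have h1 : S ≤ 6 * (S / 3) := by omega
    refine Nat.le_of_mul_le_mul_left ?_ (show 0 < 6 by norm_num)
    calc 6 * a ^ 3 ≤ M * S := hMS
      _ ≤ M * (6 * (S / 3)) := Nat.mul_le_mul_left M h1
      _ = 6 * (M * (S / 3)) := by ring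
  · refine (pow_lt_wordBound (by omega) (hedges.trans ?_)).le
    have h1 : 2 ≤ a ^ 3 := ha2.trans (Nat.le_self_pow (by norm_num) a)
    calc 2 * a ^ 3 ≤ a ^ 3 * a ^ 3 := Nat.mul_le_mul_right _ h1
      _ = (a ^ 3) ^ 2 := (sq _).symm
      _ ≤ (a ^ 3) ^ κ := Nat.pow_le_pow_right (by omega) hκ
  · exact pow_lt_wordBound (by omega) (Nat.le_self_pow (by omega) _)
  · exact pow_lt_wordBound (by omega) hSn
  · exact pow_lt_wordBound (by omega) hMn

theorem ncard_edgeSet_lollipop_le {a : ℕ} (ha : 2 ≤ a) (B : Finset (ℕ × ℕ)) :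
    (lollipop a B).G.edgeSet.ncard ≤ 2 * a ^ 3 := by
  classical
  set E : Finset (Sym2 ℕ) := (Finset.range (a ^ 3)).image (fun u => s(u, u + 1)) ∪
    (Finset.Ioc (a ^ 3 - a) (a ^ 3) ×ˢ Finset.Ioc (a ^ 3 - a) (a ^ 3)).image
      (fun p => s(p.1, p.2)) with hE
  have hsub : (lollipop a B).G.edgeSet ⊆ E := by
    intro e
    induction e using Sym2.ind with
    | h u v =>
      intro he
      have hadj : (lollipopGraph a B).Adj u v := he
      simp only [lollipopGraph, SimpleGraph.fromRel_adj, freePairs, Finset.mem_filter] at hadj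
      rw [hE, Finset.mem_coe, Finset.mem_union, Finset.mem_image, Finset.mem_image]
      rcases hadj with ⟨-, (⟨-, rfl, h⟩ | ⟨-, h, -⟩) | (⟨-, rfl, h⟩ | ⟨-, h, -⟩)⟩
      · exact Or.inl ⟨u, Finset.mem_range.mpr h, rfl⟩
      · exact Or.inr ⟨_, h, rfl⟩
      · exact Or.inl ⟨v, Finset.mem_range.mpr h, Sym2.eq_swap⟩
      · exact Or.inr ⟨_, h, Sym2.eq_swap⟩
  have hle : a ≤ a ^ 3 := Nat.le_self_pow (by norm_num) a
  calc (lollipop a B).G.edgeSet.ncard ≤ (E : Set (Sym2 ℕ)).ncard :=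
        Set.ncard_le_ncard hsub E.finite_toSet
    _ = E.card := Set.ncard_coe_finset E
    _ ≤ a ^ 3 + a * a := by
        refine (Finset.card_union_le _ _).trans (Nat.add_le_add ?_ ?_)
        · exact Finset.card_image_le.trans_eq (Finset.card_range _)
        · refine Finset.card_image_le.trans_eq ?_
          rw [Finset.card_product, Nat.card_Ioc, Nat.sub_sub_self hle]
    _ ≤ 2 * a ^ 3 := by nlinarith [Nat.mul_le_mul_right (a * a) ha]

theorem trianglesAlg_solves {κ : ℕ} (hκ : 2 ≤ κ) {δ : ℝ} (hδ : 0 < δ) (hδ' : δ < 1) :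
    ∃ a₀ : ℕ, ∀ a ≥ a₀, ∀ M S : ℕ, ((a : ℝ) ^ 3) ^ δ ≤ S → 6 * a ^ 3 ≤ M * S →
      M ≤ (a ^ 3) ^ κ → S ≤ (a ^ 3) ^ κ →
      MPCSolves (trianglesAlg ⌈1 / δ⌉₊) (lollipopTriangles κ (one_le_two.trans hκ) {a})
        (fun _ => M) (fun _ => S) (fun _ => ⌊((6 : ℕ) : ℝ) / δ⌋₊) := by
  obtain ⟨a₀, h⟩ := exists_listingParams hκ hδ
  refine ⟨a₀, fun a ha M S hS hMS hMn hSn => ?_⟩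
  obtain ⟨b, hp⟩ := h a ha M S hS hMS hMn hSn
  rintro I ⟨_, rfl, B, -, rfl⟩
  rw [lollipop_nodes]
  refine ⟨hp.M_lt, hp.S_lt, ?_, fun inp hinp => ?_⟩
  · have := ncard_edgeSet_lollipop_le hp.two_le_a B
    dsimp only
    omega
  · have hR : ⌈1 / δ⌉₊ + 2 ≤ ⌊((6 : ℕ) : ℝ) / δ⌋₊ := by
      refine Nat.le_floor ?_
      have h1 := (Nat.ceil_lt_add_one (show 0 ≤ 1 / δ by positivity)).le
      have h2 : 1 ≤ 1 / δ := (one_le_div hδ).mpr hδ'.le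
      have h3 : ((6 : ℕ) : ℝ) / δ = 6 * (1 / δ) := by push_cast; ring
      rw [h3]
      push_cast
      linarith
    obtain ⟨conf, h1, h2, h3⟩ := trianglesAlg_run hp hR hinp
    exact ⟨conf, h1, h2, _, rfl, h3⟩

end DistSim

/-! ### Assembly of the five statements -/

theorem mainTheorem3 (κ : ℕ) (hκ : 2 ≤ κ) :
    -- impossibility of constant-slowdown simulation
    (∃ c : ℝ, 0 < c ∧ ∀ a : ℕ → ℕ,
      (fun n : ℕ => (n : ℝ) ^ (1 / 3 : ℝ)) =O[Filter.atTop] (fun n : ℕ => (a n : ℝ)) →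
      (∀ᶠ n in Filter.atTop, 2 * a n ≤ n + 1) →
      ∀ M S : ℕ → ℕ,
        (∀ᶠ n in Filter.atTop, n ≤ M n * S n ∧
          (M n : ℝ) * S n ≤ (a n : ℝ) * n / (c * Real.log n)) →
        ¬ MPCLeNCC (boundedArboricity κ a) (fun _ => 1) M S (fun n => M n * S n / n)) ∧
    -- lollipop graphs with `a ^ 3` nodes have arboricity at most `a`
    (∀ a : ℕ, ∀ B ∈ (freePairs a).powerset, arboricity (lollipop a B).G ≤ a) ∧
    -- MPC lists the triangles of lollipop graphs in `O(1 / δ)` rounds, with linear total memory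
    (∃ K : ℕ, ∀ δ : ℝ, 0 < δ → δ < 1 → ∃ (A : MPCAlgorithm) (a₀ : ℕ), ∀ a ≥ a₀, ∀ M S : ℕ,
      ((a : ℝ) ^ 3) ^ δ ≤ S → K * a ^ 3 ≤ M * S → M ≤ (a ^ 3) ^ κ → S ≤ (a ^ 3) ^ κ →
      MPCSolves A (lollipopTriangles κ (one_le_two.trans hκ) {a}) (fun _ => M) (fun _ => S)
        (fun _ => ⌊(K : ℝ) / δ⌋₊)) ∧
    -- NCC needs `Ω(a / (C log n))` rounds in expectation, where `n = a ^ 3`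
    (∃ c' : ℝ, 0 < c' ∧ ∃ a₀ : ℕ, ∀ a ≥ a₀, ∀ (C : ℕ) (A : NCCAlgorithm) (τ : Instance → ℕ),
      NCCSolves A (lollipopTriangles κ (one_le_two.trans hκ) {a}) (fun _ => C) τ →
      c' * (a / (C * Real.log ((a : ℝ) ^ 3))) ≤ lollipopExpectation a τ) ∧
    -- hence no number `t` of rounds suffices in `NCC(MS / n)` below a threshold `a n / (c log n)`
    (∀ t : ℕ, ∃ c : ℝ, 0 < c ∧ ∃ a₀ : ℕ, ∀ a ≥ a₀, ∀ M S : ℕ,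
      a ^ 3 ≤ M * S →
      (M : ℝ) * S ≤ a * (a : ℝ) ^ 3 / (c * Real.log ((a : ℝ) ^ 3)) →
      ∀ (A : NCCAlgorithm) (τ : Instance → ℕ),
        NCCSolves A (lollipopTriangles κ (one_le_two.trans hκ) {a})
          (fun _ => M * S / a ^ 3) τ →
        ∃ B ∈ (freePairs a).powerset, t < τ (lollipop a B)) := by
  have hκ1 : 1 ≤ κ := one_le_two.trans hκ
  -- The constant c = 1 suffices in the first statement, since the clique argument only needs log n
  -- to outgrow every constant.
  refine ⟨⟨1, one_pos, fun a _ ha M S hMS => not_mpcLeNCC hκ a M S ha hMS⟩,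
    fun a B _ => arboricity_lollipop_le a B, ⟨6, fun δ hδ hδ' => ?_⟩,
    ⟨1 / (16 * 12288 * (3 * κ + 5)), by positivity, 12288, fun a ha C A τ hA =>
      lollipop_ncc_expectation_lower_bound hκ1 ha hA⟩,
    fun t => ⟨(t + 1) * (16 * 12288 * (3 * κ + 5)), by positivity, 12288,
      fun a ha M S hMS hMS' A τ hA => lollipop_ncc_exists_slow hκ1 t ha hMS hMS' hA⟩⟩
  obtain ⟨a₀, h⟩ := trianglesAlg_solves hκ hδ hδ'
  exact ⟨trianglesAlg ⌈1 / δ⌉₊, a₀, h⟩
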